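/- **Parameters and notation.** Let $\varepsilon,\nu\in[0,1)$, $\kappa\in(0,1)$, $R>0$, $\tau_{\rm buoy}\in\mathbb R$, $T>0$, and let $F_{\rm ext}:[0,T)\to\mathbb R$ be bounded and continuous. Let $\zeta_{\rm eq}\in\mathbb R$ be the (constant) surface elevation under the cylinder at equilibrium, with $h_{\rm i,eq}:=1+\varepsilon\zeta_{\rm eq}>0$ (so $\zeta_{\rm eq}=(h_{\rm i,eq}-1)/\varepsilon$ if $\varepsilon>0$). Archimedes' principle at equilibrium gives the mass $m=1-h_{\rm i,eq}$, i.e. $m/\varepsilon=-\zeta_{\rm eq}$. Write $p=P/\varepsilon$ for the rescaled surface pressure, $h=1+\varepsilon\zeta$, ${\rm d}_rf=\partial_rf+f/r$, $\dot f=\partial_tf$, $\mathcal I=\{|x|<R\}\subset\mathbb R^2$; an underline denotes the trace at $r=R$, taken from $r>R$ for exterior functions (index e) and from $r<R$ for interior ones (index i), and $[f]_\Gamma=\underline{f_{\rm e}}-\underline{f_{\rm i}}$. **Regularity.** A pair $(\zeta,q)$ of functions on $[0,T)\times[R,\infty)$ is called regular if $\zeta,q,\partial_rq$ are $C^1$ up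 to the boundary and, for all $t\in[0,T)$, the functions $\zeta,\partial_r\zeta,q,\partial_rq,\partial_r{\rm d}_rq,\partial_tq,{\rm d}_r\partial_tq$ belong to $L^2((R,\infty),r\,dr)$. **Wave–structure problem**, with data $(\zeta_0,q_0,\delta_0,\delta_1)$: find $\zeta,q,p$ (functions of $t\in[0,T)$, $r>0$) and a twice differentiable $\delta$ with $h>0$ such that, classically for $r\in(0,R)\cup(R,\infty)$, $$\partial_t\zeta+{\rm d}_rq=0,\qquad (1-\kappa^2\partial_r{\rm d}_r)\partial_tq+\varepsilon\,{\rm d}_r\Big(\frac{q^2}{h}\Big)+h\partial_r\zeta=-h\,\partial_rp+\nu h\,\partial_r\frac{{\rm d}_rq}{h},$$ with $\zeta=\delta+\zeta_{\rm eq}$ (i.e. $h_{\rm i}=h_{\rm i,eq}+\varepsilon\delta$) for $r<R$, $p=0$ for $r>R$, $q\to0$ as $r\to0$; Newton's equation $$\tau_{\rm buoy}^2\ddot\delta+\frac m\varepsilon=\frac1{|\mathcal I|}\int_{\mathcal I}p\,dx+F_{\rm ext};$$ the transmission conditions $$[q]_\Gamma=0,\qquad \Big[p+\zeta+\nu\dot\zeta+\kappa^2\ddot\zeta+\frac\varepsilon2\frac{q^2}{h^2}\Big]_\Gamma=0,\qquad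 \Big[\frac{q}{h}\,e_r\times n_\Gamma\Big]_\Gamma=0\quad(n_\Gamma=e_r);$$ and the initial conditions $(\zeta_{\rm e},q_{\rm e})|_{t=0}=(\zeta_0,q_0)$, $(\delta,\dot\delta)|_{t=0}=(\delta_0,\delta_1)$. **Operators.** $w=\mathfrak R_0f$ is the solution of $(1-\kappa^2\partial_r{\rm d}_r)w=f$ in $(R,\infty)$ with $\underline w=0$, $w\to0$ at infinity; $v=\mathfrak R_1f$ is the solution of $(1-\kappa^2{\rm d}_r\partial_r)v=f$ in $(R,\infty)$ with $\underline{\partial_rv}=0$, $v\to0$ at infinity. $K_0,K_1$ are the modified Bessel functions of the second kind. For $u=(\zeta,q)$ on $(R,\infty)$ and $Z\in\mathbb R^4$ put $$f_{\rm hyd}=\mathfrak R_1\Big(\zeta-\nu{\rm d}_rq+\varepsilon\big(\tfrac{\zeta^2}2+\tfrac{q^2}h\big)\Big)+\varepsilon\kappa^2{\rm d}_r\mathfrak R_0\Big(\frac{q^2}{rh}\Big)+\nu\kappa^2{\rm d}_r\mathfrak R_0\big(\partial_r(\ln h)\,{\rm d}_rq\big),\qquad \mathcal I_{\rm hyd}u=\underline{f_{\rm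 hyd}},$$ $$h_{\rm i}=h_{\rm i,eq}+\varepsilon Z_1,\quad \tau_\kappa^2(\varepsilon Z_1)=\tau_{\rm buoy}^2+\kappa^2+\frac{R^2}{8h_{\rm i}},\quad G=\frac R2\frac{K_0(R/\kappa)}{K_1(R/\kappa)},\quad \mathfrak f=\frac{Z_3^2}2+\frac{R^2Z_2^2}{4(1+\varepsilon Z_3)},\quad a=\frac{R^2}{16h_{\rm i}^2}+\frac{R^2}{8(1+\varepsilon Z_3)^2},$$ $$\gamma=\frac{R^2Z_1\big(\varepsilon aZ_2^2-\varepsilon\mathfrak f-Z_1-\nu Z_2+\underline{f_{\rm hyd}}+F_{\rm ext}\big)}{8h_{\rm i,eq}h_{\rm i}(\tau_\kappa^2(\varepsilon Z_1)+\kappa G)}+aZ_2^2,\qquad \mathcal D=\frac{\varepsilon\gamma+\underline{f_{\rm hyd}}-\varepsilon\mathfrak f-Z_1-\nu Z_2+F_{\rm ext}}{\tau_\kappa^2(0)+\kappa G},$$ $$\widetilde{\mathfrak F}_\kappa[u,Z]=\begin{pmatrix}q\\ \mathfrak R_1\big(\zeta-\nu{\rm d}_rq+\varepsilon(\frac{\zeta^2}2+\frac{q^2}h)\big)-\mathcal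 D\,\frac{\kappa R}2\frac{K_0(r/\kappa)}{K_1(R/\kappa)}\end{pmatrix},\quad \mathcal S_r(u)=-\begin{pmatrix}q/r\\ \varepsilon\mathfrak R_0(\frac{q^2}{rh})\end{pmatrix},\quad \mathcal S_\nu(u)=\begin{pmatrix}0\\-\mathfrak R_0\big(\partial_r(\frac{\ln h}\varepsilon){\rm d}_rq\big)\end{pmatrix}$$ (with $\nu\varepsilon\mathcal S_\nu=0$ if $\varepsilon=0$), and $\widetilde{\mathfrak D}(Z,\mathcal I_{\rm hyd}u,F_{\rm ext})=\mathcal M^{-1}\big(\mathcal TZ-(0,F_{\rm ext},0,\mathcal I_{\rm hyd}u)^T-\varepsilon(0,\gamma,0,-\mathfrak f)^T\big)$ with $$\mathcal M=\begin{pmatrix}1&0&0&0\\ \nu&\tau_\kappa^2(0)&-\nu&-\kappa^2\\0&0&1&0\\0&\kappa G&\nu&\kappa^2\end{pmatrix},\qquad \mathcal T=\begin{pmatrix}0&-1&0&0\\1&0&-1&0\\0&0&0&-1\\0&0&1&0\end{pmatrix}.$$ **Augmented system**, with data $(\zeta_0,q_0,\delta_0,\delta_1)$: $1+\varepsilon u_1>0$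 on $[R,\infty)$, $h_{\rm i,eq}+\varepsilon Z_1>0$, and on $[0,T)$ $$\partial_tu+\partial_r\widetilde{\mathfrak F}_\kappa[u,Z]=\mathcal S_r(u)+\nu\varepsilon\,\mathcal S_\nu(u)\ \text{ in }(R,\infty),\qquad \partial_tZ+\widetilde{\mathfrak D}(Z,\mathcal I_{\rm hyd}u,F_{\rm ext})=0,\qquad \underline{u_1}=Z_3,\quad \underline{u_2}=-\tfrac R2Z_2,$$ $$u|_{t=0}=(\zeta_0,q_0),\qquad Z|_{t=0}=(\delta_0,\delta_1,\underline{\zeta_0},-\underline{{\rm d}_rq_0}).$$ **Theorem.** (1) Let $(\zeta,q,p,\delta)$ solve the wave–structure problem with $(\zeta_{\rm e},q_{\rm e})$ regular. Then all terms of the augmented system are well defined for $u:=(\zeta_{\rm e},q_{\rm e})$ at every $t\in[0,T)$, and $u$ together with $Z:=(\delta,\dot\delta,\underline{\zeta_{\rm e}},\underline{\dot\zeta_{\rm e}})$ solves the augmented system with the same data. (2) Conversely, let $(u,Z)$ solve the augmented system, with $u$ regular. For $r<R$ put $\zeta_{\rm i}=Z_1+\zeta_{\rm eq}$ (that is, $\varepsilon^{-1}(\varepsilon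 Z_1+h_{\rm i,eq}-1)$ if $\varepsilon>0$), $q_{\rm i}(r)=-\frac r2Z_2$ and $$p_{\rm i}(r)=\frac{P_{\rm i}(r)}\varepsilon=\frac{r^2-R^2}{2(1+\varepsilon\zeta_{\rm i})}\Big(\frac{\dot Z_2}2-\frac{3\varepsilon Z_2^2}{4(1+\varepsilon\zeta_{\rm i})}\Big)+Z_3-\zeta_{\rm i}+\nu(Z_4-\dot\zeta_{\rm i})+\kappa^2(\dot Z_4-\ddot\zeta_{\rm i})+\frac\varepsilon2\Big(\frac{\underline{u_2}^2}{(1+\varepsilon\underline{u_1})^2}-\frac{\underline{q_{\rm i}}^2}{(1+\varepsilon\zeta_{\rm i})^2}\Big).$$ Then $(\zeta,q,p):=(u_1,u_2,0)$ for $r>R$, $(\zeta_{\rm i},q_{\rm i},p_{\rm i})$ for $r<R$, together with $\delta:=Z_1$ (and $\dot\delta=Z_2$), solve the wave–structure problem with the same data; in particular Newton's equation, the radial Boussinesq–Abbott system in both domains and the three transmission conditions hold. -/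

import Mathlib

open Set Filter Topology MeasureTheory

noncomputable section

namespace FloatingCylinder

/-! ### Physical parameters -/

/-- Parameters of the dimensionless floating-cylinder problem: the nonlinearity parameter `ε`, the
shallowness (dispersion) parameter `κ`, the viscosity parameter `ν`, the radius `R` of the cylinder,
the buoyancy parameter `τ` (only its square occurs), and the surface elevation `ζeq` under the
cylinder at equilibrium.  The latter encodes the height of the wet surface at equilibrium,
`hEq = 1 + ε ζeq`; for `ε > 0` it is `ζeq = (hEq - 1) / ε`. -/
structure Params where
  ε : ℝ
  κ : ℝ
  ν : ℝ
  R : ℝ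
  τ : ℝ
  ζeq : ℝ

/-- Height (from the bottom of the basin) of the flat wet surface at equilibrium. -/
def Params.hEq (P : Params) : ℝ := 1 + P.ε * P.ζeq

/-- The rescaled weight `m / ε` of the cylinder.  By Archimedes' principle (balance of forces at
equilibrium) `m = 1 - hEq`, i.e. `m / ε = - ζeq`. -/
def Params.weight (P : Params) : ℝ := -P.ζeq

/-- The standing assumptions on the parameters. -/
structure Params.Admissible (P : Params) : Prop where
  ε_nonneg : 0 ≤ P.ε
  ε_lt_one : P.ε < 1
  κ_pos : 0 < P.κ
  κ_lt_one : P.κ < 1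
  ν_nonneg : 0 ≤ P.ν
  ν_lt_one : P.ν < 1
  R_pos : 0 < P.R
  hEq_pos : 0 < P.hEq

/-! ### Differential operators, traces, jumps, weighted Lebesgue space -/

/-- Time derivative at time `t` of a function on the time interval `[0, T)` (one-sided at `0`). -/
def dt {E : Type*} [NormedAddCommGroup E] [NormedSpace ℝ E] (T : ℝ) (f : ℝ → E) (t : ℝ) : E :=
  derivWithin f (Ico 0 T) t

/-- Radial divergence `d_r f = ∂_r f + f / r`. -/
def dr (f : ℝ → ℝ) (r : ℝ) : ℝ := deriv f r + f r / r

/-- Trace at `r = R` from the exterior side `r > R`. -/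
def trace (R : ℝ) (f : ℝ → ℝ) : ℝ := limUnder (𝓝[>] R) f

/-- The jump of `f` across `r = R` vanishes: both one-sided limits exist and are equal. -/
def JumpZero (R : ℝ) (f : ℝ → ℝ) : Prop :=
  ∃ a : ℝ, Tendsto f (𝓝[>] R) (𝓝 a) ∧ Tendsto f (𝓝[<] R) (𝓝 a)

/-- The unit radial vector of the plane at angle `θ`. -/
def er (θ : ℝ) : ℝ × ℝ := (Real.cos θ, Real.sin θ)

/-- The (scalar) cross product of the plane. -/
def cross (a b : ℝ × ℝ) : ℝ := a.1 * b.2 - a.2 * b.1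

/-- `f` belongs to `L²((R, ∞), r dr)`. -/
def MemL2r (R : ℝ) (f : ℝ → ℝ) : Prop :=
  MemLp f 2 ((volume.restrict (Ioi R)).withDensity fun r => ENNReal.ofReal r)

/-! ### Regularity class in the exterior domain -/

/-- Regularity of the exterior unknowns `(ζ, q)`, functions of `(t, r) ∈ [0, T) × [R, ∞)`:
`ζ`, `q` and `∂_r q` are continuously differentiable up to the boundary, and for every time
`(ζ, q)` belongs to `H¹_r × H²_κ` and `∂_t q` belongs to `H¹_κ`.  (The second time derivative of
`ζ` is not required separately: the mass conservation `∂_t ζ = - d_r q` provides it.) -/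
structure RegularExterior (R T : ℝ) (ζ q : ℝ → ℝ → ℝ) : Prop where
  smooth_ζ : ContDiffOn ℝ 1 (fun x : ℝ × ℝ => ζ x.1 x.2) (Ico 0 T ×ˢ Ici R)
  smooth_q : ContDiffOn ℝ 1 (fun x : ℝ × ℝ => q x.1 x.2) (Ico 0 T ×ˢ Ici R)
  smooth_dq : ContDiffOn ℝ 1 (fun x : ℝ × ℝ => derivWithin (q x.1) (Ici R) x.2)
    (Ico 0 T ×ˢ Ici R)
  mem_ζ : ∀ t ∈ Ico 0 T, MemL2r R (ζ t)
  mem_dζ : ∀ t ∈ Ico 0 T, MemL2r R (deriv (ζ t))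
  mem_q : ∀ t ∈ Ico 0 T, MemL2r R (q t)
  mem_dq : ∀ t ∈ Ico 0 T, MemL2r R (deriv (q t))
  mem_ddq : ∀ t ∈ Ico 0 T, MemL2r R (deriv (dr (q t)))
  mem_qt : ∀ t ∈ Ico 0 T, MemL2r R (fun r => dt T (fun s => q s r) t)
  mem_dqt : ∀ t ∈ Ico 0 T, MemL2r R (dr fun r => dt T (fun s => q s r) t)

/-! ### The radial Boussinesq-Abbott system and the wave-structure problem -/

/-- `(ζ, q, p)` is a classical solution at the point `(t, r)` of the radial Boussinesq-Abbott
system, where `p` stands for the rescaled surface pressure `P / ε` and `h = 1 + ε ζ`. -/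
structure SolvesBArAt (P : Params) (T : ℝ) (ζ q p : ℝ → ℝ → ℝ) (t r : ℝ) : Prop where
  diff_ζt : DifferentiableWithinAt ℝ (fun s => ζ s r) (Ico 0 T) t
  diff_ζ : DifferentiableAt ℝ (ζ t) r
  diff_qt : DifferentiableWithinAt ℝ (fun s => q s r) (Ico 0 T) t
  diff_q : DifferentiableAt ℝ (q t) r
  diff_dq : DifferentiableAt ℝ (dr (q t)) r
  diff_qtr : DifferentiableAt ℝ (fun ρ => dt T (fun s => q s ρ) t) r
  diff_dqt : DifferentiableAt ℝ (dr fun ρ => dt T (fun s => q s ρ) t) r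
  diff_p : DifferentiableAt ℝ (p t) r
  mass : dt T (fun s => ζ s r) t + dr (q t) r = 0
  momentum :
    (dt T (fun s => q s r) t - P.κ ^ 2 * deriv (dr fun ρ => dt T (fun s => q s ρ) t) r)
      + P.ε * dr (fun ρ => q t ρ ^ 2 / (1 + P.ε * ζ t ρ)) r
      + (1 + P.ε * ζ t r) * deriv (ζ t) r
    = - (1 + P.ε * ζ t r) * deriv (p t) r
      + P.ν * (1 + P.ε * ζ t r) * deriv (fun ρ => dr (q t) ρ / (1 + P.ε * ζ t ρ)) r

/-- The full axisymmetric wave-structure problem on `[0, T)`.  The unknowns `ζ`, `q`, `p = P / ε` are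
functions of `(t, r)`; the interior domain is `0 < r < R`, the exterior domain is `r > R` (values at
`r = R` are those of the exterior domain); `δ` is the displacement of the cylinder.  The initial data
are `ζ₀`, `q₀` (exterior) and `δ₀`, `δ₁`. -/
structure SolvesWaveStructure (P : Params) (T : ℝ) (F : ℝ → ℝ) (ζ₀ q₀ : ℝ → ℝ) (δ₀ δ₁ : ℝ)
    (ζ q p : ℝ → ℝ → ℝ) (δ : ℝ → ℝ) : Prop where
  /-- the water height does not vanish -/
  height_pos : ∀ t ∈ Ico 0 T, ∀ r, 0 < r → 0 < 1 + P.ε * ζ t r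
  /-- the radial Boussinesq-Abbott system in the interior and in the exterior domain -/
  bar : ∀ t ∈ Ico 0 T, ∀ r, 0 < r → r ≠ P.R → SolvesBArAt P T ζ q p t r
  /-- in the interior the water fits the wet surface: `ζ_i = δ + ζeq`, i.e. `h_i = ε δ + hEq` -/
  interior_constraint : ∀ t ∈ Ico 0 T, ∀ r, 0 < r → r < P.R → ζ t r = δ t + P.ζeq
  /-- the vector field `q e_r` is continuous at the centre -/
  centre : ∀ t ∈ Ico 0 T, Tendsto (q t) (𝓝[>] 0) (𝓝 0)
  /-- constant (zero) surface pressure in the exterior -/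
  exterior_pressure : ∀ t ∈ Ico 0 T, ∀ r, P.R < r → p t r = 0
  diff_δ : DifferentiableOn ℝ δ (Ico 0 T)
  diff_dδ : DifferentiableOn ℝ (dt T δ) (Ico 0 T)
  /-- Newton's equation for the cylinder, with the mean of the pressure over the disc -/
  newton : ∀ t ∈ Ico 0 T,
    P.τ ^ 2 * dt T (dt T δ) t + P.weight
      = (⨍ x in Metric.ball (0 : EuclideanSpace ℝ (Fin 2)) P.R, p t ‖x‖) + F t
  /-- conservation of the fluid volume at the contact line -/
  volume_cons : ∀ t ∈ Ico 0 T, JumpZero P.R (q t)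
  /-- conservation of the energy at the contact line -/
  energy_cons : ∀ t ∈ Ico 0 T, JumpZero P.R fun r =>
    p t r + ζ t r + P.ν * dt T (fun s => ζ s r) t
      + P.κ ^ 2 * dt T (dt T fun s => ζ s r) t
      + P.ε / 2 * (q t r ^ 2 / (1 + P.ε * ζ t r) ^ 2)
  /-- no vortex line at the contact line; the normal at angle `θ` is `er θ` -/
  no_vortex : ∀ t ∈ Ico 0 T, ∀ θ : ℝ, JumpZero P.R fun r =>
    cross ((q t r / (1 + P.ε * ζ t r)) • er θ) (er θ)
  init_ζ : ∀ r, P.R < r → ζ 0 r = ζ₀ r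
  init_q : ∀ r, P.R < r → q 0 r = q₀ r
  init_δ : δ 0 = δ₀
  init_dδ : dt T δ 0 = δ₁

/-! ### Bessel functions and the regularizing operators -/

/-- Modified Bessel function of the second kind (for `x > 0`). -/
def besselK (α x : ℝ) : ℝ := ∫ s in Ioi (0 : ℝ), Real.exp (-x * Real.cosh s) * Real.cosh (α * s)

/-- `u = 𝕽₀ f`: the solution vanishing at infinity of `(1 - κ² ∂_r d_r) u = f` on `(R, ∞)` with
homogeneous Dirichlet condition at `R`. -/
structure IsR0 (κ R : ℝ) (f u : ℝ → ℝ) : Prop where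
  diff : ∀ r, R < r → DifferentiableAt ℝ u r
  diff' : ∀ r, R < r → DifferentiableAt ℝ (dr u) r
  eqn : ∀ r, R < r → u r - κ ^ 2 * deriv (dr u) r = f r
  bdry : Tendsto u (𝓝[>] R) (𝓝 0)
  decay : Tendsto u atTop (𝓝 0)

/-- `v = 𝕽₁ f`: the solution vanishing at infinity of `(1 - κ² d_r ∂_r) v = f` on `(R, ∞)` with
homogeneous Neumann condition at `R`. -/
structure IsR1 (κ R : ℝ) (f v : ℝ → ℝ) : Prop where
  diff : ∀ r, R < r → DifferentiableAt ℝ v r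
  diff' : ∀ r, R < r → DifferentiableAt ℝ (deriv v) r
  eqn : ∀ r, R < r → v r - κ ^ 2 * dr (deriv v) r = f r
  bdry : Tendsto (deriv v) (𝓝[>] R) (𝓝 0)
  decay : Tendsto v atTop (𝓝 0)

/-- The operator `𝕽₀`. -/
def R0 (κ R : ℝ) (f : ℝ → ℝ) : ℝ → ℝ := Classical.epsilon (IsR0 κ R f)

/-- The operator `𝕽₁`. -/
def R1 (κ R : ℝ) (f : ℝ → ℝ) : ℝ → ℝ := Classical.epsilon (IsR1 κ R f)

/-! ### The augmented system

The exterior unknown at a given time is `u : ℝ → ℝ × ℝ`, `u r = (ζ r, q r)`; the boundary unknown is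
`Z = (δ, δ', ζ(R), ζ'(R))`. -/

/-- `ζ - ν d_r q + ε (ζ² / 2 + q² / h)`. -/
def fluxArg (P : Params) (u : ℝ → ℝ × ℝ) (r : ℝ) : ℝ :=
  (u r).1 - P.ν * dr (fun ρ => (u ρ).2) r
    + P.ε * ((u r).1 ^ 2 / 2 + (u r).2 ^ 2 / (1 + P.ε * (u r).1))

/-- `q² / (r h)`. -/
def radialArg (P : Params) (u : ℝ → ℝ × ℝ) (r : ℝ) : ℝ :=
  (u r).2 ^ 2 / (r * (1 + P.ε * (u r).1))

/-- `∂_r (ln h / ε) d_r q`. -/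
def viscousArg (P : Params) (u : ℝ → ℝ × ℝ) (r : ℝ) : ℝ :=
  deriv (fun ρ => Real.log (1 + P.ε * (u ρ).1) / P.ε) r * dr (fun ρ => (u ρ).2) r

/-- `f_hyd = 𝕽₁(ζ - ν d_r q + ε (ζ²/2 + q²/h)) + ε κ² d_r 𝕽₀(q²/(r h))
  + ε ν κ² d_r 𝕽₀(∂_r (ln h / ε) d_r q)`. -/
def fHyd (P : Params) (u : ℝ → ℝ × ℝ) (r : ℝ) : ℝ :=
  R1 P.κ P.R (fluxArg P u) r
    + P.ε * P.κ ^ 2 * dr (R0 P.κ P.R (radialArg P u)) r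
    + P.ε * P.ν * P.κ ^ 2 * dr (R0 P.κ P.R (viscousArg P u)) r

/-- `𝓘_hyd u`, the trace of `f_hyd`. -/
def Ihyd (P : Params) (u : ℝ → ℝ × ℝ) : ℝ := trace P.R (fHyd P u)

/-- `h_i = hEq + ε δ`. -/
def hInt (P : Params) (δ : ℝ) : ℝ := P.hEq + P.ε * δ

/-- `τ_κ²(ε δ) = τ² + κ² + R² / (8 h_i)`. -/
def tauSq (P : Params) (δ : ℝ) : ℝ := P.τ ^ 2 + P.κ ^ 2 + P.R ^ 2 / (8 * hInt P δ)

/-- `G = (R / 2) K₀(R/κ) / K₁(R/κ)`. -/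
def G (P : Params) : ℝ := P.R / 2 * (besselK 0 (P.R / P.κ) / besselK 1 (P.R / P.κ))

/-- Trace at `R` of `ζ² / 2 + q² / h`, using `q(R) = - (R/2) Z₂`. -/
def fBdry (P : Params) (Z : Fin 4 → ℝ) : ℝ :=
  Z 2 ^ 2 / 2 + (-(P.R / 2) * Z 1) ^ 2 / (1 + P.ε * Z 2)

/-- `a = R² / (16 h_i²) + R² / (8 h_e(R)²)`. -/
def aCoef (P : Params) (Z : Fin 4 → ℝ) : ℝ :=
  P.R ^ 2 / (16 * hInt P (Z 0) ^ 2) + P.R ^ 2 / (8 * (1 + P.ε * Z 2) ^ 2)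

/-- The nonlinearity `γ(Z, f_hyd, F_ext)` of the equation of the solid. -/
def gam (P : Params) (Z : Fin 4 → ℝ) (I F : ℝ) : ℝ :=
  P.R ^ 2 * Z 0 / (8 * P.hEq * hInt P (Z 0) * (tauSq P (Z 0) + P.κ * G P))
      * (P.ε * aCoef P Z * Z 1 ^ 2 - P.ε * fBdry P Z - Z 0 - P.ν * Z 1 + I + F)
    + aCoef P Z * Z 1 ^ 2

/-- `𝓓(f_hyd, Z)`, the acceleration of the solid expressed without second derivatives. -/
def accel (P : Params) (Z : Fin 4 → ℝ) (I F : ℝ) : ℝ :=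
  (P.ε * gam P Z I F + I - P.ε * fBdry P Z - Z 0 - P.ν * Z 1 + F) / (tauSq P 0 + P.κ * G P)

/-- The flux `𝕱_κ[u, Z]`. -/
def flux (P : Params) (u : ℝ → ℝ × ℝ) (Z : Fin 4 → ℝ) (F : ℝ) (r : ℝ) : ℝ × ℝ :=
  ((u r).2,
    R1 P.κ P.R (fluxArg P u) r
      - accel P Z (Ihyd P u) F
        * (P.κ * P.R / 2 * (besselK 0 (r / P.κ) / besselK 1 (P.R / P.κ))))

/-- The radial source `𝓢_r(u)`. -/
def Sr (P : Params) (u : ℝ → ℝ × ℝ) (r : ℝ) : ℝ × ℝ :=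
  (-((u r).2 / r), -(P.ε * R0 P.κ P.R (radialArg P u) r))

/-- The viscous source `𝓢_ν(u)`. -/
def Snu (P : Params) (u : ℝ → ℝ × ℝ) (r : ℝ) : ℝ × ℝ :=
  (0, -R0 P.κ P.R (viscousArg P u) r)

/-- The matrix `𝓜`. -/
def matM (P : Params) : Matrix (Fin 4) (Fin 4) ℝ :=
  !![1, 0, 0, 0;
     P.ν, tauSq P 0, -P.ν, -P.κ ^ 2;
     0, 0, 1, 0;
     0, P.κ * G P, P.ν, P.κ ^ 2]

/-- The matrix `𝓣`. -/
def matT : Matrix (Fin 4) (Fin 4) ℝ :=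
  !![0, -1, 0, 0;
     1, 0, -1, 0;
     0, 0, 0, -1;
     0, 0, 1, 0]

/-- The linear forcing `P(f_hyd, F_ext)`. -/
def vecP (I F : ℝ) : Fin 4 → ℝ := ![0, F, 0, I]

/-- The nonlinear forcing. -/
def vecPtilde (P : Params) (Z : Fin 4 → ℝ) (I F : ℝ) : Fin 4 → ℝ :=
  ![0, gam P Z I F, 0, -fBdry P Z]

/-- `𝕯(Z, 𝓘_hyd u, F_ext) = 𝓜⁻¹ (𝓣 Z - P - ε P̃)`. -/
def Dtilde (P : Params) (Z : Fin 4 → ℝ) (I F : ℝ) : Fin 4 → ℝ :=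
  Matrix.mulVec (matM P)⁻¹ (Matrix.mulVec matT Z - vecP I F - P.ε • vecPtilde P Z I F)

/-- The nonlocal terms of the augmented system are meaningful for `u = (ζ, q)` at a given time: the
boundary value problems are solvable and the trace of `f_hyd` exists. -/
structure NonlocalDefined (P : Params) (u : ℝ → ℝ × ℝ) : Prop where
  flux_defined : IsR1 P.κ P.R (fluxArg P u) (R1 P.κ P.R (fluxArg P u))
  radial_defined : IsR0 P.κ P.R (radialArg P u) (R0 P.κ P.R (radialArg P u))
  viscous_defined : IsR0 P.κ P.R (viscousArg P u) (R0 P.κ P.R (viscousArg P u))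
  trace_defined : Tendsto (fHyd P u) (𝓝[>] P.R) (𝓝 (Ihyd P u))

/-- The augmented system on `[0, T)`, with initial data `ζ₀`, `q₀`, `δ₀`, `δ₁`. -/
structure SolvesAugmented (P : Params) (T : ℝ) (F : ℝ → ℝ) (ζ₀ q₀ : ℝ → ℝ) (δ₀ δ₁ : ℝ)
    (u : ℝ → ℝ → ℝ × ℝ) (Z : ℝ → Fin 4 → ℝ) : Prop where
  /-- the water height does not vanish -/
  height_ext : ∀ t ∈ Ico 0 T, ∀ r, P.R ≤ r → 0 < 1 + P.ε * (u t r).1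
  height_int : ∀ t ∈ Ico 0 T, 0 < hInt P (Z t 0)
  diff_t : ∀ t ∈ Ico 0 T, ∀ r, P.R < r → DifferentiableWithinAt ℝ (fun s => u s r) (Ico 0 T) t
  diff_flux : ∀ t ∈ Ico 0 T, ∀ r, P.R < r → DifferentiableAt ℝ (flux P (u t) (Z t) (F t)) r
  /-- the non-local conservation law with radial and viscous sources -/
  pde : ∀ t ∈ Ico 0 T, ∀ r, P.R < r →
    dt T (fun s => u s r) t + deriv (flux P (u t) (Z t) (F t)) r
      = Sr P (u t) r + (P.ν * P.ε) • Snu P (u t) r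
  diff_Z : DifferentiableOn ℝ Z (Ico 0 T)
  /-- the ordinary differential equation at the boundary -/
  ode : ∀ t ∈ Ico 0 T, dt T Z t + Dtilde P (Z t) (Ihyd P (u t)) (F t) = 0
  bdry_ζ : ∀ t ∈ Ico 0 T, Tendsto (fun r => (u t r).1) (𝓝[>] P.R) (𝓝 (Z t 2))
  bdry_q : ∀ t ∈ Ico 0 T, Tendsto (fun r => (u t r).2) (𝓝[>] P.R) (𝓝 (-(P.R / 2) * Z t 1))
  init_u : ∀ r, P.R < r → u 0 r = (ζ₀ r, q₀ r)
  /-- `Z(0) = (δ₀, δ₁, ζ(0, R), ζ'(0, R))`, with `ζ'(0, R) = - d_r q₀(R)` by mass conservation -/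
  init_Z : Z 0 = ![δ₀, δ₁, trace P.R ζ₀, -trace P.R (dr q₀)]

/-- `Z = (δ, δ', ζ_e(R), ζ_e'(R))`. -/
def bdryUnknown (P : Params) (T : ℝ) (ζ : ℝ → ℝ → ℝ) (δ : ℝ → ℝ) (t : ℝ) : Fin 4 → ℝ :=
  ![δ t, dt T δ t, trace P.R (ζ t), trace P.R fun r => dt T (fun s => ζ s r) t]

/-! ### Reconstruction of the interior unknowns -/

/-- `ζ_i = ε⁻¹ (ε Z₁ + hEq - 1) = Z₁ + ζeq`. -/
def zetaInt (P : Params) (Z : ℝ → Fin 4 → ℝ) (t : ℝ) : ℝ := Z t 0 + P.ζeq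

/-- `q_i(r) = - (r/2) Z₂`. -/
def qInt (Z : ℝ → Fin 4 → ℝ) (t r : ℝ) : ℝ := -(r / 2) * Z t 1

/-- The rescaled interior pressure `P_i / ε`. -/
def pInt (P : Params) (T : ℝ) (u : ℝ → ℝ → ℝ × ℝ) (Z : ℝ → Fin 4 → ℝ) (t r : ℝ) : ℝ :=
  (r ^ 2 - P.R ^ 2) / (2 * (1 + P.ε * zetaInt P Z t))
      * (dt T (fun s => Z s 1) t / 2 - 3 * P.ε * Z t 1 ^ 2 / (4 * (1 + P.ε * zetaInt P Z t)))
    + (Z t 2 - zetaInt P Z t)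
    + P.ν * (Z t 3 - dt T (zetaInt P Z) t)
    + P.κ ^ 2 * (dt T (fun s => Z s 3) t - dt T (dt T (zetaInt P Z)) t)
    + P.ε / 2 *
      (trace P.R (fun ρ => (u t ρ).2) ^ 2 / (1 + P.ε * trace P.R (fun ρ => (u t ρ).1)) ^ 2
        - qInt Z t P.R ^ 2 / (1 + P.ε * zetaInt P Z t) ^ 2)

/-- The function equal to `fi` in the interior `r < R` and to `fe` in the exterior. -/
def glue (R : ℝ) (fi fe : ℝ → ℝ → ℝ) (t r : ℝ) : ℝ := if r < R then fi t r else fe t r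

end FloatingCylinder

end

/-!
The two problems are equivalent because the exterior momentum equation can be solved for `∂_t q`.
At a fixed time it reads `(1 - κ² ∂_r d_r) ∂_t q = -S`, with `S` a sum of local terms.  A decaying
solution is determined by its trace at `R`, so that
`∂_t q = ∂_t q(R) · K₁(r/κ) / K₁(R/κ) - W`, where `W` solves the Dirichlet problem with right-hand side
`S` (`eq_decayK_sub_of_eqn`, `eqn_of_eq_decayK_sub`).  Splitting `S` into `∂_r` of the local flux, a
radial term and a viscous term, and using `∂_r 𝕽₁ = 𝕽₀ ∂_r` (`R1_spec`), `W` becomes the sum of the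
nonlocal terms of the augmented system (`RegularSlice.exists_nonlocal`).  The momentum equation is thus
the second component of the conservation law, provided that `∂_t q(R) = -(R/2) 𝓓`.

In the interior, mass conservation forces `q = -(r/2) δ'`, hence `∂_t q(R) = -(R/2) δ''`, and the
momentum equation makes the pressure a quadratic polynomial in `r`, whose constant is fixed by the
conservation of energy at the contact line.  Averaging it over the disc turns Newton's equation into a
relation between the boundary unknowns (`newton_iff_exact`).  A second relation comes from the trace of
`d_r ∂_t q` in the formula above: by equality of mixed derivatives (`hasDerivWithinAt_mixed`) and mass
conservation this trace is `-ζ''(R)`, which gives the last row of the boundary equation (`trace_dr_qt`).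
Elementary algebra shows that the two relations are equivalent to the remaining rows of
`Z' + 𝓜⁻¹(…) = 0`, and that they imply `δ'' = 𝓓` (`newton_iff_row`).

The analytic input is that `𝕽₀` and `𝕽₁` are well defined.  Uniqueness holds because `r (w²)'` is
nondecreasing for homogeneous solutions `w`.  For existence, writing `w = K₁(r/κ) g` reduces the
Dirichlet problem to two integrations (`exists_dirichlet`); the decay at infinity follows from
the exponential decay of `K₁` and from `f ∈ L²(r dr)`.
-/

open Set Filter Topology MeasureTheory

namespace FloatingCylinder

/-! ### Modified Bessel functions of orders zero and one -/

/-- The moments `∫₀^∞ coshⁿ s · exp (-x cosh s) ds`; the cases `n = 0, 1` are `K₀` and `K₁`, and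
differentiation in `x` raises `n` by one. -/
noncomputable def coshMoment (n : ℕ) (x : ℝ) : ℝ :=
  ∫ s in Ioi (0 : ℝ), Real.cosh s ^ n * Real.exp (-x * Real.cosh s)

theorem self_le_cosh {s : ℝ} (hs : 0 ≤ s) : s ≤ Real.cosh s :=
  (Real.self_le_sinh_iff.2 hs).trans (Real.sinh_lt_cosh s).le

theorem pow_mul_exp_le (n : ℕ) {x y : ℝ} (hx : 0 < x) (hy : 0 ≤ y) :
    y ^ n * Real.exp (-x * y) ≤ (n.factorial / (x / 2) ^ n) * Real.exp (-(x / 2) * y) := by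
  have h1 := Real.pow_div_factorial_le_exp (x := x / 2 * y) (by positivity) n
  rw [div_le_iff₀ (by positivity), mul_pow] at h1
  have h2 : Real.exp (-x * y) = Real.exp (-(x / 2) * y) * Real.exp (-(x / 2) * y) := by
    rw [← Real.exp_add]; ring_nf
  have h3 : Real.exp (x / 2 * y) * Real.exp (-(x / 2) * y) = 1 := by
    rw [← Real.exp_add]; simp
  have h4 : y ^ n * Real.exp (-(x / 2) * y) ≤ n.factorial / (x / 2) ^ n := by
    rw [le_div_iff₀ (by positivity)]
    calc y ^ n * Real.exp (-(x / 2) * y) * (x / 2) ^ n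
        = ((x / 2) ^ n * y ^ n) * Real.exp (-(x / 2) * y) := by ring
      _ ≤ (Real.exp (x / 2 * y) * n.factorial) * Real.exp (-(x / 2) * y) := by gcongr
      _ = n.factorial * (Real.exp (x / 2 * y) * Real.exp (-(x / 2) * y)) := by ring
      _ = n.factorial := by rw [h3, mul_one]
  rw [h2, ← mul_assoc]
  gcongr

theorem cosh_pow_mul_exp_le (n : ℕ) {x s : ℝ} (hx : 0 < x) (hs : 0 ≤ s) :
    Real.cosh s ^ n * Real.exp (-x * Real.cosh s)
      ≤ (n.factorial / (x / 2) ^ n) * Real.exp (-(x / 2) * s) := by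
  refine (pow_mul_exp_le n hx (Real.cosh_pos s).le).trans ?_
  have := self_le_cosh hs
  gcongr _ * Real.exp ?_
  nlinarith

theorem integrableOn_coshMoment (n : ℕ) {x : ℝ} (hx : 0 < x) :
    IntegrableOn (fun s => Real.cosh s ^ n * Real.exp (-x * Real.cosh s)) (Ioi 0) := by
  refine integrable_of_isBigO_exp_neg (b := x / 2) (by positivity) (by fun_prop) ?_
  refine Asymptotics.IsBigO.of_bound (n.factorial / (x / 2) ^ n) ?_
  filter_upwards [eventually_ge_atTop 0] with s hs
  have := Real.cosh_pos s
  rw [Real.norm_of_nonneg (by positivity), Real.norm_of_nonneg (by positivity)]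
  exact cosh_pow_mul_exp_le n hx hs

theorem hasDerivAt_coshMoment (n : ℕ) {x : ℝ} (hx : 0 < x) :
    HasDerivAt (coshMoment n) (-coshMoment (n + 1) x) x := by
  have h := (hasDerivAt_integral_of_dominated_loc_of_deriv_le
    (μ := volume.restrict (Ioi (0 : ℝ))) (x₀ := x) (s := Ioi (x / 2))
    (F := fun x s => Real.cosh s ^ n * Real.exp (-x * Real.cosh s))
    (F' := fun x s => -(Real.cosh s ^ (n + 1) * Real.exp (-x * Real.cosh s)))
    (bound := fun s => Real.cosh s ^ (n + 1) * Real.exp (-(x / 2) * Real.cosh s))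
    (Ioi_mem_nhds (by linarith))
    (Eventually.of_forall fun y => Continuous.aestronglyMeasurable (by fun_prop))
    (integrableOn_coshMoment n hx)
    (Continuous.aestronglyMeasurable (by fun_prop)) ?_
    (integrableOn_coshMoment (n + 1) (by positivity)) ?_).2
  · rw [integral_neg] at h
    exact h
  · refine Eventually.of_forall fun s y hy => ?_
    have := Real.cosh_pos s
    rw [norm_neg, Real.norm_of_nonneg (by positivity)]
    gcongr
    exact le_of_lt hy
  · refine Eventually.of_forall fun s y _ => ?_
    have h1 : HasDerivAt (fun y : ℝ => -y * Real.cosh s) (-1 * Real.cosh s) y :=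
      (hasDerivAt_id y).neg.mul_const _
    exact (h1.exp.const_mul (Real.cosh s ^ n)).congr_deriv (by ring)

theorem coshMoment_pos (n : ℕ) {x : ℝ} (hx : 0 < x) : 0 < coshMoment n x := by
  have hp : ∀ s : ℝ, 0 < Real.cosh s ^ n * Real.exp (-x * Real.cosh s) := fun s => by
    have := Real.cosh_pos s
    positivity
  refine (setIntegral_pos_iff_support_of_nonneg_ae
    (Eventually.of_forall fun s => (hp s).le) (integrableOn_coshMoment n hx)).2 ?_
  have : Function.support (fun s => Real.cosh s ^ n * Real.exp (-x * Real.cosh s)) = univ :=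
    eq_univ_of_forall fun s => (hp s).ne'
  rw [this, univ_inter]
  simp

theorem coshMoment_le_succ (n : ℕ) {x : ℝ} (hx : 0 < x) :
    coshMoment n x ≤ coshMoment (n + 1) x := by
  refine setIntegral_mono (integrableOn_coshMoment n hx) (integrableOn_coshMoment (n + 1) hx)
    fun s => ?_
  have := Real.one_le_cosh s
  dsimp only
  gcongr
  omega

/-- Integration by parts: `K₁(x) = x ∫ sinh² s · exp (-x cosh s) ds`. -/
theorem coshMoment_two {x : ℝ} (hx : 0 < x) :
    coshMoment 2 x = coshMoment 0 x + coshMoment 1 x / x := by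
  have hd : ∀ s : ℝ, HasDerivAt (fun s => Real.sinh s * Real.exp (-x * Real.cosh s))
      (Real.cosh s ^ 1 * Real.exp (-x * Real.cosh s)
        - x * (Real.cosh s ^ 2 * Real.exp (-x * Real.cosh s)
          - Real.cosh s ^ 0 * Real.exp (-x * Real.cosh s))) s := fun s => by
    refine ((Real.hasDerivAt_sinh s).mul
      (((Real.hasDerivAt_cosh s).const_mul (-x)).exp)).congr_deriv ?_
    rw [Real.cosh_sq]
    ring
  have i0 := integrableOn_coshMoment 0 hx
  have i1 := integrableOn_coshMoment 1 hx
  have i2 := integrableOn_coshMoment 2 hx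
  have hlim : Tendsto (fun s => Real.sinh s * Real.exp (-x * Real.cosh s)) atTop (𝓝 0) := by
    have hz : Tendsto (fun s : ℝ => ((1 : ℕ).factorial / (x / 2) ^ 1) * Real.exp (-(x / 2) * s))
        atTop (𝓝 0) := by
      have h0 : Tendsto (fun s : ℝ => Real.exp (-(x / 2) * s)) atTop (𝓝 0) :=
        Real.tendsto_exp_atBot.comp (tendsto_id.const_mul_atTop_of_neg (by linarith))
      have h1 := h0.const_mul (((1 : ℕ).factorial : ℝ) / (x / 2) ^ 1)
      rwa [mul_zero] at h1
    refine squeeze_zero' ?_ ?_ hz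
    · filter_upwards [eventually_ge_atTop 0] with s hs
      exact mul_nonneg (Real.sinh_nonneg_iff.2 hs) (Real.exp_pos _).le
    · filter_upwards [eventually_ge_atTop 0] with s hs
      refine le_trans ?_ (cosh_pow_mul_exp_le 1 hx hs)
      rw [pow_one]
      have := (Real.sinh_lt_cosh s).le
      gcongr
  have i3 : IntegrableOn (fun s => x * (Real.cosh s ^ 2 * Real.exp (-x * Real.cosh s)
      - Real.cosh s ^ 0 * Real.exp (-x * Real.cosh s))) (Ioi 0) := (i2.sub i0).const_mul x
  have h := integral_Ioi_of_hasDerivAt_of_tendsto' (a := 0) (fun s _ => hd s) (i1.sub i3) hlim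
  rw [integral_sub i1 i3, integral_const_mul, integral_sub i2 i0] at h
  change coshMoment 1 x - x * (coshMoment 2 x - coshMoment 0 x) = _ at h
  simp only [Real.sinh_zero, zero_mul, sub_zero] at h
  field_simp
  linarith

theorem besselK_zero_eq (x : ℝ) : besselK 0 x = coshMoment 0 x := by
  simp [besselK, coshMoment]

theorem besselK_one_eq (x : ℝ) : besselK 1 x = coshMoment 1 x := by
  simp [besselK, coshMoment, mul_comm]

theorem besselK_zero_pos {x : ℝ} (hx : 0 < x) : 0 < besselK 0 x := by
  rw [besselK_zero_eq]; exact coshMoment_pos 0 hx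

theorem besselK_one_pos {x : ℝ} (hx : 0 < x) : 0 < besselK 1 x := by
  rw [besselK_one_eq]; exact coshMoment_pos 1 hx

theorem besselK_zero_le_one {x : ℝ} (hx : 0 < x) : besselK 0 x ≤ besselK 1 x := by
  rw [besselK_zero_eq, besselK_one_eq]; exact coshMoment_le_succ 0 hx

theorem hasDerivAt_besselK_zero {x : ℝ} (hx : 0 < x) :
    HasDerivAt (besselK 0) (-besselK 1 x) x := by
  rw [besselK_one_eq, funext besselK_zero_eq]
  exact hasDerivAt_coshMoment 0 hx

theorem hasDerivAt_besselK_one {x : ℝ} (hx : 0 < x) :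
    HasDerivAt (besselK 1) (-(besselK 0 x + besselK 1 x / x)) x := by
  rw [besselK_one_eq, besselK_zero_eq, ← coshMoment_two hx, funext besselK_one_eq]
  exact hasDerivAt_coshMoment 1 hx

/-- Exponential decay of `K₁`: `eˣ K₁(x)` is nonincreasing, since `cosh ≥ 1`. -/
theorem besselK_one_le_exp {x y : ℝ} (hx : 0 < x) (hxy : x ≤ y) :
    besselK 1 y ≤ besselK 1 x * Real.exp (-(y - x)) := by
  rw [besselK_one_eq, besselK_one_eq, coshMoment, coshMoment, ← integral_mul_const]
  refine setIntegral_mono (integrableOn_coshMoment 1 (hx.trans_le hxy))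
    ((integrableOn_coshMoment 1 hx).mul_const _) fun s => ?_
  have h1 := Real.one_le_cosh s
  dsimp only
  rw [mul_assoc, ← Real.exp_add]
  gcongr _ * Real.exp ?_
  nlinarith

/-! ### The decaying solution of the homogeneous equation -/

/-- `r ↦ K₁(r / κ)`, the positive decaying solution of `(1 - κ² ∂_r d_r) w = 0`. -/
noncomputable def decayK (κ r : ℝ) : ℝ := besselK 1 (r / κ)

section Profile

variable {κ : ℝ}

theorem decayK_pos (hκ : 0 < κ) {r : ℝ} (hr : 0 < r) : 0 < decayK κ r :=
  besselK_one_pos (div_pos hr hκ)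

theorem hasDerivAt_decayK (hκ : 0 < κ) {r : ℝ} (hr : 0 < r) :
    HasDerivAt (decayK κ) (-(besselK 0 (r / κ) / κ) - decayK κ r / r) r := by
  have h1 : HasDerivAt (fun r : ℝ => r / κ) (1 / κ) r := (hasDerivAt_id r).div_const κ
  refine ((hasDerivAt_besselK_one (div_pos hr hκ)).comp r h1).congr_deriv ?_
  rw [decayK]
  field_simp
  ring

theorem hasDerivAt_besselK_zero_div (hκ : 0 < κ) {r : ℝ} (hr : 0 < r) :
    HasDerivAt (fun r => besselK 0 (r / κ)) (-(decayK κ r / κ)) r := by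
  have h1 : HasDerivAt (fun r : ℝ => r / κ) (1 / κ) r := (hasDerivAt_id r).div_const κ
  refine ((hasDerivAt_besselK_zero (div_pos hr hκ)).comp r h1).congr_deriv ?_
  rw [decayK]
  ring

theorem continuousOn_decayK (hκ : 0 < κ) : ContinuousOn (decayK κ) (Ioi 0) := fun _ hr =>
  (hasDerivAt_decayK hκ hr).continuousAt.continuousWithinAt

theorem decayK_le_exp (hκ : 0 < κ) {s r : ℝ} (hs : 0 < s) (hsr : s ≤ r) :
    decayK κ r ≤ decayK κ s * Real.exp (-(r - s) / κ) := by
  have := besselK_one_le_exp (div_pos hs hκ) (div_le_div_of_nonneg_right hsr hκ.le)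
  rwa [← sub_div, ← neg_div] at this

theorem tendsto_exp_neg_div (hκ : 0 < κ) (s : ℝ) :
    Tendsto (fun r => Real.exp (-(r - s) / κ)) atTop (𝓝 0) := by
  refine Real.tendsto_exp_atBot.comp (Tendsto.atBot_div_const hκ ?_)
  exact tendsto_neg_atTop_atBot.comp (tendsto_atTop_add_const_right _ (-s) tendsto_id)

theorem tendsto_decayK (hκ : 0 < κ) : Tendsto (decayK κ) atTop (𝓝 0) := by
  have h := (tendsto_exp_neg_div hκ 1).const_mul (decayK κ 1)
  rw [mul_zero] at h
  refine squeeze_zero' ?_ ?_ h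
  · filter_upwards [eventually_gt_atTop 0] with r hr using (decayK_pos hκ hr).le
  · filter_upwards [eventually_ge_atTop 1] with r hr using decayK_le_exp hκ one_pos hr

end Profile

/-! ### Uniqueness for the boundary value problems -/

section Uniqueness

variable {R : ℝ} {w w1 w2 c : ℝ → ℝ}

theorem hasDerivAt_sq {r w' : ℝ} (h : HasDerivAt w w' r) :
    HasDerivAt (fun r => w r ^ 2) (2 * (w r * w')) r :=
  (h.pow 2).congr_deriv (by simp [mul_assoc])

/-- For a solution of `w'' + w' / r = c w` with `c ≥ 0`, the quantity `r (w²)'` is nondecreasing. -/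
theorem monotoneOn_energy (hR : 0 < R) (hw : ∀ r, R < r → HasDerivAt w (w1 r) r)
    (hw1 : ∀ r, R < r → HasDerivAt w1 (w2 r) r) (hc : ∀ r, R < r → 0 ≤ c r)
    (heq : ∀ r, R < r → w2 r = c r * w r - w1 r / r) :
    MonotoneOn (fun r => r * (w r * w1 r)) (Ioi R) := by
  have hd : ∀ r, R < r → HasDerivAt (fun r => r * (w r * w1 r))
      (r * (w1 r ^ 2 + c r * w r ^ 2)) r := fun r hr => by
    have hr0 : r ≠ 0 := (hR.trans hr).ne'
    refine ((hasDerivAt_id r).mul ((hw r hr).mul (hw1 r hr))).congr_deriv ?_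
    rw [heq r hr]
    simp only [id, Pi.mul_apply]
    field_simp
    ring
  refine monotoneOn_of_deriv_nonneg (convex_Ioi R)
    (fun r hr => (hd r hr).continuousAt.continuousWithinAt) ?_ ?_
  · rw [interior_Ioi]
    exact fun r hr => (hd r hr).differentiableAt.differentiableWithinAt
  · rw [interior_Ioi]
    intro r hr
    rw [(hd r hr).deriv]
    have h0 := hR.trans hr
    have := hc r hr
    positivity

/-- A decaying solution of `w'' + w' / r = c w` with `c ≥ 0` satisfies `w w' ≤ 0`: otherwise `w²`
would increase from some point on. -/
theorem mul_deriv_nonpos_of_decay (hR : 0 < R) (hw : ∀ r, R < r → HasDerivAt w (w1 r) r)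
    (hw1 : ∀ r, R < r → HasDerivAt w1 (w2 r) r) (hc : ∀ r, R < r → 0 ≤ c r)
    (heq : ∀ r, R < r → w2 r = c r * w r - w1 r / r) (hlim : Tendsto w atTop (𝓝 0)) :
    ∀ r, R < r → w r * w1 r ≤ 0 := by
  intro r hr
  by_contra! hpos
  have hmono := monotoneOn_energy hR hw hw1 hc heq
  have hinc : MonotoneOn (fun r => w r ^ 2) (Ici r) := by
    refine monotoneOn_of_deriv_nonneg (convex_Ici r)
      (fun s hs => (hasDerivAt_sq (hw s (hr.trans_le hs))).continuousAt.continuousWithinAt) ?_ ?_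
    · exact fun s hs => (hasDerivAt_sq (hw s (hr.trans_le (interior_subset hs))))
        |>.differentiableAt.differentiableWithinAt
    · intro s hs
      have hrs : r ≤ s := interior_subset hs
      have hs' := hr.trans_le hrs
      rw [(hasDerivAt_sq (hw s hs')).deriv]
      have h1 : r * (w r * w1 r) ≤ s * (w s * w1 s) := hmono hr hs' hrs
      have h2 : 0 < r * (w r * w1 r) := mul_pos (hR.trans hr) hpos
      have h3 : 0 < w s * w1 s :=
        pos_of_mul_pos_right (h2.trans_le h1) (hR.trans hs').le
      nlinarith
  have h0 : w r ^ 2 ≤ 0 := by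
    refine ge_of_tendsto (by simpa using hlim.pow 2) ?_
    filter_upwards [eventually_ge_atTop r] with s hs using hinc self_mem_Ici hs hs
  have : w r = 0 := by nlinarith
  rw [this, zero_mul] at hpos
  exact lt_irrefl _ hpos

theorem antitoneOn_sq_of_decay (hR : 0 < R) (hw : ∀ r, R < r → HasDerivAt w (w1 r) r)
    (hw1 : ∀ r, R < r → HasDerivAt w1 (w2 r) r) (hc : ∀ r, R < r → 0 ≤ c r)
    (heq : ∀ r, R < r → w2 r = c r * w r - w1 r / r) (hlim : Tendsto w atTop (𝓝 0)) :
    AntitoneOn (fun r => w r ^ 2) (Ioi R) := by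
  refine antitoneOn_of_deriv_nonpos (convex_Ioi R)
    (fun s hs => (hasDerivAt_sq (hw s hs)).continuousAt.continuousWithinAt) ?_ ?_
  · rw [interior_Ioi]
    exact fun s hs => (hasDerivAt_sq (hw s hs)).differentiableAt.differentiableWithinAt
  · rw [interior_Ioi]
    intro s hs
    rw [(hasDerivAt_sq (hw s hs)).deriv]
    have := mul_deriv_nonpos_of_decay hR hw hw1 hc heq hlim s hs
    nlinarith

theorem eq_zero_of_dirichlet (hR : 0 < R) (hw : ∀ r, R < r → HasDerivAt w (w1 r) r)
    (hw1 : ∀ r, R < r → HasDerivAt w1 (w2 r) r) (hc : ∀ r, R < r → 0 ≤ c r)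
    (heq : ∀ r, R < r → w2 r = c r * w r - w1 r / r) (hlim : Tendsto w atTop (𝓝 0))
    (hb : Tendsto w (𝓝[>] R) (𝓝 0)) : ∀ r, R < r → w r = 0 := by
  intro r hr
  have h := antitoneOn_sq_of_decay hR hw hw1 hc heq hlim
  have h0 : w r ^ 2 ≤ 0 := by
    refine ge_of_tendsto (by simpa using hb.pow 2) ?_
    filter_upwards [Ioo_mem_nhdsGT hr] with s hs using h hs.1 hr hs.2.le
  nlinarith

theorem eq_zero_of_neumann (hR : 0 < R) (hw : ∀ r, R < r → HasDerivAt w (w1 r) r)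
    (hw1 : ∀ r, R < r → HasDerivAt w1 (w2 r) r) (hc : ∀ r, R < r → 0 ≤ c r)
    (heq : ∀ r, R < r → w2 r = c r * w r - w1 r / r) (hlim : Tendsto w atTop (𝓝 0))
    (hb : Tendsto w1 (𝓝[>] R) (𝓝 0)) : ∀ r, R < r → w r = 0 := by
  -- `w` is bounded near `R` because `w'` is, hence `r w w'` vanishes at `R`
  obtain ⟨b, hRb, hb1⟩ : ∃ b, R < b ∧ ∀ s ∈ Ioc R b, |w1 s| ≤ 1 := by
    have h1 : ∀ᶠ s in 𝓝[>] R, |w1 s| < 1 := by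
      have := hb.abs
      rw [abs_zero] at this
      exact this.eventually (gt_mem_nhds one_pos)
    obtain ⟨b, hb, hb'⟩ := mem_nhdsGT_iff_exists_Ioc_subset.1 h1
    exact ⟨b, hb, fun s hs => (hb' hs).le⟩
  have hbd : ∀ s ∈ Ioc R b, |w s| ≤ |w b| + (b - R) := by
    intro s hs
    have h1 := (convex_Ioc R b).norm_image_sub_le_of_norm_hasDerivWithin_le (C := 1)
      (fun x hx => (hw x hx.1).hasDerivWithinAt) (fun x hx => hb1 x hx)
      (right_mem_Ioc.2 hRb) hs
    rw [Real.norm_eq_abs, Real.norm_eq_abs, one_mul, abs_sub_comm s b,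
      abs_of_nonneg (sub_nonneg.2 hs.2)] at h1
    have h2 := abs_sub_abs_le_abs_sub (w s) (w b)
    linarith [hs.1]
  have hlim0 : Tendsto (fun r => r * (w r * w1 r)) (𝓝[>] R) (𝓝 0) := by
    have h1 : Tendsto (fun r => w r * w1 r) (𝓝[>] R) (𝓝 0) := by
      have h2 : Tendsto (fun r => (|w b| + (b - R)) * |w1 r|) (𝓝[>] R) (𝓝 0) := by
        simpa using hb.abs.const_mul (|w b| + (b - R))
      refine squeeze_zero_norm' ?_ h2
      filter_upwards [Ioc_mem_nhdsGT hRb] with s hs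
      rw [norm_mul]
      exact mul_le_mul_of_nonneg_right (hbd s hs) (norm_nonneg _)
    have h3 : Tendsto (fun r : ℝ => r) (𝓝[>] R) (𝓝 R) := tendsto_id.mono_left nhdsWithin_le_nhds
    simpa using h3.mul h1
  have hmono := monotoneOn_energy hR hw hw1 hc heq
  have hnn : ∀ r, R < r → 0 ≤ w r * w1 r := fun r hr => by
    have h1 : 0 ≤ r * (w r * w1 r) := by
      refine le_of_tendsto hlim0 ?_
      filter_upwards [Ioo_mem_nhdsGT hr] with s hs using hmono hs.1 hr hs.2.le
    exact nonneg_of_mul_nonneg_right h1 (hR.trans hr)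
  have hinc : MonotoneOn (fun r => w r ^ 2) (Ioi R) := by
    refine monotoneOn_of_deriv_nonneg (convex_Ioi R)
      (fun s hs => (hasDerivAt_sq (hw s hs)).continuousAt.continuousWithinAt) ?_ ?_
    · rw [interior_Ioi]
      exact fun s hs => (hasDerivAt_sq (hw s hs)).differentiableAt.differentiableWithinAt
    · rw [interior_Ioi]
      intro s hs
      rw [(hasDerivAt_sq (hw s hs)).deriv]
      have := hnn s hs
      nlinarith
  intro r hr
  have h0 : w r ^ 2 ≤ 0 := by
    refine ge_of_tendsto (by simpa using hlim.pow 2) ?_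
    filter_upwards [eventually_ge_atTop r] with s hs using hinc hr (hr.trans_le hs) hs
  nlinarith

end Uniqueness

section Operators

variable {κ R : ℝ} {f g u v : ℝ → ℝ}

theorem IsR0.congr (hu : IsR0 κ R f u) (hfg : ∀ r, R < r → f r = g r) : IsR0 κ R g u :=
  { hu with eqn := fun r hr => (hu.eqn r hr).trans (hfg r hr) }

theorem IsR1.congr (hu : IsR1 κ R f u) (hfg : ∀ r, R < r → f r = g r) : IsR1 κ R g u :=
  { hu with eqn := fun r hr => (hu.eqn r hr).trans (hfg r hr) }

theorem hasDerivAt_of_dr {r : ℝ} (h : DifferentiableAt ℝ u r) :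
    HasDerivAt u (dr u r - u r / r) r :=
  h.hasDerivAt.congr_deriv (by simp [dr])

theorem hasDerivAt_dr_sub {r : ℝ} (hr : r ≠ 0) (h : DifferentiableAt ℝ u r)
    (h' : DifferentiableAt ℝ (dr u) r) :
    HasDerivAt (fun r => dr u r - u r / r)
      (deriv (dr u) r - (dr u r - u r / r) / r + u r / r ^ 2) r := by
  refine (h'.hasDerivAt.sub ((hasDerivAt_of_dr h).div (hasDerivAt_id r) hr)).congr_deriv ?_
  simp only [id]
  field_simp
  ring

theorem IsR0.unique (hκ : 0 < κ) (hR : 0 < R) (hu : IsR0 κ R f u) (hv : IsR0 κ R f v) :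
    ∀ r, R < r → u r = v r := by
  intro r hr
  have := eq_zero_of_dirichlet (w := fun r => u r - v r)
    (w1 := fun r => (dr u r - u r / r) - (dr v r - v r / r))
    (c := fun r => 1 / κ ^ 2 + 1 / r ^ 2) hR
    (fun r hr => (hasDerivAt_of_dr (hu.diff r hr)).sub (hasDerivAt_of_dr (hv.diff r hr)))
    (fun r hr => (hasDerivAt_dr_sub (hR.trans hr).ne' (hu.diff r hr) (hu.diff' r hr)).sub
      (hasDerivAt_dr_sub (hR.trans hr).ne' (hv.diff r hr) (hv.diff' r hr)))
    (fun r hr => by positivity) ?_ (by simpa using hu.decay.sub hv.decay)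
    (by simpa using hu.bdry.sub hv.bdry) r hr
  · linarith
  · intro r hr
    have h1 := hu.eqn r hr
    have h2 := hv.eqn r hr
    have h3 : deriv (dr u) r - deriv (dr v) r = (u r - v r) / κ ^ 2 := by
      field_simp
      linarith
    have hr0 := (hR.trans hr).ne'
    linear_combination h3

theorem IsR1.unique (hκ : 0 < κ) (hR : 0 < R) (hu : IsR1 κ R f u) (hv : IsR1 κ R f v) :
    ∀ r, R < r → u r = v r := by
  intro r hr
  have := eq_zero_of_neumann (w := fun r => u r - v r)
    (w1 := fun r => deriv u r - deriv v r) (w2 := fun r => deriv (deriv u) r - deriv (deriv v) r)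
    (c := fun _ => 1 / κ ^ 2) hR
    (fun r hr => (hu.diff r hr).hasDerivAt.sub (hv.diff r hr).hasDerivAt)
    (fun r hr => (hu.diff' r hr).hasDerivAt.sub (hv.diff' r hr).hasDerivAt)
    (fun r hr => by positivity) ?_ (by simpa using hu.decay.sub hv.decay)
    (by simpa using hu.bdry.sub hv.bdry) r hr
  · linarith
  · intro r hr
    have h1 := hu.eqn r hr
    have h2 := hv.eqn r hr
    simp only [dr] at h1 h2
    have h3 : deriv (deriv u) r + deriv u r / r - (deriv (deriv v) r + deriv v r / r)
        = (u r - v r) / κ ^ 2 := by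
      field_simp
      field_simp at h1 h2
      linarith
    linear_combination h3

theorem IsR0.isR0_R0 (hu : IsR0 κ R f u) : IsR0 κ R f (R0 κ R f) :=
  Classical.epsilon_spec ⟨u, hu⟩

theorem IsR1.isR1_R1 (hu : IsR1 κ R f u) : IsR1 κ R f (R1 κ R f) :=
  Classical.epsilon_spec ⟨u, hu⟩

end Operators

/-! ### Solvability of the Dirichlet problem -/

section L2

variable {R : ℝ} {f : ℝ → ℝ}

theorem MemL2r.integrableOn (hR : 0 < R) (hf : MemL2r R f) :
    IntegrableOn (fun r => r * f r ^ 2) (Ioi R) := by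
  have h1 := MemLp.integrable_sq hf
  rw [integrable_withDensity_iff_integrable_smul' (by fun_prop)
    (Eventually.of_forall fun _ => ENNReal.ofReal_lt_top)] at h1
  refine (integrable_congr ?_).1 h1
  filter_upwards [ae_restrict_mem measurableSet_Ioi] with r hr
  rw [ENNReal.toReal_ofReal (hR.trans hr).le, smul_eq_mul]

end L2

theorem hasDerivAt_integral_of_continuousOn {h : ℝ → ℝ} {a : ℝ} (ha : 0 < a)
    (hh : ContinuousOn h (Ioi 0)) {r : ℝ} (hr : 0 < r) :
    HasDerivAt (fun r => ∫ s in a..r, h s) (h r) r := by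
  refine intervalIntegral.integral_hasDerivAt_right ?_ ?_ (hh.continuousAt (Ioi_mem_nhds hr))
  · refine (hh.mono fun s hs => ?_).intervalIntegrable
    exact (lt_min ha hr).trans_le hs.1
  · exact hh.stronglyMeasurableAtFilter isOpen_Ioi r hr

/-- Damped averages of a function vanishing at infinity vanish at infinity. -/
theorem tendsto_mul_integral_div {κ R : ℝ} (hκ : 0 < κ) (hR : 0 < R) {ψ B : ℝ → ℝ}
    (hψ : ∀ r, 0 < r → 0 < ψ r) (hψc : ContinuousOn ψ (Ioi 0))
    (hexp : ∀ s r, 0 < s → s ≤ r → ψ r ≤ ψ s * Real.exp (-(r - s) / κ))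
    (hB : ContinuousOn B (Ioi 0)) (hlim : Tendsto B atTop (𝓝 0)) :
    Tendsto (fun r => ψ r * ∫ s in R..r, B s / ψ s) atTop (𝓝 0) := by
  have hc : ContinuousOn (fun s => B s / ψ s) (Ioi 0) := hB.div hψc fun s hs => (hψ s hs).ne'
  have hii : ∀ a b, 0 < a → 0 < b → IntervalIntegrable (fun s => B s / ψ s) volume a b :=
    fun a b ha hb => (hc.mono fun s hs => (lt_min ha hb).trans_le hs.1).intervalIntegrable
  have hψ0 : Tendsto ψ atTop (𝓝 0) := by
    have h := (tendsto_exp_neg_div hκ 1).const_mul (ψ 1)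
    rw [mul_zero] at h
    refine squeeze_zero' ?_ ?_ h
    · filter_upwards [eventually_gt_atTop 0] with r hr using (hψ r hr).le
    · filter_upwards [eventually_ge_atTop 1] with r hr using hexp 1 r one_pos hr
  rw [Metric.tendsto_atTop']
  intro η hη
  obtain ⟨S, hSR, hS⟩ : ∃ S, R ≤ S ∧ ∀ s, S ≤ s → |B s| ≤ η / (2 * κ) := by
    have h1 : ∀ᶠ s in atTop, |B s| ≤ η / (2 * κ) := by
      have h2 := hlim.abs
      rw [abs_zero] at h2
      exact h2.eventually (ge_mem_nhds (by positivity))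
    obtain ⟨S, hS⟩ := eventually_atTop.1 h1
    exact ⟨max R S, le_max_left _ _, fun s hs => hS s ((le_max_right _ _).trans hs)⟩
  have hS0 : 0 < S := hR.trans_le hSR
  have h3 : ∀ᶠ r in atTop, |ψ r * ∫ s in R..S, B s / ψ s| < η / 2 := by
    have h4 := (hψ0.mul_const (∫ s in R..S, B s / ψ s)).abs
    rw [zero_mul, abs_zero] at h4
    exact h4.eventually (gt_mem_nhds (by positivity))
  obtain ⟨S', hS'⟩ := eventually_atTop.1 h3
  refine ⟨max S S', fun r hr => ?_⟩
  have hr1 : S < r := (le_max_left _ _).trans_lt hr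
  have hr0 := hS0.trans hr1
  have h5 := hS' r ((le_max_right _ _).trans hr.le)
  have h6 : |ψ r * ∫ s in S..r, B s / ψ s| ≤ η / 2 := by
    have hE : ∀ s, HasDerivAt (fun s => η / 2 * Real.exp (-(r - s) / κ))
        (η / (2 * κ) * Real.exp (-(r - s) / κ)) s := fun s => by
      have h1 : HasDerivAt (fun s : ℝ => -(r - s) / κ) (1 / κ) s := by
        refine (((hasDerivAt_id s).const_sub r).neg.div_const κ).congr_deriv (by simp)
      refine (h1.exp.const_mul (η / 2)).congr_deriv ?_
      field_simp
    have hEc : Continuous fun s => η / (2 * κ) * Real.exp (-(r - s) / κ) := by fun_prop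
    have h7 := intervalIntegral.integral_eq_sub_of_hasDerivAt (a := S) (b := r)
      (fun s _ => hE s) (hEc.intervalIntegrable _ _)
    rw [← intervalIntegral.integral_const_mul, ← Real.norm_eq_abs]
    refine (intervalIntegral.norm_integral_le_of_norm_le hr1.le
      (g := fun s => η / (2 * κ) * Real.exp (-(r - s) / κ)) ?_
      (hEc.intervalIntegrable _ _)).trans ?_
    · refine Eventually.of_forall fun s hs => ?_
      have hs0 : 0 < s := hS0.trans hs.1
      have hp := hψ s hs0
      rw [norm_mul, norm_div, Real.norm_eq_abs, Real.norm_eq_abs, Real.norm_eq_abs,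
        abs_of_pos (hψ r hr0), abs_of_pos hp]
      calc ψ r * (|B s| / ψ s) ≤ (ψ s * Real.exp (-(r - s) / κ)) * (η / (2 * κ) / ψ s) := by
            have := hexp s r hs0 hs.2
            have := hS s hs.1.le
            gcongr
        _ = η / (2 * κ) * Real.exp (-(r - s) / κ) := by field_simp
    · rw [h7]
      have := Real.exp_pos (-(r - S) / κ)
      simp only [sub_self, neg_zero, zero_div, Real.exp_zero, mul_one]
      nlinarith
  rw [Real.dist_eq, sub_zero, ← intervalIntegral.integral_add_adjacent_intervals
    (hii R S hR hS0) (hii S r hS0 hr0), mul_add]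
  exact (abs_add_le _ _).trans_lt (by linarith)

section Dirichlet

variable {κ R : ℝ} {f : ℝ → ℝ}

/-- Weighted arithmetic-geometric mean bound of the integrand of `∫ₛ^∞ ρ ψ f dρ`, where
`ψ = decayK κ`: exponential decay of `ψ` controls the first term, `f ∈ L²(r dr)` the second. -/
theorem abs_mul_decayK_mul_le (hκ : 0 < κ) (hR : 0 < R) {s ρ : ℝ} (hs : R ≤ s) (hρ : s ≤ ρ)
    (y : ℝ) :
    |ρ * decayK κ ρ * y| ≤ decayK κ s * √s / 2 *
      ((1 + κ / R) * Real.exp (-(ρ - s) / κ) + ρ * y ^ 2) := by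
  have hs0 : 0 < s := hR.trans_le hs
  have hρ0 : 0 < ρ := hs0.trans_le hρ
  have hψs := decayK_pos hκ hs0
  have hψ := decayK_pos hκ hρ0
  have hsq : 0 < √s := Real.sqrt_pos.2 hs0
  have hss : √s * √s = s := Real.mul_self_sqrt hs0.le
  set E := Real.exp (-(ρ - s) / κ) with hE
  have hE0 : 0 < E := Real.exp_pos _
  have h1 : decayK κ ρ ≤ decayK κ s * E := decayK_le_exp hκ hs0 hρ
  -- the algebraic growth of `ρ` is absorbed by one half of the exponential decay of `ψ²`
  have h2 : ρ * E ≤ (1 + κ / R) * s := by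
    have h3 : (ρ - s) / κ + 1 ≤ Real.exp ((ρ - s) / κ) := Real.add_one_le_exp _
    have h4 : Real.exp ((ρ - s) / κ) * E = 1 := by
      rw [hE, ← Real.exp_add, neg_div, add_neg_cancel, Real.exp_zero]
    have h5 : ρ ≤ (1 + κ / R) * s * ((ρ - s) / κ + 1) := by
      have h6 : (1 + κ / R) * s * ((ρ - s) / κ + 1)
        = ρ + (κ / R) * s + (ρ - s) * (s - R) / R + (ρ - s) * (s / κ) := by
        field_simp
        ring
      have h7 : 0 ≤ (ρ - s) * (s - R) / R := by
        have := sub_nonneg.2 hs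
        have := sub_nonneg.2 hρ
        positivity
      have h8 : 0 ≤ (ρ - s) * (s / κ) := by
        have := sub_nonneg.2 hρ
        positivity
      have h9 : 0 ≤ κ / R * s := by positivity
      linarith
    calc ρ * E ≤ ((1 + κ / R) * s * ((ρ - s) / κ + 1)) * E := by gcongr
      _ ≤ ((1 + κ / R) * s * Real.exp ((ρ - s) / κ)) * E := by gcongr
      _ = (1 + κ / R) * s := by rw [mul_assoc, h4, mul_one]
  have h10 : ρ * decayK κ ρ ^ 2 ≤ (decayK κ s * √s) ^ 2 * ((1 + κ / R) * E) := by
    calc ρ * decayK κ ρ ^ 2 ≤ ρ * (decayK κ s * E) ^ 2 := by gcongr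
      _ = decayK κ s ^ 2 * E * (ρ * E) := by ring
      _ ≤ decayK κ s ^ 2 * E * ((1 + κ / R) * s) := by gcongr
      _ = _ := by rw [mul_pow, Real.sq_sqrt hs0.le]; ring
  set a := decayK κ s * √s with ha
  have ha0 : 0 < a := mul_pos hψs hsq
  rw [abs_mul, abs_of_pos (mul_pos hρ0 hψ)]
  have h11 : 2 * a * (ρ * decayK κ ρ * |y|) ≤ ρ * decayK κ ρ ^ 2 + a ^ 2 * (ρ * y ^ 2) := by
    have h12 : 0 ≤ ρ * (decayK κ ρ - a * |y|) ^ 2 := by positivity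
    rw [← sq_abs y]
    nlinarith
  have h13 : 2 * a * (ρ * decayK κ ρ * |y|)
      ≤ 2 * a * (a / 2 * ((1 + κ / R) * E + ρ * y ^ 2)) := by
    calc _ ≤ _ := h11
      _ ≤ a ^ 2 * ((1 + κ / R) * E) + a ^ 2 * (ρ * y ^ 2) := by gcongr
      _ = _ := by ring
  exact le_of_mul_le_mul_left h13 (by positivity)

theorem hasDerivAt_exp_neg_div (κ s ρ : ℝ) (hκ : 0 < κ) :
    HasDerivAt (fun ρ => -κ * Real.exp (-(ρ - s) / κ)) (Real.exp (-(ρ - s) / κ)) ρ := by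
  have h1 : HasDerivAt (fun ρ : ℝ => -(ρ - s) / κ) (-1 / κ) ρ :=
    ((hasDerivAt_id ρ).sub_const s).neg.div_const κ
  refine (h1.exp.const_mul (-κ)).congr_deriv ?_
  field_simp

theorem tendsto_neg_mul_exp_neg_div (hκ : 0 < κ) (s : ℝ) :
    Tendsto (fun ρ => -κ * Real.exp (-(ρ - s) / κ)) atTop (𝓝 0) := by
  simpa using (tendsto_exp_neg_div hκ s).const_mul (-κ)

theorem integrableOn_exp_neg_div (hκ : 0 < κ) (s : ℝ) :
    IntegrableOn (fun ρ => Real.exp (-(ρ - s) / κ)) (Ioi s) :=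
  integrableOn_Ioi_deriv_of_nonneg' (fun ρ _ => hasDerivAt_exp_neg_div κ s ρ hκ)
    (fun _ _ => (Real.exp_pos _).le) (tendsto_neg_mul_exp_neg_div hκ s)

theorem integral_exp_neg_div (hκ : 0 < κ) (s : ℝ) :
    ∫ ρ in Ioi s, Real.exp (-(ρ - s) / κ) = κ := by
  rw [integral_Ioi_of_hasDerivAt_of_tendsto' (fun ρ _ => hasDerivAt_exp_neg_div κ s ρ hκ)
    (integrableOn_exp_neg_div hκ s) (tendsto_neg_mul_exp_neg_div hκ s)]
  simp

theorem integrableOn_mul_decayK_mul (hκ : 0 < κ) (hR : 0 < R) (hf : Continuous f)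
    (hf2 : IntegrableOn (fun r => r * f r ^ 2) (Ioi R)) :
    IntegrableOn (fun ρ => ρ * decayK κ ρ * f ρ) (Ioi R) := by
  refine Integrable.mono' ((((integrableOn_exp_neg_div hκ R).const_mul (1 + κ / R)).add
    hf2).const_mul (decayK κ R * √R / 2)) ?_ ?_
  · refine ContinuousOn.aestronglyMeasurable ?_ measurableSet_Ioi
    exact (continuousOn_id.mul ((continuousOn_decayK hκ).mono (Ioi_subset_Ioi hR.le))).mul
      hf.continuousOn
  · filter_upwards [ae_restrict_mem measurableSet_Ioi] with ρ hρ
    exact abs_mul_decayK_mul_le hκ hR le_rfl (le_of_lt hρ) (f ρ)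

theorem abs_integral_mul_decayK_mul_le (hκ : 0 < κ) (hR : 0 < R)
    (hf2 : IntegrableOn (fun r => r * f r ^ 2) (Ioi R)) {s : ℝ} (hs : R ≤ s) :
    |∫ ρ in Ioi s, ρ * decayK κ ρ * f ρ| ≤ decayK κ s * √s / 2 *
      ((1 + κ / R) * κ + ∫ r in Ioi R, r * f r ^ 2) := by
  have hs0 := hR.trans_le hs
  have hf3 := hf2.mono_set (Ioi_subset_Ioi hs)
  have hi := (integrableOn_exp_neg_div hκ s).const_mul (1 + κ / R)
  have h1 : ∫ r in Ioi s, r * f r ^ 2 ≤ ∫ r in Ioi R, r * f r ^ 2 := by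
    refine setIntegral_mono_set hf2 ?_ (Ioi_subset_Ioi hs).eventuallyLE
    filter_upwards [ae_restrict_mem measurableSet_Ioi] with r hr
    have : 0 < r := hR.trans hr
    simp only [Pi.zero_apply]
    positivity
  have h2 := norm_integral_le_of_norm_le ((hi.add hf3).const_mul (decayK κ s * √s / 2))
    (f := fun ρ => ρ * decayK κ ρ * f ρ) (by
      filter_upwards [ae_restrict_mem measurableSet_Ioi] with ρ hρ
      exact abs_mul_decayK_mul_le hκ hR hs (le_of_lt hρ) (f ρ))
  simp only [Pi.add_apply] at h2
  rw [integral_const_mul, integral_add hi hf3, integral_const_mul, integral_exp_neg_div hκ] at h2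
  refine h2.trans ?_
  have := decayK_pos hκ hs0
  gcongr

/-- Solvability of `(1 - κ² ∂_r d_r) w = f` with Dirichlet condition, for a continuous `f` in
`L²(r dr)`.  The substitution `w = ψ g`, with `ψ` the decaying homogeneous solution, turns the equation
into `(r ψ² g')' = - r ψ f / κ²`, which is integrated once from infinity and once from `R`.  The
function `e` is `d_r w`. -/
theorem exists_dirichlet (hκ : 0 < κ) (hR : 0 < R) (hf : Continuous f)
    (hf2 : IntegrableOn (fun r => r * f r ^ 2) (Ioi R)) :
    ∃ w e : ℝ → ℝ, (∀ r, 0 < r → HasDerivAt w (e r - w r / r) r) ∧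
      (∀ r, 0 < r → HasDerivAt e ((w r - f r) / κ ^ 2) r) ∧ w R = 0 ∧
      Tendsto w atTop (𝓝 0) ∧ Tendsto e atTop (𝓝 0) := by
  have hh : ContinuousOn (fun ρ => ρ * decayK κ ρ * f ρ) (Ioi 0) :=
    (continuousOn_id.mul (continuousOn_decayK hκ)).mul hf.continuousOn
  have hi := integrableOn_mul_decayK_mul hκ hR hf hf2
  set N : ℝ → ℝ := fun s => (∫ ρ in Ioi R, ρ * decayK κ ρ * f ρ)
    - ∫ ρ in R..s, ρ * decayK κ ρ * f ρ with hN
  have hNd : ∀ s, 0 < s → HasDerivAt N (-(s * decayK κ s * f s)) s := fun s hs =>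
    (hasDerivAt_integral_of_continuousOn hR hh hs).const_sub _
  have hNI : ∀ s, R ≤ s → N s = ∫ ρ in Ioi s, ρ * decayK κ ρ * f ρ := fun s hs => by
    rw [hN, sub_eq_iff_eq_add, add_comm]
    exact (intervalIntegral.integral_interval_add_Ioi hi
      (hi.mono_set (Ioi_subset_Ioi hs))).symm
  set B : ℝ → ℝ := fun s => N s / (s * decayK κ s) / κ ^ 2 with hB
  have hBd : ∀ s, 0 < s → HasDerivAt B
      (-(f s / κ ^ 2) + B s * (besselK 0 (s / κ) / κ) / decayK κ s) s := fun s hs => by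
    have hp := (decayK_pos hκ hs).ne'
    refine (((hNd s hs).div ((hasDerivAt_id s).mul (hasDerivAt_decayK hκ hs))
      (mul_ne_zero hs.ne' hp)).div_const (κ ^ 2)).congr_deriv ?_
    simp only [id, Pi.mul_apply, hB]
    field_simp
    ring
  have hBc : ContinuousOn B (Ioi 0) := fun s hs =>
    (hBd s hs).continuousAt.continuousWithinAt
  have hBlim : Tendsto B atTop (𝓝 0) := by
    set C := ((1 + κ / R) * κ + ∫ r in Ioi R, r * f r ^ 2) / 2 / κ ^ 2 with hC
    have h1 : Tendsto (fun s => C * (√s)⁻¹) atTop (𝓝 0) := by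
      have h2 : Tendsto (fun s : ℝ => (√s)⁻¹) atTop (𝓝 0) :=
        tendsto_inv_atTop_zero.comp Real.tendsto_sqrt_atTop
      simpa using h2.const_mul C
    refine squeeze_zero_norm' ?_ h1
    filter_upwards [eventually_ge_atTop R] with s hs
    have hs0 := hR.trans_le hs
    have hp := decayK_pos hκ hs0
    have hsq : 0 < √s := Real.sqrt_pos.2 hs0
    have h3 := abs_integral_mul_decayK_mul_le hκ hR hf2 hs
    rw [hB]
    simp only
    rw [hNI s hs, norm_div, norm_div, Real.norm_eq_abs, Real.norm_eq_abs, Real.norm_eq_abs,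
      abs_of_pos (mul_pos hs0 hp), abs_of_pos (pow_pos hκ 2)]
    calc _ ≤ (decayK κ s * √s / 2 * ((1 + κ / R) * κ + ∫ r in Ioi R, r * f r ^ 2))
          / (s * decayK κ s) / κ ^ 2 := by gcongr
      _ = C * (√s)⁻¹ := by
        have hss : s = √s * √s := (Real.mul_self_sqrt hs0.le).symm
        rw [hC]
        generalize decayK κ s = d at hp ⊢
        generalize √s = t at hss hsq ⊢
        subst hss
        field_simp
  set g : ℝ → ℝ := fun r => ∫ s in R..r, B s / decayK κ s with hg
  have hgd : ∀ r, 0 < r → HasDerivAt g (B r / decayK κ r) r := fun r hr =>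
    hasDerivAt_integral_of_continuousOn hR
      (hBc.div (continuousOn_decayK hκ) fun s hs => (decayK_pos hκ hs).ne') hr
  have hwlim : Tendsto (fun r => decayK κ r * g r) atTop (𝓝 0) :=
    tendsto_mul_integral_div hκ hR (fun r hr => decayK_pos hκ hr) (continuousOn_decayK hκ)
      (fun s r hs hsr => decayK_le_exp hκ hs hsr) hBc hBlim
  refine ⟨fun r => decayK κ r * g r, fun r => -(besselK 0 (r / κ) / κ) * g r + B r, fun r hr => ?_,
    fun r hr => ?_, ?_, hwlim, ?_⟩
  · refine ((hasDerivAt_decayK hκ hr).mul (hgd r hr)).congr_deriv ?_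
    have hp := (decayK_pos hκ hr).ne'
    field_simp
    ring
  · refine ((((hasDerivAt_besselK_zero_div hκ hr).div_const κ).neg.mul (hgd r hr)).add
      (hBd r hr)).congr_deriv ?_
    have hp := (decayK_pos hκ hr).ne'
    simp only [Pi.neg_apply]
    field_simp
    ring
  · simp [hg]
  · have h1 : Tendsto (fun r => -(besselK 0 (r / κ) / κ) * g r) atTop (𝓝 0) := by
      have h2 : Tendsto (fun r => κ⁻¹ * |decayK κ r * g r|) atTop (𝓝 0) := by
        simpa using hwlim.abs.const_mul κ⁻¹
      refine squeeze_zero_norm' ?_ h2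
      filter_upwards [eventually_gt_atTop 0] with r hr
      have hp := decayK_pos hκ hr
      have h0 := besselK_zero_pos (div_pos hr hκ)
      have h01 : besselK 0 (r / κ) ≤ decayK κ r := besselK_zero_le_one (div_pos hr hκ)
      rw [norm_mul, norm_neg, Real.norm_of_nonneg (by positivity), Real.norm_eq_abs, abs_mul,
        abs_of_pos hp, div_eq_inv_mul, mul_assoc]
      gcongr
    simpa using h1.add hBlim

end Dirichlet

/-! ### The regularizing operators on continuous square integrable data -/

section Solve

variable {κ R : ℝ} {f g u v e : ℝ → ℝ}

theorem eventually_gt_of_lt {r : ℝ} (hr : R < r) : ∀ᶠ ρ in 𝓝 r, R < ρ := Ioi_mem_nhds hr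

theorem dr_of_hasDerivAt {r e : ℝ} (h : HasDerivAt u (e - u r / r) r) : dr u r = e := by
  rw [dr, h.deriv]; ring

theorem dr_congr {r : ℝ} (h : ∀ r, R < r → u r = v r) (hr : R < r) : dr u r = dr v r := by
  have h1 : u =ᶠ[𝓝 r] v := (eventually_gt_of_lt hr).mono h
  rw [dr, dr, h1.deriv_eq, h r hr]

theorem hasDerivAt_congr_Ioi {r d : ℝ} (h : ∀ r, R < r → u r = v r) (hr : R < r)
    (hv : HasDerivAt v d r) : HasDerivAt u d r :=
  hv.congr_of_eventuallyEq ((eventually_gt_of_lt hr).mono h)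

theorem isR0_of_hasDerivAt (hκ : 0 < κ) (hu : ∀ r, R < r → HasDerivAt u (e r - u r / r) r)
    (he : ∀ r, R < r → HasDerivAt e ((u r - f r) / κ ^ 2) r)
    (hb : Tendsto u (𝓝[>] R) (𝓝 0)) (hd : Tendsto u atTop (𝓝 0)) : IsR0 κ R f u := by
  have h1 : ∀ r, R < r → dr u r = e r := fun r hr => dr_of_hasDerivAt (hu r hr)
  have h2 : ∀ r, R < r → HasDerivAt (dr u) ((u r - f r) / κ ^ 2) r := fun r hr =>
    hasDerivAt_congr_Ioi h1 hr (he r hr)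
  refine ⟨fun r hr => (hu r hr).differentiableAt, fun r hr => (h2 r hr).differentiableAt,
    fun r hr => ?_, hb, hd⟩
  rw [(h2 r hr).deriv]
  field_simp
  ring

theorem IsR0.hasDerivAt_dr (hκ : 0 < κ) (hu : IsR0 κ R f u) {r : ℝ} (hr : R < r) :
    HasDerivAt (dr u) ((u r - f r) / κ ^ 2) r := by
  refine (hu.diff' r hr).hasDerivAt.congr_deriv ?_
  rw [← hu.eqn r hr]
  field_simp
  ring

theorem IsR0.add (hκ : 0 < κ) (hu : IsR0 κ R f u) (hv : IsR0 κ R g v) :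
    IsR0 κ R (fun r => f r + g r) (fun r => u r + v r) := by
  refine isR0_of_hasDerivAt (e := fun r => dr u r + dr v r) hκ (fun r hr => ?_) (fun r hr => ?_)
    (by simpa using hu.bdry.add hv.bdry) (by simpa using hu.decay.add hv.decay)
  · refine ((hasDerivAt_of_dr (hu.diff r hr)).add (hasDerivAt_of_dr (hv.diff r hr))).congr_deriv ?_
    ring
  · refine ((hu.hasDerivAt_dr hκ hr).add (hv.hasDerivAt_dr hκ hr)).congr_deriv ?_
    ring

theorem IsR0.const_mul (hκ : 0 < κ) (c : ℝ) (hu : IsR0 κ R f u) :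
    IsR0 κ R (fun r => c * f r) (fun r => c * u r) := by
  refine isR0_of_hasDerivAt (e := fun r => c * dr u r) hκ (fun r hr => ?_) (fun r hr => ?_)
    (by simpa using hu.bdry.const_mul c) (by simpa using hu.decay.const_mul c)
  · exact ((hasDerivAt_of_dr (hu.diff r hr)).const_mul c).congr_deriv (by ring)
  · exact ((hu.hasDerivAt_dr hκ hr).const_mul c).congr_deriv (by ring)

/-- `𝕽₀ f` is defined for a continuous `f` in `L²(r dr)`; its radial divergence has a trace at `R`
and vanishes at infinity. -/
theorem R0_spec (hκ : 0 < κ) (hR : 0 < R) (hg : ContinuousOn g (Ici R))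
    (hfg : ∀ r, R < r → f r = g r) (hf : MemL2r R f) :
    IsR0 κ R f (R0 κ R f) ∧ (∃ l, Tendsto (dr (R0 κ R f)) (𝓝[>] R) (𝓝 l)) ∧
      Tendsto (dr (R0 κ R f)) atTop (𝓝 0) := by
  have hgc : Continuous fun r => g (max r R) :=
    hg.comp_continuous (by fun_prop) fun r => le_max_right r R
  have hge : ∀ r, R < r → g (max r R) = f r := fun r hr => by
    rw [max_eq_left hr.le, hfg r hr]
  have hg2 : IntegrableOn (fun r => r * g (max r R) ^ 2) (Ioi R) :=
    (hf.integrableOn hR).congr_fun (fun r hr => by simp only [hge r hr]) measurableSet_Ioi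
  obtain ⟨w, e, hw, he, hwR, hwd, hed⟩ := exists_dirichlet hκ hR hgc hg2
  have hwb : Tendsto w (𝓝[>] R) (𝓝 0) := by
    rw [← hwR]
    exact (hw R hR).continuousAt.tendsto.mono_left nhdsWithin_le_nhds
  have hw0 : IsR0 κ R f w := (isR0_of_hasDerivAt hκ (fun r hr => hw r (hR.trans hr))
    (fun r hr => he r (hR.trans hr)) hwb hwd).congr hge
  have h0 := hw0.isR0_R0
  have hdr : ∀ r, R < r → e r = dr (R0 κ R f) r := fun r hr => by
    rw [dr_congr (h0.unique hκ hR hw0) hr, dr_of_hasDerivAt (hw r (hR.trans hr))]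
  refine ⟨h0, ⟨e R, ?_⟩, ?_⟩
  · refine ((he R hR).continuousAt.tendsto.mono_left nhdsWithin_le_nhds).congr' ?_
    filter_upwards [self_mem_nhdsWithin] with r hr using hdr r hr
  · refine hed.congr' ?_
    filter_upwards [eventually_gt_atTop R] with r hr using hdr r hr

/-- The commutation `∂_r 𝕽₁ = 𝕽₀ ∂_r`, which also provides `𝕽₁ f = f + κ² d_r 𝕽₀ (∂_r f)`. -/
theorem R1_spec {f1 : ℝ → ℝ} (hκ : 0 < κ) (hR : 0 < R)
    (hf : ∀ r, R < r → HasDerivAt f (f1 r) r) (hf0 : Tendsto f atTop (𝓝 0))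
    (hf1 : ContinuousOn f1 (Ici R)) (hf12 : MemL2r R f1) :
    IsR1 κ R f (R1 κ R f) ∧
      (∀ r, R < r → R1 κ R f r = f r + κ ^ 2 * dr (R0 κ R f1) r) ∧
      (∀ r, R < r → HasDerivAt (R1 κ R f) (R0 κ R f1 r) r) := by
  obtain ⟨h0, -, hd⟩ := R0_spec hκ hR hf1 (fun _ _ => rfl) hf12
  set v : ℝ → ℝ := fun r => f r + κ ^ 2 * dr (R0 κ R f1) r with hv
  have hvd : ∀ r, R < r → HasDerivAt v (R0 κ R f1 r) r := fun r hr => by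
    refine ((hf r hr).add ((h0.hasDerivAt_dr hκ hr).const_mul (κ ^ 2))).congr_deriv ?_
    field_simp
    ring
  have hve : ∀ r, R < r → deriv v r = R0 κ R f1 r := fun r hr => (hvd r hr).deriv
  have hv1 : IsR1 κ R f v := by
    refine ⟨fun r hr => (hvd r hr).differentiableAt, fun r hr => ?_, fun r hr => ?_, ?_, ?_⟩
    · exact (hasDerivAt_congr_Ioi hve hr (h0.diff r hr).hasDerivAt).differentiableAt
    · rw [dr_congr hve hr]
      simp [hv]
    · refine h0.bdry.congr' ?_
      filter_upwards [self_mem_nhdsWithin] with r hr using (hve r hr).symm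
    · simpa using hf0.add (hd.const_mul (κ ^ 2))
  have h1 := hv1.isR1_R1
  have h2 := h1.unique hκ hR hv1
  exact ⟨h1, h2, fun r hr => hasDerivAt_congr_Ioi h2 hr (hvd r hr)⟩

end Solve

/-! ### Functions of the weighted space -/

section Weighted

variable {R : ℝ} {f g : ℝ → ℝ}

theorem ae_weighted {p : ℝ → Prop} (h : ∀ r, R < r → p r) :
    ∀ᵐ r ∂((volume.restrict (Ioi R)).withDensity fun r => ENNReal.ofReal r), p r := by
  refine (withDensity_absolutelyContinuous _ _).ae_le ?_
  filter_upwards [ae_restrict_mem measurableSet_Ioi] with r hr using h r hr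

theorem MemL2r.congr (hf : MemL2r R f) (hfg : ∀ r, R < r → f r = g r) : MemL2r R g :=
  MemLp.ae_eq (ae_weighted hfg) hf

theorem MemL2r.bdd_mul (hf : MemL2r R f) (hg : ContinuousOn g (Ioi R)) {C : ℝ}
    (hC : ∀ r, R < r → |g r| ≤ C) : MemL2r R fun r => g r * f r := by
  have hgm : AEStronglyMeasurable g
      ((volume.restrict (Ioi R)).withDensity fun r => ENNReal.ofReal r) :=
    (hg.aestronglyMeasurable measurableSet_Ioi).mono_ac (withDensity_absolutelyContinuous _ _)
  refine MemLp.of_le_mul (c := C) hf (hgm.mul hf.1) (ae_weighted fun r hr => ?_)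
  rw [norm_mul]
  exact mul_le_mul_of_nonneg_right (hC r hr) (norm_nonneg _)

theorem MemL2r.add (hf : MemL2r R f) (hg : MemL2r R g) : MemL2r R fun r => f r + g r :=
  MemLp.add hf hg

theorem MemL2r.sub (hf : MemL2r R f) (hg : MemL2r R g) : MemL2r R fun r => f r - g r :=
  MemLp.sub hf hg

theorem MemL2r.const_mul (hf : MemL2r R f) (c : ℝ) : MemL2r R fun r => c * f r :=
  MemLp.const_mul hf c

theorem MemL2r.zero : MemL2r R fun _ => 0 := MemLp.zero'

theorem MemL2r.div_self (hR : 0 < R) (hf : MemL2r R f) : MemL2r R fun r => f r / r := by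
  refine (hf.bdd_mul (g := fun r => r⁻¹) (C := R⁻¹) ?_ fun r hr => ?_).congr fun r _ => by ring
  · exact continuousOn_id.inv₀ fun r hr => (hR.trans hr).ne'
  · rw [abs_of_pos (inv_pos.2 (hR.trans hr))]
    exact inv_anti₀ hR hr.le

/-- A function of `L²(r dr)` with derivative in `L²(r dr)` vanishes at infinity. -/
theorem tendsto_zero_of_memL2r (hR : 0 < R) (hf : ∀ r, R < r → HasDerivAt f (g r) r)
    (hf2 : MemL2r R f) (hg2 : MemL2r R g) : Tendsto f atTop (𝓝 0) := by
  have hi : ∀ {p : ℝ → ℝ}, IntegrableOn (fun r => r * p r) (Ioi R) → IntegrableOn p (Ioi R) := by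
    intro p hp
    have h1 : AEStronglyMeasurable p (volume.restrict (Ioi R)) := by
      have h2 : AEStronglyMeasurable (fun r => r⁻¹ * (r * p r)) (volume.restrict (Ioi R)) :=
        (measurable_id.inv.aestronglyMeasurable).mul hp.1
      refine h2.congr ?_
      filter_upwards [ae_restrict_mem measurableSet_Ioi] with r hr
      have := (hR.trans hr).ne'
      field_simp
    refine Integrable.mono' (hp.norm.const_mul R⁻¹) h1 ?_
    filter_upwards [ae_restrict_mem measurableSet_Ioi] with r hr
    have hr0 := hR.trans hr
    rw [norm_mul, Real.norm_of_nonneg hr0.le]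
    calc ‖p r‖ = R⁻¹ * (R * ‖p r‖) := by field_simp
      _ ≤ R⁻¹ * (r * ‖p r‖) := by
        have : R ≤ r := le_of_lt hr
        gcongr
  have h1 : IntegrableOn (fun r => r * (f r * g r)) (Ioi R) := by
    have h2 : IntegrableOn (fun r => 2⁻¹ * ((r * (f r + g r) ^ 2 - r * f r ^ 2) - r * g r ^ 2))
        (Ioi R) :=
      (((hf2.add hg2).integrableOn hR).sub (hf2.integrableOn hR) |>.sub
        (hg2.integrableOn hR)).const_mul 2⁻¹
    refine h2.congr_fun (fun r _ => ?_) measurableSet_Ioi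
    simp only
    ring
  have h3 := tendsto_zero_of_hasDerivAt_of_integrableOn_Ioi (f := fun r => f r ^ 2)
    (f' := fun r => 2 * (f r * g r)) (fun r hr => hasDerivAt_sq (hf r hr))
    ((hi h1).const_mul 2) (hi (hf2.integrableOn hR))
  have h4 := h3.sqrt
  simp only [Real.sqrt_sq_eq_abs, Real.sqrt_zero] at h4
  exact (tendsto_zero_iff_abs_tendsto_zero f).2 h4

theorem exists_abs_le_of_tendsto {l : ℝ} (hf : ContinuousOn f (Ici R))
    (hl : Tendsto f atTop (𝓝 l)) : ∃ C, ∀ r, R < r → |f r| ≤ C := by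
  have h1 : ∀ᶠ r in atTop, |f r| ≤ |l| + 1 :=
    hl.abs.eventually (ge_mem_nhds (lt_add_one _))
  obtain ⟨S, hS⟩ := eventually_atTop.1 h1
  obtain ⟨C, hC⟩ := (isCompact_Icc (a := R) (b := S)).exists_bound_of_continuousOn
    (hf.mono Icc_subset_Ici_self)
  refine ⟨max C (|l| + 1), fun r hr => ?_⟩
  rcases le_total r S with h | h
  · exact (hC r ⟨hr.le, h⟩).trans (le_max_left _ _)
  · exact (hS r h).trans (le_max_right _ _)

end Weighted

/-! ### The nonlocal terms at a fixed time -/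

/-- The exterior unknowns at a fixed time: `z = ζ` and `y = q` are functions on `[R, ∞)`, and `z1`,
`e`, `e1` are continuous extensions up to `r = R` of `∂_r z`, `d_r y` and `∂_r d_r y`. -/
structure RegularSlice (ε R : ℝ) (z z1 y e e1 : ℝ → ℝ) : Prop where
  cont_z : ContinuousOn z (Ici R)
  cont_z1 : ContinuousOn z1 (Ici R)
  cont_y : ContinuousOn y (Ici R)
  cont_e : ContinuousOn e (Ici R)
  cont_e1 : ContinuousOn e1 (Ici R)
  deriv_z : ∀ r, R < r → HasDerivAt z (z1 r) r
  deriv_y : ∀ r, R < r → HasDerivAt y (e r - y r / r) r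
  deriv_e : ∀ r, R < r → HasDerivAt e (e1 r) r
  mem_z : MemL2r R z
  mem_z1 : MemL2r R z1
  mem_y : MemL2r R y
  mem_e : MemL2r R e
  mem_e1 : MemL2r R e1
  height : ∀ r, R ≤ r → 0 < 1 + ε * z r

namespace RegularSlice

variable {ε R : ℝ} {z z1 y e e1 : ℝ → ℝ}

theorem tendsto_z (h : RegularSlice ε R z z1 y e e1) (hR : 0 < R) : Tendsto z atTop (𝓝 0) :=
  tendsto_zero_of_memL2r hR h.deriv_z h.mem_z h.mem_z1

theorem tendsto_y (h : RegularSlice ε R z z1 y e e1) (hR : 0 < R) : Tendsto y atTop (𝓝 0) :=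
  tendsto_zero_of_memL2r hR h.deriv_y h.mem_y (h.mem_e.sub (h.mem_y.div_self hR))

theorem tendsto_e (h : RegularSlice ε R z z1 y e e1) (hR : 0 < R) : Tendsto e atTop (𝓝 0) :=
  tendsto_zero_of_memL2r hR h.deriv_e h.mem_e h.mem_e1

theorem cont_inv_height (h : RegularSlice ε R z z1 y e e1) :
    ContinuousOn (fun r => (1 + ε * z r)⁻¹) (Ici R) :=
  (continuousOn_const.add (continuousOn_const.mul h.cont_z)).inv₀ fun r hr => (h.height r hr).ne'

theorem tendsto_inv_height (h : RegularSlice ε R z z1 y e e1) (hR : 0 < R) :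
    Tendsto (fun r => (1 + ε * z r)⁻¹) atTop (𝓝 1) := by
  have h1 : Tendsto (fun r => 1 + ε * z r) atTop (𝓝 1) := by
    simpa using ((h.tendsto_z hR).const_mul ε).const_add 1
  simpa using h1.inv₀ one_ne_zero

theorem memL2r_mul {g f : ℝ → ℝ} {l : ℝ} (hg : ContinuousOn g (Ici R))
    (hl : Tendsto g atTop (𝓝 l)) (hf : MemL2r R f) : MemL2r R fun r => g r * f r := by
  obtain ⟨C, hC⟩ := exists_abs_le_of_tendsto hg hl
  exact hf.bdd_mul (hg.mono Ioi_subset_Ici_self) hC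

variable {P : Params}

theorem dr_y (h : RegularSlice ε R z z1 y e e1) {r : ℝ} (hr : R < r) : dr y r = e r :=
  dr_of_hasDerivAt (h.deriv_y r hr)

/-- The derivative of `fluxArg`. -/
theorem hasDerivAt_fluxArg (h : RegularSlice P.ε P.R z z1 y e e1) {r : ℝ} (hr : P.R < r) :
    HasDerivAt (fluxArg P fun r => (z r, y r))
      (z1 r - P.ν * e1 r + P.ε * (z r * z1 r + (2 * y r * (1 + P.ε * z r)⁻¹ * (e r - y r / r)
        - P.ε * (y r * (1 + P.ε * z r)⁻¹) ^ 2 * z1 r))) r := by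
  have hh := (h.height r hr.le).ne'
  have h1 : HasDerivAt (fun r => z r - P.ν * e r + P.ε * (z r ^ 2 / 2 + y r ^ 2 / (1 + P.ε * z r)))
      (z1 r - P.ν * e1 r + P.ε * (z r * z1 r + (2 * y r * (1 + P.ε * z r)⁻¹ * (e r - y r / r)
        - P.ε * (y r * (1 + P.ε * z r)⁻¹) ^ 2 * z1 r))) r := by
    refine (((h.deriv_z r hr).sub ((h.deriv_e r hr).const_mul P.ν)).add
      ((((hasDerivAt_sq (h.deriv_z r hr)).div_const 2).add
        ((hasDerivAt_sq (h.deriv_y r hr)).div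
          (((h.deriv_z r hr).const_mul P.ε).const_add 1) hh)).const_mul P.ε)).congr_deriv ?_
    generalize e r - y r / r = d
    field_simp
  refine hasDerivAt_congr_Ioi (R := P.R) (fun ρ hρ => ?_) hr h1
  simp only [fluxArg, h.dr_y hρ]

theorem viscousArg_eq (h : RegularSlice P.ε P.R z z1 y e e1) {r : ℝ} (hr : P.R < r) :
    viscousArg P (fun r => (z r, y r)) r
      = (if P.ε = 0 then 0 else 1) * ((1 + P.ε * z r)⁻¹ * z1 r) * e r := by
  have hh := (h.height r hr.le).ne'
  simp only [viscousArg, h.dr_y hr]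
  rcases eq_or_ne P.ε 0 with h0 | h0
  · simp [h0]
  · rw [(((((h.deriv_z r hr).const_mul P.ε).const_add 1).log hh).div_const P.ε).deriv, if_neg h0]
    field_simp

/-- At a fixed time, all nonlocal terms of the augmented system are defined.  The sum `W` of the
nonlocal contributions to `-∂_t q` solves the Dirichlet problem whose right-hand side consists of the
local terms of the momentum equation, and `f_hyd` differs from the local flux by `κ² d_r W`. -/
theorem exists_nonlocal (hP : P.Admissible) (h : RegularSlice P.ε P.R z z1 y e e1) :
    NonlocalDefined P (fun r => (z r, y r)) ∧ ∃ W : ℝ → ℝ,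
      IsR0 P.κ P.R (fun r => P.ε * dr (fun ρ => y ρ ^ 2 / (1 + P.ε * z ρ)) r
        + (1 + P.ε * z r) * deriv z r
        - P.ν * (1 + P.ε * z r) * deriv (fun ρ => dr y ρ / (1 + P.ε * z ρ)) r) W ∧
      (∀ r, P.R < r → HasDerivAt (R1 P.κ P.R (fluxArg P fun r => (z r, y r)))
        (W r - P.ε * R0 P.κ P.R (radialArg P fun r => (z r, y r)) r
          - P.ε * P.ν * R0 P.κ P.R (viscousArg P fun r => (z r, y r)) r) r) ∧
      (∀ r, P.R < r → fHyd P (fun r => (z r, y r)) r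
        = fluxArg P (fun r => (z r, y r)) r + P.κ ^ 2 * dr W r) := by
  have hκ := hP.κ_pos
  have hR := hP.R_pos
  set u : ℝ → ℝ × ℝ := fun r => (z r, y r) with hu
  have hhi := h.cont_inv_height
  have hhl := h.tendsto_inv_height hR
  have hidc : ContinuousOn (fun r : ℝ => r⁻¹) (Ici P.R) :=
    continuousOn_id.inv₀ fun r hr => (hR.trans_le hr).ne'
  have hyi : ContinuousOn (fun r => y r * (1 + P.ε * z r)⁻¹) (Ici P.R) := h.cont_y.mul hhi
  have hyil : Tendsto (fun r => y r * (1 + P.ε * z r)⁻¹) atTop (𝓝 0) := by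
    simpa using (h.tendsto_y hR).mul hhl
  -- the radial term
  have hrad := R0_spec (f := radialArg P u)
    (g := fun r => r⁻¹ * ((y r * (1 + P.ε * z r)⁻¹) * y r)) hκ hR
    (hidc.mul (hyi.mul h.cont_y)) (fun r _ => by
      simp only [radialArg, hu, div_eq_mul_inv, mul_inv]; ring)
    (((memL2r_mul hyi hyil h.mem_y).div_self hR).congr fun r _ => by
      simp only [radialArg, hu, div_eq_mul_inv, mul_inv]; ring)
  -- the viscous term
  have hvis := R0_spec (f := viscousArg P u)
    (g := fun r => (if P.ε = 0 then 0 else 1) * ((1 + P.ε * z r)⁻¹ * z1 r) * e r) hκ hR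
    ((continuousOn_const.mul (hhi.mul h.cont_z1)).mul h.cont_e) (fun r hr => h.viscousArg_eq hr) (by
      refine ((memL2r_mul (hhi.mul h.cont_e) (hhl.mul (h.tendsto_e hR)) h.mem_z1).const_mul
        (if P.ε = 0 then 0 else 1)).congr fun r hr => ?_
      rw [h.viscousArg_eq hr]
      simp only [Pi.mul_apply]
      ring)
  -- the flux term
  have hsq2 : ContinuousOn (fun r => P.ε * (y r * (1 + P.ε * z r)⁻¹) ^ 2) (Ici P.R) :=
    continuousOn_const.mul (hyi.pow 2)
  have hsq2l : Tendsto (fun r => P.ε * (y r * (1 + P.ε * z r)⁻¹) ^ 2) atTop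
      (𝓝 (P.ε * 0 ^ 2)) := (hyil.pow 2).const_mul _
  have hy2 : ContinuousOn (fun r => 2 * y r * (1 + P.ε * z r)⁻¹) (Ici P.R) :=
    (continuousOn_const.mul h.cont_y).mul hhi
  have hy2l : Tendsto (fun r => 2 * y r * (1 + P.ε * z r)⁻¹) atTop (𝓝 (2 * 0 * 1)) :=
    ((h.tendsto_y hR).const_mul 2).mul hhl
  have hflux0 : Tendsto (fluxArg P u) atTop (𝓝 0) := by
    have h1 : Tendsto (fun r => z r - P.ν * e r
        + P.ε * (z r ^ 2 / 2 + (y r * (1 + P.ε * z r)⁻¹) * y r)) atTop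
        (𝓝 (0 - P.ν * 0 + P.ε * (0 ^ 2 / 2 + 0 * 0))) :=
      ((h.tendsto_z hR).sub ((h.tendsto_e hR).const_mul _)).add
        (((((h.tendsto_z hR).pow 2).div_const 2).add (hyil.mul (h.tendsto_y hR))).const_mul _)
    have h2 : (0 - P.ν * 0 + P.ε * (0 ^ 2 / 2 + 0 * 0) : ℝ) = 0 := by ring
    rw [h2] at h1
    refine h1.congr' ?_
    filter_upwards [eventually_gt_atTop P.R] with r hr
    simp only [fluxArg, hu, h.dr_y hr]
    ring
  obtain ⟨f1, hf1⟩ : ∃ f1 : ℝ → ℝ, f1 = fun r => z1 r - P.ν * e1 r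
    + P.ε * (z r * z1 r + (2 * y r * (1 + P.ε * z r)⁻¹ * (e r - y r / r)
      - P.ε * (y r * (1 + P.ε * z r)⁻¹) ^ 2 * z1 r)) := ⟨_, rfl⟩
  have hf1c : ContinuousOn f1 (Ici P.R) := by
    rw [hf1]
    refine (h.cont_z1.sub (continuousOn_const.mul h.cont_e1)).add (continuousOn_const.mul
      ((h.cont_z.mul h.cont_z1).add ((hy2.mul (h.cont_e.sub ?_)).sub (hsq2.mul h.cont_z1))))
    exact (h.cont_y.mul hidc).congr fun r _ => by
      simp only [Pi.mul_apply, div_eq_mul_inv]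
  have hf1m : MemL2r P.R f1 := by
    rw [hf1]
    exact (h.mem_z1.sub (h.mem_e1.const_mul _)).add
      (((memL2r_mul h.cont_z (h.tendsto_z hR) h.mem_z1).add
        ((memL2r_mul hy2 hy2l (h.mem_e.sub (h.mem_y.div_self hR))).sub
          (memL2r_mul hsq2 hsq2l h.mem_z1))).const_mul _)
  have hfd : ∀ r, P.R < r → HasDerivAt (fluxArg P u) (f1 r) r := fun r hr => by
    rw [hf1]
    exact h.hasDerivAt_fluxArg hr
  obtain ⟨hR1, hR1v, hR1d⟩ := R1_spec hκ hR hfd hflux0 hf1c hf1m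
  obtain ⟨hT, ⟨lT, hlT⟩, -⟩ := R0_spec hκ hR hf1c (fun _ _ => rfl) hf1m
  obtain ⟨hradI, ⟨lr, hlr⟩, -⟩ := hrad
  obtain ⟨hvisI, ⟨lv, hlv⟩, -⟩ := hvis
  have hfluxlim : ∃ l, Tendsto (fluxArg P u) (𝓝[>] P.R) (𝓝 l) := by
    have hc : ContinuousOn (fun r => z r - P.ν * e r
        + P.ε * (z r ^ 2 / 2 + (y r * (1 + P.ε * z r)⁻¹) * y r)) (Ici P.R) :=
      (h.cont_z.sub (continuousOn_const.mul h.cont_e)).add (continuousOn_const.mul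
        (((h.cont_z.pow 2).div_const 2).add (hyi.mul h.cont_y)))
    refine ⟨_, ((hc P.R self_mem_Ici).tendsto.mono_left
      (nhdsWithin_mono _ Ioi_subset_Ici_self)).congr' ?_⟩
    filter_upwards [self_mem_nhdsWithin] with r hr
    simp only [fluxArg, hu, h.dr_y hr]
    ring
  obtain ⟨lf, hlf⟩ := hfluxlim
  have hW := (hT.add hκ (hradI.const_mul hκ P.ε)).add hκ (hvisI.const_mul hκ (P.ε * P.ν))
  have hfh : ∀ r, P.R < r → fHyd P u r = fluxArg P u r + P.κ ^ 2 * dr (R0 P.κ P.R f1) r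
      + P.ε * P.κ ^ 2 * dr (R0 P.κ P.R (radialArg P u)) r
      + P.ε * P.ν * P.κ ^ 2 * dr (R0 P.κ P.R (viscousArg P u)) r := fun r hr => by
    rw [fHyd, hR1v r hr]
  refine ⟨⟨hR1, hradI, hvisI, ?_⟩, _, hW.congr fun r hr => ?_, fun r hr => ?_, fun r hr => ?_⟩
  · have h1 : Tendsto (fHyd P u) (𝓝[>] P.R) (𝓝 (lf + P.κ ^ 2 * lT + P.ε * P.κ ^ 2 * lr
        + P.ε * P.ν * P.κ ^ 2 * lv)) := by
      refine (((hlf.add (hlT.const_mul _)).add (hlr.const_mul _)).add (hlv.const_mul _)).congr' ?_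
      filter_upwards [self_mem_nhdsWithin] with r hr using (hfh r hr).symm
    rw [Ihyd, trace, h1.limUnder_eq]
    exact h1
  · have hh := (h.height r hr.le).ne'
    have hr0 : r ≠ 0 := (hR.trans hr).ne'
    have hH : HasDerivAt (fun ρ => 1 + P.ε * z ρ) (P.ε * z1 r) r :=
      ((h.deriv_z r hr).const_mul P.ε).const_add 1
    have h1 : HasDerivAt (fun ρ => dr y ρ / (1 + P.ε * z ρ)) _ r :=
      hasDerivAt_congr_Ioi (v := fun ρ => e ρ / (1 + P.ε * z ρ))
        (fun ρ hρ => by simp only [h.dr_y hρ]) hr ((h.deriv_e r hr).div hH hh)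
    have h2 : HasDerivAt (fun ρ => y ρ ^ 2 / (1 + P.ε * z ρ)) _ r :=
      (hasDerivAt_sq (h.deriv_y r hr)).div hH hh
    rw [h1.deriv, (h.deriv_z r hr).deriv, h.viscousArg_eq hr, hf1]
    simp only [dr, radialArg, hu]
    rw [h2.deriv]
    rcases eq_or_ne P.ε 0 with h0 | h0
    · simp [h0]
    · rw [if_neg h0]
      field_simp
      ring
  · refine (hR1d r hr).congr_deriv ?_
    ring
  · rw [hfh r hr]
    have h1 := ((hasDerivAt_of_dr (hT.diff r hr)).add
      ((hasDerivAt_of_dr (hradI.diff r hr)).const_mul P.ε)).add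
      ((hasDerivAt_of_dr (hvisI.diff r hr)).const_mul (P.ε * P.ν))
    have h2 : dr (fun r => R0 P.κ P.R f1 r + P.ε * R0 P.κ P.R (radialArg P u) r
        + P.ε * P.ν * R0 P.κ P.R (viscousArg P u) r) r
        = dr (R0 P.κ P.R f1) r + P.ε * dr (R0 P.κ P.R (radialArg P u)) r
        + P.ε * P.ν * dr (R0 P.κ P.R (viscousArg P u)) r :=
      dr_of_hasDerivAt (h1.congr_deriv (by ring))
    rw [h2]
    ring

end RegularSlice

/-! ### Consequences of the regularity of the exterior unknowns -/

section Slices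

variable {T R : ℝ} {f : ℝ → ℝ → ℝ}

theorem hasDerivWithinAt_slice_time
    (hf : ContDiffOn ℝ 1 (fun x : ℝ × ℝ => f x.1 x.2) (Ico 0 T ×ˢ Ici R)) {t r : ℝ}
    (ht : t ∈ Ico 0 T) (hr : R ≤ r) :
    HasDerivWithinAt (fun s => f s r)
      (fderivWithin ℝ (fun x : ℝ × ℝ => f x.1 x.2) (Ico 0 T ×ˢ Ici R) (t, r) (1, 0))
      (Ico 0 T) t := by
  have h1 := ((hf.differentiableOn one_ne_zero) (t, r) ⟨ht, hr⟩).hasFDerivWithinAt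
  have h2 : HasDerivWithinAt (fun s : ℝ => (s, r)) ((1 : ℝ), (0 : ℝ)) (Ico 0 T) t :=
    (hasDerivWithinAt_id t _).prodMk (hasDerivWithinAt_const t _ r)
  have hm : MapsTo (fun s : ℝ => (s, r)) (Ico 0 T) (Ico 0 T ×ˢ Ici R) := fun s hs => ⟨hs, hr⟩
  exact h1.comp_hasDerivWithinAt t h2 hm

theorem hasDerivWithinAt_slice_space
    (hf : ContDiffOn ℝ 1 (fun x : ℝ × ℝ => f x.1 x.2) (Ico 0 T ×ˢ Ici R)) {t r : ℝ}
    (ht : t ∈ Ico 0 T) (hr : R ≤ r) :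
    HasDerivWithinAt (f t)
      (fderivWithin ℝ (fun x : ℝ × ℝ => f x.1 x.2) (Ico 0 T ×ˢ Ici R) (t, r) (0, 1))
      (Ici R) r := by
  have h1 := ((hf.differentiableOn one_ne_zero) (t, r) ⟨ht, hr⟩).hasFDerivWithinAt
  have h2 : HasDerivWithinAt (fun s : ℝ => (t, s)) ((0 : ℝ), (1 : ℝ)) (Ici R) r :=
    (hasDerivWithinAt_const r _ t).prodMk (hasDerivWithinAt_id r _)
  have hm : MapsTo (fun s : ℝ => (t, s)) (Ici R) (Ico 0 T ×ˢ Ici R) := fun s hs => ⟨ht, hs⟩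
  exact h1.comp_hasDerivWithinAt r h2 hm

theorem hasDerivWithinAt_dt {h : ℝ → ℝ} {t : ℝ} (hh : DifferentiableWithinAt ℝ h (Ico 0 T) t) :
    HasDerivWithinAt h (dt T h t) (Ico 0 T) t := hh.hasDerivWithinAt

theorem HasDerivWithinAt.dt_eq {E : Type*} [NormedAddCommGroup E] [NormedSpace ℝ E] {h : ℝ → E}
    {t : ℝ} {d : E} (ht : t ∈ Ico 0 T) (hh : HasDerivWithinAt h d (Ico 0 T) t) : dt T h t = d :=
  hh.derivWithin (uniqueDiffOn_Ico 0 T t ht)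

theorem dt_congr {E : Type*} [NormedAddCommGroup E] [NormedSpace ℝ E] {h k : ℝ → E} {t : ℝ}
    (ht : t ∈ Ico 0 T) (hhk : ∀ s ∈ Ico 0 T, h s = k s) : dt T h t = dt T k t :=
  derivWithin_congr hhk (hhk t ht)

theorem continuousOn_dt_slice
    (hf : ContDiffOn ℝ 1 (fun x : ℝ × ℝ => f x.1 x.2) (Ico 0 T ×ˢ Ici R)) :
    ContinuousOn (fun x : ℝ × ℝ => dt T (fun s => f s x.2) x.1) (Ico 0 T ×ˢ Ici R) := by
  have hu : UniqueDiffOn ℝ (Ico 0 T ×ˢ Ici R) := (uniqueDiffOn_Ico 0 T).prod (uniqueDiffOn_Ici R)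
  refine ((hf.continuousOn_fderivWithin hu le_rfl).clm_apply
    (continuousOn_const (c := ((1 : ℝ), (0 : ℝ))))).congr fun x hx => ?_
  exact HasDerivWithinAt.dt_eq hx.1 (hasDerivWithinAt_slice_time hf hx.1 hx.2)

theorem continuousOn_derivWithin_slice
    (hf : ContDiffOn ℝ 1 (fun x : ℝ × ℝ => f x.1 x.2) (Ico 0 T ×ˢ Ici R)) :
    ContinuousOn (fun x : ℝ × ℝ => derivWithin (f x.1) (Ici R) x.2) (Ico 0 T ×ˢ Ici R) := by
  have hu : UniqueDiffOn ℝ (Ico 0 T ×ˢ Ici R) := (uniqueDiffOn_Ico 0 T).prod (uniqueDiffOn_Ici R)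
  refine ((hf.continuousOn_fderivWithin hu le_rfl).clm_apply
    (continuousOn_const (c := ((0 : ℝ), (1 : ℝ))))).congr fun x hx => ?_
  exact (hasDerivWithinAt_slice_space hf hx.1 hx.2).derivWithin (uniqueDiffOn_Ici R x.2 hx.2)

theorem ContinuousOn.slice_space {g : ℝ → ℝ → ℝ}
    (hg : ContinuousOn (fun x : ℝ × ℝ => g x.1 x.2) (Ico 0 T ×ˢ Ici R)) {t : ℝ}
    (ht : t ∈ Ico 0 T) : ContinuousOn (g t) (Ici R) :=
  hg.comp (f := fun r => (t, r)) (by fun_prop) fun _ hr => ⟨ht, hr⟩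

theorem tendsto_trace {g : ℝ → ℝ} (hg : ContinuousOn g (Ici R)) :
    Tendsto g (𝓝[>] R) (𝓝 (g R)) :=
  (hg R self_mem_Ici).tendsto.mono_left (nhdsWithin_mono _ Ioi_subset_Ici_self)

theorem hasDerivAt_of_slice
    (hf : ContDiffOn ℝ 1 (fun x : ℝ × ℝ => f x.1 x.2) (Ico 0 T ×ˢ Ici R)) {t r : ℝ}
    (ht : t ∈ Ico 0 T) (hr : R < r) :
    HasDerivAt (f t) (derivWithin (f t) (Ici R) r) r :=
  (hasDerivWithinAt_slice_space hf ht hr.le).differentiableWithinAt.hasDerivWithinAt.hasDerivAt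
    (Ici_mem_nhds hr)

/-- Equality of mixed derivatives up to the boundary of the domain: only the iterated derivative
`k = ∂_t ∂_r f` is assumed to exist and to be continuous. -/
theorem hasDerivWithinAt_mixed {g k : ℝ → ℝ → ℝ} {ft : ℝ → ℝ} {t r : ℝ} (ht : t ∈ Ico 0 T)
    (hr : R ≤ r)
    (hg : ∀ s ∈ Ico 0 T, ∀ ρ, R ≤ ρ → HasDerivWithinAt (f s) (g s ρ) (Ici R) ρ)
    (hk : ∀ s ∈ Ico 0 T, ∀ ρ, R ≤ ρ → HasDerivWithinAt (fun s => g s ρ) (k s ρ) (Ico 0 T) s)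
    (hkc : ContinuousWithinAt (fun x : ℝ × ℝ => k x.1 x.2) (Ico 0 T ×ˢ Ici R) (t, r))
    (hft : ∀ ρ, R ≤ ρ → HasDerivWithinAt (fun s => f s ρ) (ft ρ) (Ico 0 T) t) :
    HasDerivWithinAt ft (k t r) (Ici R) r := by
  rw [hasDerivWithinAt_iff_isLittleO, Asymptotics.isLittleO_iff]
  intro c hc
  obtain ⟨d, hd, hkd⟩ := Metric.continuousWithinAt_iff.1 hkc c hc
  have hkd' : ∀ s ∈ Ico 0 T ∩ Metric.ball t d, ∀ ρ ∈ Ici R ∩ Metric.ball r d,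
      ‖k s ρ - k t r‖ ≤ c := fun s hs ρ hρ => by
    have := hkd (x := (s, ρ)) ⟨hs.1, hρ.1⟩ (by
      rw [Prod.dist_eq]
      exact max_lt hs.2 hρ.2)
    rw [dist_eq_norm] at this
    exact this.le
  -- the mean value inequality, in time and then in space
  have h1 : ∀ s ∈ Ico 0 T ∩ Metric.ball t d, ∀ ρ ∈ Ici R ∩ Metric.ball r d,
      ‖(g s ρ - k t r * s) - (g t ρ - k t r * t)‖ ≤ c * ‖s - t‖ := fun s hs ρ hρ =>
    ((convex_Ico 0 T).inter (convex_ball t d)).norm_image_sub_le_of_norm_hasDerivWithin_le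
      (f := fun s => g s ρ - k t r * s) (f' := fun s => k s ρ - k t r * 1)
      (fun x hx => ((hk x hx.1 ρ hρ.1).mono inter_subset_left).sub
        ((hasDerivWithinAt_id x _).const_mul _))
      (fun x hx => by rw [mul_one]; exact hkd' x hx ρ hρ)
      ⟨ht, Metric.mem_ball_self hd⟩ hs
  have h2 : ∀ s ∈ Ico 0 T ∩ Metric.ball t d, ∀ ρ ∈ Ici R ∩ Metric.ball r d,
      ‖(f s ρ - f t ρ - k t r * (s - t) * ρ) - (f s r - f t r - k t r * (s - t) * r)‖
        ≤ c * ‖s - t‖ * ‖ρ - r‖ := fun s hs ρ hρ =>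
    ((convex_Ici R).inter (convex_ball r d)).norm_image_sub_le_of_norm_hasDerivWithin_le
      (f := fun ρ => f s ρ - f t ρ - k t r * (s - t) * ρ)
      (f' := fun ρ => g s ρ - g t ρ - k t r * (s - t) * 1)
      (fun x hx => ((((hg s hs.1 x hx.1).mono inter_subset_left).sub
        ((hg t ht x hx.1).mono inter_subset_left))).sub ((hasDerivWithinAt_id x _).const_mul _))
      (fun x hx => by
        refine le_trans (le_of_eq ?_) (h1 s hs x hx)
        congr 1
        ring)
      ⟨hr, Metric.mem_ball_self hd⟩ hρ
  filter_upwards [inter_mem_nhdsWithin (Ici R) (Metric.ball_mem_nhds r hd)] with ρ hρ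
  have hslope := hasDerivWithinAt_iff_tendsto_slope.1 ((hft ρ hρ.1).sub (hft r hr))
  have : (𝓝[Ico 0 T \ {t}] t).NeBot :=
    accPt_principal_iff_nhdsWithin.1 (uniqueDiffOn_Ico 0 T t ht).accPt
  have hlim := ((hslope.sub_const ((ρ - r) * k t r))).norm
  refine le_of_tendsto hlim ?_
  have hmem : ∀ᶠ s in 𝓝[Ico 0 T \ {t}] t, s ∈ (Ico 0 T \ {t}) ∩ Metric.ball t d :=
    inter_mem_nhdsWithin _ (Metric.ball_mem_nhds t hd)
  filter_upwards [hmem] with s hs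
  have hst : s - t ≠ 0 := sub_ne_zero.2 hs.1.2
  have h3 := h2 s ⟨hs.1.1, hs.2⟩ ρ hρ
  have h4 : 0 < ‖s - t‖ := norm_pos_iff.2 hst
  refine le_of_mul_le_mul_left ?_ h4
  rw [← norm_mul]
  refine le_trans (le_of_eq ?_) (h3.trans (le_of_eq (by ring)))
  congr 1
  simp only [slope_def_field, Pi.sub_apply]
  field_simp
  ring

end Slices

namespace RegularExterior

variable {R T : ℝ} {ζ q : ℝ → ℝ → ℝ}

/-- The continuous extension of `d_r q` up to `r = R`. -/
noncomputable def drq (R : ℝ) (q : ℝ → ℝ → ℝ) (t r : ℝ) : ℝ :=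
  derivWithin (q t) (Ici R) r + q t r / r

/-- The time derivative of `drq`. -/
noncomputable def drqt (R T : ℝ) (q : ℝ → ℝ → ℝ) (t r : ℝ) : ℝ :=
  dt T (fun s => derivWithin (q s) (Ici R) r) t + dt T (fun s => q s r) t / r

theorem hasDerivWithinAt_time {f : ℝ → ℝ → ℝ}
    (hf : ContDiffOn ℝ 1 (fun x : ℝ × ℝ => f x.1 x.2) (Ico 0 T ×ˢ Ici R)) {t r : ℝ}
    (ht : t ∈ Ico 0 T) (hr : R ≤ r) :
    HasDerivWithinAt (fun s => f s r) (dt T (fun s => f s r) t) (Ico 0 T) t :=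
  hasDerivWithinAt_dt (hasDerivWithinAt_slice_time hf ht hr).differentiableWithinAt

variable (h : RegularExterior R T ζ q)
include h

theorem dr_eq_drq {t r : ℝ} (ht : t ∈ Ico 0 T) (hr : R < r) : dr (q t) r = drq R q t r := by
  rw [dr, drq, (hasDerivAt_of_slice h.smooth_q ht hr).deriv]

theorem hasDerivWithinAt_drq {t r : ℝ} (ht : t ∈ Ico 0 T) (hr : R ≤ r) :
    HasDerivWithinAt (fun s => drq R q s r) (drqt R T q t r) (Ico 0 T) t :=
  (hasDerivWithinAt_time h.smooth_dq ht hr).add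
    ((hasDerivWithinAt_time h.smooth_q ht hr).div_const r)

theorem continuousOn_drq (hR : 0 < R) {t : ℝ} (ht : t ∈ Ico 0 T) :
    ContinuousOn (drq R q t) (Ici R) :=
  (ContinuousOn.slice_space (g := fun t r => derivWithin (q t) (Ici R) r)
    h.smooth_dq.continuousOn ht).add
    ((ContinuousOn.slice_space h.smooth_q.continuousOn ht).div continuousOn_id fun _ hr =>
      (hR.trans_le hr).ne')

theorem continuousOn_drqt (hR : 0 < R) {t : ℝ} (ht : t ∈ Ico 0 T) :
    ContinuousOn (drqt R T q t) (Ici R) :=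
  (ContinuousOn.slice_space (g := fun t r => dt T (fun s => derivWithin (q s) (Ici R) r) t)
    (continuousOn_dt_slice h.smooth_dq) ht).add
    ((ContinuousOn.slice_space (g := fun t r => dt T (fun s => q s r) t)
      (continuousOn_dt_slice h.smooth_q) ht).div continuousOn_id
      fun _ hr => (hR.trans_le hr).ne')

theorem hasDerivAt_qt {t r : ℝ} (ht : t ∈ Ico 0 T) (hr : R < r) :
    HasDerivAt (fun ρ => dt T (fun s => q s ρ) t)
      (drqt R T q t r - dt T (fun s => q s r) t / r) r := by
  refine ((hasDerivWithinAt_mixed (f := q) (g := fun s ρ => derivWithin (q s) (Ici R) ρ)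
    (k := fun t r => dt T (fun s => derivWithin (q s) (Ici R) r) t)
    (ft := fun ρ => dt T (fun s => q s ρ) t) ht hr.le ?_ ?_ ?_ ?_).hasDerivAt
    (Ici_mem_nhds hr)).congr_deriv ?_
  · exact fun s hs ρ hρ =>
      (hasDerivWithinAt_slice_space h.smooth_q hs hρ).differentiableWithinAt.hasDerivWithinAt
  · exact fun s hs ρ hρ => hasDerivWithinAt_time h.smooth_dq hs hρ
  · exact continuousOn_dt_slice h.smooth_dq (t, r) ⟨ht, hr.le⟩
  · exact fun ρ hρ => hasDerivWithinAt_time h.smooth_q ht hρ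
  · rw [drqt]
    ring

theorem dr_qt {t r : ℝ} (ht : t ∈ Ico 0 T) (hr : R < r) :
    dr (fun ρ => dt T (fun s => q s ρ) t) r = drqt R T q t r :=
  dr_of_hasDerivAt (h.hasDerivAt_qt ht hr)

theorem tendsto_dr_qt (hR : 0 < R) {t : ℝ} (ht : t ∈ Ico 0 T) :
    Tendsto (dr fun ρ => dt T (fun s => q s ρ) t) (𝓝[>] R) (𝓝 (drqt R T q t R)) := by
  refine (tendsto_trace (h.continuousOn_drqt hR ht)).congr' ?_
  filter_upwards [self_mem_nhdsWithin] with r hr using (h.dr_qt ht hr).symm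

theorem tendsto_qt_atTop (hR : 0 < R) {t : ℝ} (ht : t ∈ Ico 0 T) :
    Tendsto (fun ρ => dt T (fun s => q s ρ) t) atTop (𝓝 0) := by
  refine tendsto_zero_of_memL2r hR (fun r hr => h.hasDerivAt_qt ht hr) (h.mem_qt t ht) ?_
  exact ((h.mem_dqt t ht).congr fun r hr => h.dr_qt ht hr).sub ((h.mem_qt t ht).div_self hR)

theorem tendsto_qt_trace {t : ℝ} (ht : t ∈ Ico 0 T) :
    Tendsto (fun ρ => dt T (fun s => q s ρ) t) (𝓝[>] R) (𝓝 (dt T (fun s => q s R) t)) :=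
  tendsto_trace (ContinuousOn.slice_space (g := fun t r => dt T (fun s => q s r) t)
    (continuousOn_dt_slice h.smooth_q) ht)

theorem tendsto_ζt_trace {t : ℝ} (ht : t ∈ Ico 0 T) :
    Tendsto (fun ρ => dt T (fun s => ζ s ρ) t) (𝓝[>] R) (𝓝 (dt T (fun s => ζ s R) t)) :=
  tendsto_trace (ContinuousOn.slice_space (g := fun t r => dt T (fun s => ζ s r) t)
    (continuousOn_dt_slice h.smooth_ζ) ht)

theorem tendsto_ζ_trace {t : ℝ} (ht : t ∈ Ico 0 T) : Tendsto (ζ t) (𝓝[>] R) (𝓝 (ζ t R)) :=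
  tendsto_trace (ContinuousOn.slice_space h.smooth_ζ.continuousOn ht)

theorem tendsto_q_trace {t : ℝ} (ht : t ∈ Ico 0 T) : Tendsto (q t) (𝓝[>] R) (𝓝 (q t R)) :=
  tendsto_trace (ContinuousOn.slice_space h.smooth_q.continuousOn ht)

theorem tendsto_drq_trace (hR : 0 < R) {t : ℝ} (ht : t ∈ Ico 0 T) :
    Tendsto (dr (q t)) (𝓝[>] R) (𝓝 (drq R q t R)) := by
  refine (tendsto_trace (h.continuousOn_drq hR ht)).congr' ?_
  filter_upwards [self_mem_nhdsWithin] with r hr using (h.dr_eq_drq ht hr).symm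

/-- Mass conservation in the exterior extends to the boundary. -/
theorem dt_ζ_boundary (hR : 0 < R) {t : ℝ} (ht : t ∈ Ico 0 T)
    (hm : ∀ r, R < r → dt T (fun s => ζ s r) t + dr (q t) r = 0) :
    dt T (fun s => ζ s R) t = -drq R q t R := by
  refine tendsto_nhds_unique (h.tendsto_ζt_trace ht)
    ((h.tendsto_drq_trace hR ht).neg.congr' ?_)
  filter_upwards [self_mem_nhdsWithin] with r hr
  linarith [hm r hr]

theorem regularSlice {ε : ℝ} (hR : 0 < R) {t : ℝ} (ht : t ∈ Ico 0 T)
    (hh : ∀ r, R ≤ r → 0 < 1 + ε * ζ t r) :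
    RegularSlice ε R (ζ t) (derivWithin (ζ t) (Ici R)) (q t) (drq R q t)
      (fun r => derivWithin (derivWithin (q t) (Ici R)) (Ici R) r
        + (derivWithin (q t) (Ici R) r / r - q t r / r / r)) := by
  have hd : ∀ r, R < r → HasDerivAt (drq R q t)
      (derivWithin (derivWithin (q t) (Ici R)) (Ici R) r
        + (derivWithin (q t) (Ici R) r / r - q t r / r / r)) r := fun r hr => by
    have hr0 : r ≠ 0 := (hR.trans hr).ne'
    refine ((hasDerivAt_of_slice (f := fun s => derivWithin (q s) (Ici R)) h.smooth_dq ht hr).add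
      ((hasDerivAt_of_slice h.smooth_q ht hr).div (hasDerivAt_id r) hr0)).congr_deriv ?_
    simp only [id]
    field_simp
  have hcq := ContinuousOn.slice_space h.smooth_q.continuousOn ht
  have hcq1 := ContinuousOn.slice_space (g := fun t r => derivWithin (q t) (Ici R) r)
    (continuousOn_derivWithin_slice h.smooth_q) ht
  have hcq2 := ContinuousOn.slice_space
    (g := fun t r => derivWithin (derivWithin (q t) (Ici R)) (Ici R) r)
    (continuousOn_derivWithin_slice (f := fun s => derivWithin (q s) (Ici R)) h.smooth_dq) ht
  have hne : ∀ r ∈ Ici R, r ≠ 0 := fun r hr => (hR.trans_le hr).ne'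
  have hq1 : MemL2r R (derivWithin (q t) (Ici R)) :=
    (h.mem_dq t ht).congr fun r hr => (hasDerivAt_of_slice h.smooth_q ht hr).deriv
  exact
    { cont_z := ContinuousOn.slice_space h.smooth_ζ.continuousOn ht
      cont_z1 := ContinuousOn.slice_space (g := fun t r => derivWithin (ζ t) (Ici R) r)
        (continuousOn_derivWithin_slice h.smooth_ζ) ht
      cont_y := hcq
      cont_e := h.continuousOn_drq hR ht
      cont_e1 := hcq2.add ((hcq1.div continuousOn_id hne).sub
        ((hcq.div continuousOn_id hne).div continuousOn_id hne))
      deriv_z := fun r hr => hasDerivAt_of_slice h.smooth_ζ ht hr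
      deriv_y := fun r hr => (hasDerivAt_of_slice h.smooth_q ht hr).congr_deriv (by
        rw [drq]; ring)
      deriv_e := hd
      mem_z := h.mem_ζ t ht
      mem_z1 := (h.mem_dζ t ht).congr fun r hr => (hasDerivAt_of_slice h.smooth_ζ ht hr).deriv
      mem_y := h.mem_q t ht
      mem_e := hq1.add ((h.mem_q t ht).div_self hR)
      mem_e1 := (h.mem_ddq t ht).congr fun r hr =>
        (hasDerivAt_congr_Ioi (fun ρ hρ => h.dr_eq_drq ht hρ) hr (hd r hr)).deriv
      height := hh }

end RegularExterior

/-! ### Algebra of the boundary equations -/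

section Boundary

variable {P : Params}

theorem G_pos (hP : P.Admissible) : 0 < G P := by
  have h := div_pos hP.R_pos hP.κ_pos
  have h0 := besselK_zero_pos h
  have h1 := besselK_one_pos h
  have := hP.R_pos
  rw [G]
  positivity

theorem tauSq_add_pos (hP : P.Admissible) {δ : ℝ} (hδ : 0 < hInt P δ) :
    0 < tauSq P δ + P.κ * G P := by
  have h1 := G_pos hP
  have h2 := hP.κ_pos
  rw [tauSq]
  positivity

theorem hInt_zero_pos (hP : P.Admissible) : 0 < hInt P 0 := by
  simpa [hInt] using hP.hEq_pos

/-- The boundary equation in rows: multiplication by the invertible matrix `𝓜`. -/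
theorem ode_iff (hP : P.Admissible) (Z Z' : Fin 4 → ℝ) (I F : ℝ) :
    Z' + Dtilde P Z I F = 0 ↔
      Z' 0 = Z 1 ∧
      P.ν * Z' 0 + tauSq P 0 * Z' 1 - P.ν * Z' 2 - P.κ ^ 2 * Z' 3
        + (Z 0 - Z 2 - F - P.ε * gam P Z I F) = 0 ∧
      Z' 2 = Z 3 ∧
      P.κ * G P * Z' 1 + P.ν * Z' 2 + P.κ ^ 2 * Z' 3 + (Z 2 - I + P.ε * fBdry P Z) = 0 := by
  have hdet : (matM P).det = P.κ ^ 2 * (tauSq P 0 + P.κ * G P) := by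
    simp [matM, Matrix.det_succ_row_zero, Fin.sum_univ_succ, Fin.succAbove]
    ring
  have hunit : IsUnit (matM P).det := by
    rw [hdet, isUnit_iff_ne_zero]
    exact mul_ne_zero (pow_ne_zero 2 hP.κ_pos.ne') (tauSq_add_pos hP (hInt_zero_pos hP)).ne'
  set v : Fin 4 → ℝ := Matrix.mulVec matT Z - vecP I F - P.ε • vecPtilde P Z I F with hv
  have h1 : Z' + Dtilde P Z I F = 0 ↔ Matrix.mulVec (matM P) Z' + v = 0 := by
    have h2 : Matrix.mulVec (matM P) (Z' + Dtilde P Z I F) = Matrix.mulVec (matM P) Z' + v := by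
      rw [Matrix.mulVec_add, Dtilde, Matrix.mulVec_mulVec, Matrix.mul_nonsing_inv _ hunit,
        Matrix.one_mulVec]
    have h3 : Function.Injective (Matrix.mulVec (matM P)) :=
      Matrix.mulVec_injective_of_isUnit ((Matrix.isUnit_iff_isUnit_det _).2 hunit)
    rw [← h2]
    constructor
    · intro h
      rw [h, Matrix.mulVec_zero]
    · intro h
      exact h3 (by rw [h, Matrix.mulVec_zero])
  rw [h1, funext_iff]
  simp only [Fin.forall_fin_succ, hv, matM, matT, vecP, vecPtilde]
  simp [Matrix.vecHead, Matrix.vecTail]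
  refine and_congr ?_ (and_congr ?_ (and_congr ?_ ?_)) <;>
    constructor <;> intro h <;> linarith

/-- Newton's equation with the pressure eliminated is equivalent, given the equation for the trace
of `d_r ∂_t q`, to the second row of the boundary equation; both express the acceleration as
`accel`. -/
theorem newton_iff_row (hP : P.Admissible) {Z Z' : Fin 4 → ℝ} {I F : ℝ}
    (hδ : 0 < hInt P (Z 0)) (h0 : Z' 0 = Z 1) (h2 : Z' 2 = Z 3)
    (h3 : P.κ * G P * Z' 1 + P.ν * Z' 2 + P.κ ^ 2 * Z' 3 + (Z 2 - I + P.ε * fBdry P Z) = 0) :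
    (P.ν * Z' 0 + tauSq P 0 * Z' 1 - P.ν * Z' 2 - P.κ ^ 2 * Z' 3
        + (Z 0 - Z 2 - F - P.ε * gam P Z I F) = 0 ↔
      tauSq P (Z 0) * Z' 1 + Z 0 + P.ν * Z 1 - Z 2 - P.ν * Z 3 - P.κ ^ 2 * Z' 3
        = F + P.ε * aCoef P Z * Z 1 ^ 2) ∧
    (tauSq P (Z 0) * Z' 1 + Z 0 + P.ν * Z 1 - Z 2 - P.ν * Z 3 - P.κ ^ 2 * Z' 3
        = F + P.ε * aCoef P Z * Z 1 ^ 2 → accel P Z I F = Z' 1) := by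
  have hA := tauSq_add_pos hP hδ
  have hA0 := tauSq_add_pos hP (hInt_zero_pos hP)
  have hE := hP.hEq_pos
  obtain ⟨N, hN⟩ : ∃ N, N = P.ε * aCoef P Z * Z 1 ^ 2 - P.ε * fBdry P Z - Z 0 - P.ν * Z 1 + I + F :=
    ⟨_, rfl⟩
  obtain ⟨A, hAd⟩ : ∃ A, A = tauSq P (Z 0) + P.κ * G P := ⟨_, rfl⟩
  obtain ⟨A0, hA0d⟩ : ∃ A0, A0 = tauSq P 0 + P.κ * G P := ⟨_, rfl⟩
  rw [← hAd] at hA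
  rw [← hA0d] at hA0
  have hd : A0 - A = P.ε * (P.R ^ 2 * Z 0 / (8 * P.hEq * hInt P (Z 0))) := by
    have e0 : hInt P 0 = P.hEq := by simp [hInt]
    have e1 : P.ε * Z 0 = hInt P (Z 0) - P.hEq := by simp [hInt]
    rw [hA0d, hAd, tauSq, tauSq, e0]
    field_simp
    linear_combination (-P.R ^ 2) * e1
  have hg : P.ε * gam P Z I F = N * A0 / A - N + P.ε * aCoef P Z * Z 1 ^ 2 := by
    have h4 : gam P Z I F = P.R ^ 2 * Z 0 / (8 * P.hEq * hInt P (Z 0)) / A * N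
        + aCoef P Z * Z 1 ^ 2 := by
      rw [gam, hN, hAd]
      field_simp
    rw [h4, mul_add, ← mul_assoc, mul_div_assoc', ← hd]
    field_simp
  have key : tauSq P (Z 0) * Z' 1 + Z 0 + P.ν * Z 1 - Z 2 - P.ν * Z 3 - P.κ ^ 2 * Z' 3
        = F + P.ε * aCoef P Z * Z 1 ^ 2 ↔ A * Z' 1 = N := by
    rw [hN, hAd]
    constructor <;> intro h
    · linear_combination h + h3 - P.ν * h2
    · linear_combination h - h3 + P.ν * h2
  refine ⟨?_, fun h => ?_⟩
  · rw [key]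
    have key2 : P.ν * Z' 0 + tauSq P 0 * Z' 1 - P.ν * Z' 2 - P.κ ^ 2 * Z' 3
        + (Z 0 - Z 2 - F - P.ε * gam P Z I F) = A0 / A * (A * Z' 1 - N) := by
      have h5 : A0 / A * (A * Z' 1 - N) = A0 * Z' 1 - N * A0 / A := by field_simp
      rw [h5, hg, hN, hA0d]
      linear_combination P.ν * h0 - h3
    rw [key2, mul_eq_zero, or_iff_right (div_pos hA0 hA).ne', sub_eq_zero]
  · rw [key] at h
    rw [accel, ← hA0d, hg]
    rw [div_eq_iff hA0.ne']
    have h5 : N * A0 / A = Z' 1 * A0 := by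
      rw [← h]
      field_simp
    rw [h5, hN]
    ring

end Boundary

/-! ### The momentum equation in the exterior -/

section Exterior

variable {κ R : ℝ}

theorem dr_decayK (hκ : 0 < κ) {r : ℝ} (hr : 0 < r) :
    dr (decayK κ) r = -(besselK 0 (r / κ) / κ) :=
  dr_of_hasDerivAt (hasDerivAt_decayK hκ hr)

theorem hasDerivAt_dr_decayK (hκ : 0 < κ) {r : ℝ} (hr : 0 < r) :
    HasDerivAt (dr (decayK κ)) (decayK κ r / κ ^ 2) r :=
  hasDerivAt_congr_Ioi (R := 0) (fun ρ hρ => dr_decayK hκ hρ) hr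
    (((hasDerivAt_besselK_zero_div hκ hr).div_const κ).neg.congr_deriv (by field_simp))

/-- A decaying solution of `(1 - κ² ∂_r d_r) v = -S` with trace `c` at `R` is the sum of a multiple
of the homogeneous solution and of the solution of the Dirichlet problem. -/
theorem eq_decayK_sub_of_eqn (hκ : 0 < κ) (hR : 0 < R) {v S W : ℝ → ℝ} {c : ℝ}
    (hv : ∀ r, R < r → DifferentiableAt ℝ v r) (hv' : ∀ r, R < r → DifferentiableAt ℝ (dr v) r)
    (heq : ∀ r, R < r → v r - κ ^ 2 * deriv (dr v) r = -S r)
    (hb : Tendsto v (𝓝[>] R) (𝓝 c)) (hd : Tendsto v atTop (𝓝 0)) (hW : IsR0 κ R S W) {r : ℝ}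
    (hr : R < r) : v r = c / decayK κ R * decayK κ r - W r := by
  have hp := decayK_pos hκ hR
  have hψb : Tendsto (decayK κ) (𝓝[>] R) (𝓝 (decayK κ R)) :=
    (hasDerivAt_decayK hκ hR).continuousAt.tendsto.mono_left nhdsWithin_le_nhds
  have h1 : IsR0 κ R S (fun r => c / decayK κ R * decayK κ r - v r) := by
    refine isR0_of_hasDerivAt (e := fun r => c / decayK κ R * dr (decayK κ) r - dr v r) hκ
      (fun r hr => ?_) (fun r hr => ?_) ?_ ?_
    · refine (((hasDerivAt_decayK hκ (hR.trans hr)).const_mul _).sub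
        (hasDerivAt_of_dr (hv r hr))).congr_deriv ?_
      rw [dr_decayK hκ (hR.trans hr)]
      ring
    · refine (((hasDerivAt_dr_decayK hκ (hR.trans hr)).const_mul _).sub
        (hv' r hr).hasDerivAt).congr_deriv ?_
      have := heq r hr
      rw [eq_div_iff (pow_ne_zero 2 hκ.ne'), sub_mul, mul_assoc,
        div_mul_cancel₀ _ (pow_ne_zero 2 hκ.ne')]
      linarith
    · have h2 := (hψb.const_mul (c / decayK κ R)).sub hb
      rwa [div_mul_cancel₀ _ hp.ne', sub_self] at h2
    · simpa using ((tendsto_decayK hκ).const_mul (c / decayK κ R)).sub hd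
  linarith [h1.unique hκ hR hW r hr]

/-- Converse of `eq_decayK_sub_of_eqn`, together with the value of `d_r v`. -/
theorem eqn_of_eq_decayK_sub (hκ : 0 < κ) (hR : 0 < R) {v S W : ℝ → ℝ} {c : ℝ} (hW : IsR0 κ R S W)
    (hv : ∀ r, R < r → v r = c / decayK κ R * decayK κ r - W r) :
    (∀ r, R < r → DifferentiableAt ℝ v r) ∧ (∀ r, R < r → DifferentiableAt ℝ (dr v) r) ∧
      (∀ r, R < r → v r - κ ^ 2 * deriv (dr v) r = -S r) ∧
      (∀ r, R < r → dr v r = -(c / decayK κ R * (besselK 0 (r / κ) / κ)) - dr W r) := by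
  have h1 : ∀ r, R < r → HasDerivAt v
      ((-(c / decayK κ R * (besselK 0 (r / κ) / κ)) - dr W r) - v r / r) r := fun r hr => by
    refine hasDerivAt_congr_Ioi hv hr ((((hasDerivAt_decayK hκ (hR.trans hr)).const_mul _).sub
      (hasDerivAt_of_dr (hW.diff r hr))).congr_deriv ?_)
    rw [hv r hr]
    ring
  have h2 : ∀ r, R < r → dr v r = -(c / decayK κ R * (besselK 0 (r / κ) / κ)) - dr W r :=
    fun r hr => dr_of_hasDerivAt (h1 r hr)
  have h3 : ∀ r, R < r → HasDerivAt (dr v) ((v r + S r) / κ ^ 2) r := fun r hr => by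
    refine hasDerivAt_congr_Ioi h2 hr
      (((((hasDerivAt_besselK_zero_div hκ (hR.trans hr)).div_const κ).const_mul
        (c / decayK κ R)).neg.sub (hW.hasDerivAt_dr hκ hr)).congr_deriv ?_)
    rw [hv r hr]
    field_simp
    ring
  refine ⟨fun r hr => (h1 r hr).differentiableAt, fun r hr => (h3 r hr).differentiableAt,
    fun r hr => ?_, h2⟩
  rw [(h3 r hr).deriv]
  field_simp
  ring

end Exterior

/-! ### The interior domain -/

section Interior

theorem hasDerivAt_linear (c r : ℝ) : HasDerivAt (fun ρ : ℝ => -(ρ / 2) * c) (-c / 2) r :=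
  ((((hasDerivAt_id r).div_const 2).neg).mul_const c).congr_deriv (by ring)

theorem dr_linear {c r : ℝ} (hr : r ≠ 0) : dr (fun ρ : ℝ => -(ρ / 2) * c) r = -c := by
  rw [dr, (hasDerivAt_linear c r).deriv]
  field_simp
  ring

theorem dr_congr_nhds {u v : ℝ → ℝ} {r : ℝ} (h : u =ᶠ[𝓝 r] v) : dr u =ᶠ[𝓝 r] dr v := by
  filter_upwards [h.eventuallyEq_nhds] with ρ hρ
  rw [dr, dr, hρ.deriv_eq, hρ.eq_of_nhds]

theorem dr_linear_eventually {u : ℝ → ℝ} {c r : ℝ} (hr : 0 < r)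
    (h : u =ᶠ[𝓝 r] fun ρ => -(ρ / 2) * c) : dr u =ᶠ[𝓝 r] fun _ => -c := by
  filter_upwards [dr_congr_nhds h, Ioi_mem_nhds hr] with ρ h1 h2
  rw [h1, dr_linear (ne_of_gt h2)]

/-- The momentum equation for a constant surface elevation `b` and the discharge `-(r/2) c`. -/
theorem interior_momentum_iff {ε κ ν b c c' r p' : ℝ} {z y yt : ℝ → ℝ} (hr : 0 < r)
    (hb : 0 < 1 + ε * b)
    (hz : z =ᶠ[𝓝 r] fun _ => b) (hy : y =ᶠ[𝓝 r] fun ρ => -(ρ / 2) * c)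
    (hyt : yt =ᶠ[𝓝 r] fun ρ => -(ρ / 2) * c') :
    ((yt r - κ ^ 2 * deriv (dr yt) r) + ε * dr (fun ρ => y ρ ^ 2 / (1 + ε * z ρ)) r
      + (1 + ε * z r) * deriv z r
      = -(1 + ε * z r) * p' + ν * (1 + ε * z r) * deriv (fun ρ => dr y ρ / (1 + ε * z ρ)) r) ↔
    p' = r / (1 + ε * b) * (c' / 2 - 3 * ε * c ^ 2 / (4 * (1 + ε * b))) := by
  have h1 : deriv (dr yt) r = 0 := by
    rw [(dr_linear_eventually hr hyt).deriv_eq]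
    simp
  have h2 : deriv z r = 0 := by
    rw [hz.deriv_eq]
    simp
  have h3 : deriv (fun ρ => dr y ρ / (1 + ε * z ρ)) r = 0 := by
    have h4 : (fun ρ => dr y ρ / (1 + ε * z ρ)) =ᶠ[𝓝 r] fun _ => -c / (1 + ε * b) := by
      filter_upwards [dr_linear_eventually hr hy, hz] with ρ h5 h6
      rw [h5, h6]
    rw [h4.deriv_eq]
    simp
  have h5 : dr (fun ρ => y ρ ^ 2 / (1 + ε * z ρ)) r = 3 * c ^ 2 * r / (4 * (1 + ε * b)) := by
    have h6 : (fun ρ => y ρ ^ 2 / (1 + ε * z ρ)) =ᶠ[𝓝 r]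
        fun ρ => (-(ρ / 2) * c) ^ 2 / (1 + ε * b) := by
      filter_upwards [hy, hz] with ρ h7 h8
      rw [h7, h8]
    rw [(dr_congr_nhds h6).eq_of_nhds, dr,
      ((hasDerivAt_sq (hasDerivAt_linear c r)).div_const (1 + ε * b)).deriv]
    field_simp
    ring
  rw [h1, h2, h3, h5, hyt.eq_of_nhds, hz.eq_of_nhds]
  have hb' := hb.ne'
  constructor
  · intro h
    have h6 : (1 + ε * b) * p' = r / 2 * c' - ε * (3 * c ^ 2 * r / (4 * (1 + ε * b))) := by
      linarith
    have h7 : p' = (r / 2 * c' - ε * (3 * c ^ 2 * r / (4 * (1 + ε * b)))) / (1 + ε * b) := by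
      rw [eq_div_iff hb', ← h6]
      ring
    rw [h7]
    field_simp
  · intro h
    rw [h]
    field_simp
    ring

/-- The mean over the disc of a radial function that is quadratic in the radius. -/
theorem average_ball_quadratic {R a b : ℝ} (hR : 0 < R) {p : ℝ → ℝ}
    (hp : ∀ r, 0 < r → r < R → p r = a * r ^ 2 + b) :
    ⨍ x in Metric.ball (0 : EuclideanSpace ℝ (Fin 2)) R, p ‖x‖ = a * R ^ 2 / 2 + b := by
  have hball : Metric.ball (0 : EuclideanSpace ℝ (Fin 2)) R = (fun x => ‖x‖) ⁻¹' Iio R := by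
    ext x
    simp
  have h1 : ∫ x in Metric.ball (0 : EuclideanSpace ℝ (Fin 2)) R, p ‖x‖
      = ∫ x : EuclideanSpace ℝ (Fin 2), (Iio R).indicator p ‖x‖ := by
    rw [← integral_indicator measurableSet_ball, hball]
    rfl
  have h2 : ∫ y in Ioi (0 : ℝ), y ^ (2 - 1) • (Iio R).indicator p y
      = a * R ^ 4 / 4 + b * R ^ 2 / 2 := by
    have h3 : ∫ y in Ioi (0 : ℝ), y ^ (2 - 1) • (Iio R).indicator p y
        = ∫ y in Ioo 0 R, (a * y ^ 3 + b * y) := by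
      rw [← Ioi_inter_Iio, ← setIntegral_indicator measurableSet_Iio]
      refine setIntegral_congr_fun measurableSet_Ioi fun y hy => ?_
      by_cases hyR : y ∈ Iio R
      · simp only [indicator_of_mem hyR, hp y hy hyR, smul_eq_mul]
        ring
      · simp only [indicator_of_notMem hyR, smul_zero]
    rw [h3, ← integral_Ioc_eq_integral_Ioo, ← intervalIntegral.integral_of_le hR.le,
      intervalIntegral.integral_eq_sub_of_hasDerivAt (f := fun y => a * y ^ 4 / 4 + b * y ^ 2 / 2)]
    · ring
    · intro y _
      refine ((((hasDerivAt_pow 4 y).const_mul a).div_const 4).add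
        (((hasDerivAt_pow 2 y).const_mul b).div_const 2)).congr_deriv ?_
      push_cast
      ring
    · exact Continuous.intervalIntegrable (by fun_prop) _ _
  have h4 := integral_fun_norm_addHaar (volume : Measure (EuclideanSpace ℝ (Fin 2)))
    ((Iio R).indicator p)
  rw [finrank_euclideanSpace_fin, h2] at h4
  have hv : volume.real (Metric.ball (0 : EuclideanSpace ℝ (Fin 2)) R)
      = R ^ 2 * volume.real (Metric.ball (0 : EuclideanSpace ℝ (Fin 2)) 1) := by
    rw [Measure.real, Measure.addHaar_ball _ _ hR.le, finrank_euclideanSpace_fin,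
      ENNReal.toReal_mul, ENNReal.toReal_ofReal (by positivity), Measure.real]
  have hpos : 0 < volume.real (Metric.ball (0 : EuclideanSpace ℝ (Fin 2)) 1) :=
    ENNReal.toReal_pos (Metric.measure_ball_pos _ _ one_pos).ne' measure_ball_lt_top.ne
  rw [setAverage_eq, h1, h4, hv]
  simp only [smul_eq_mul, nsmul_eq_mul]
  field_simp
  push_cast
  ring

end Interior

/-! ### The flux and the boundary identities -/

section Coupling

variable {P : Params} {T : ℝ} {ζ q : ℝ → ℝ → ℝ}

theorem hasDerivAt_flux (hP : P.Admissible) {z y : ℝ → ℝ} {W : ℝ → ℝ} {y' : ℝ} (Z : Fin 4 → ℝ)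
    (F : ℝ) {r : ℝ} (hr : P.R < r) (hy : HasDerivAt y y' r)
    (hW : HasDerivAt (R1 P.κ P.R (fluxArg P fun r => (z r, y r)))
      (W r - P.ε * R0 P.κ P.R (radialArg P fun r => (z r, y r)) r
        - P.ε * P.ν * R0 P.κ P.R (viscousArg P fun r => (z r, y r)) r) r) :
    HasDerivAt (flux P (fun r => (z r, y r)) Z F)
      (y', W r - P.ε * R0 P.κ P.R (radialArg P fun r => (z r, y r)) r
        - P.ε * P.ν * R0 P.κ P.R (viscousArg P fun r => (z r, y r)) r
        + accel P Z (Ihyd P fun r => (z r, y r)) F * (P.R / 2) / decayK P.κ P.R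
          * decayK P.κ r) r := by
  have hκ := hP.κ_pos
  have h1 := (((hasDerivAt_besselK_zero_div hκ (hP.R_pos.trans hr)).div_const
    (besselK 1 (P.R / P.κ))).const_mul (P.κ * P.R / 2)).const_mul
    (accel P Z (Ihyd P fun r => (z r, y r)) F)
  refine hy.prodMk ((hW.sub h1).congr_deriv ?_)
  have h2 : besselK 1 (P.R / P.κ) = decayK P.κ P.R := rfl
  rw [h2]
  field_simp
  ring

/-- The trace of `d_r ∂_t q`, expressed through the traces of the unknowns, of `∂_t q` and of
`f_hyd`. -/
theorem trace_dr_qt (hP : P.Admissible) (h : RegularExterior P.R T ζ q) {t : ℝ} (ht : t ∈ Ico 0 T)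
    (hh : ∀ r, P.R ≤ r → 0 < 1 + P.ε * ζ t r) {S W : ℝ → ℝ} {c : ℝ} (hW : IsR0 P.κ P.R S W)
    (hv : ∀ r, P.R < r → dt T (fun s => q s r) t = c / decayK P.κ P.R * decayK P.κ r - W r)
    (hN : NonlocalDefined P fun r => (ζ t r, q t r))
    (hf : ∀ r, P.R < r → fHyd P (fun r => (ζ t r, q t r)) r
      = fluxArg P (fun r => (ζ t r, q t r)) r + P.κ ^ 2 * dr W r) :
    P.κ ^ 2 * RegularExterior.drqt P.R T q t P.R
      = -(2 * P.κ * G P / P.R * c) + (ζ t P.R - P.ν * RegularExterior.drq P.R q t P.R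
        + P.ε * (ζ t P.R ^ 2 / 2 + q t P.R ^ 2 / (1 + P.ε * ζ t P.R)))
        - Ihyd P (fun r => (ζ t r, q t r)) := by
  have hκ := hP.κ_pos
  have hR := hP.R_pos
  have hdr := (eqn_of_eq_decayK_sub hκ hR hW hv).2.2.2
  have hflux : Tendsto (fluxArg P fun r => (ζ t r, q t r)) (𝓝[>] P.R)
      (𝓝 (ζ t P.R - P.ν * RegularExterior.drq P.R q t P.R
        + P.ε * (ζ t P.R ^ 2 / 2 + q t P.R ^ 2 / (1 + P.ε * ζ t P.R)))) := by
    have hζ := h.tendsto_ζ_trace ht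
    have hq := h.tendsto_q_trace ht
    exact (hζ.sub ((h.tendsto_drq_trace hR ht).const_mul _)).add
      ((((hζ.pow 2).div_const 2).add ((hq.pow 2).div ((hζ.const_mul _).const_add 1)
        (hh P.R le_rfl).ne')).const_mul _)
  have hK : Tendsto (fun r => besselK 0 (r / P.κ)) (𝓝[>] P.R) (𝓝 (besselK 0 (P.R / P.κ))) :=
    (hasDerivAt_besselK_zero_div hκ hR).continuousAt.tendsto.mono_left nhdsWithin_le_nhds
  have hlim := ((hK.const_mul (-(c / decayK P.κ P.R * P.κ))).add hflux).sub hN.trace_defined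
  have h1 := tendsto_nhds_unique ((h.tendsto_dr_qt hR ht).const_mul (P.κ ^ 2)) (hlim.congr' ?_)
  · rw [h1, G]
    have h2 : besselK 1 (P.R / P.κ) = decayK P.κ P.R := rfl
    rw [h2]
    have := (decayK_pos hκ hR).ne'
    field_simp
  · filter_upwards [self_mem_nhdsWithin] with r hr
    rw [hdr r hr, hf r hr]
    field_simp
    ring

/-- Newton's equation for a quadratic interior pressure `a r² + b` whose constant `b` is fixed by the
conservation of energy at the contact line. -/
theorem newton_iff_exact {Z Z' : Fin 4 → ℝ} {F b : ℝ} (hδ : 0 < hInt P (Z 0))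
    (he : 0 < 1 + P.ε * Z 2)
    (hb : 1 / (2 * hInt P (Z 0)) * (Z' 1 / 2 - 3 * P.ε * Z 1 ^ 2 / (4 * hInt P (Z 0))) * P.R ^ 2 + b
        + (Z 0 + P.ζeq) + P.ν * Z 1 + P.κ ^ 2 * Z' 1
        + P.ε / 2 * ((-(P.R / 2) * Z 1) ^ 2 / hInt P (Z 0) ^ 2)
      = Z 2 + P.ν * Z 3 + P.κ ^ 2 * Z' 3
        + P.ε / 2 * ((-(P.R / 2) * Z 1) ^ 2 / (1 + P.ε * Z 2) ^ 2)) :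
    P.τ ^ 2 * Z' 1 + P.weight
      = (1 / (2 * hInt P (Z 0)) * (Z' 1 / 2 - 3 * P.ε * Z 1 ^ 2 / (4 * hInt P (Z 0))) * P.R ^ 2 / 2
        + b) + F ↔
    tauSq P (Z 0) * Z' 1 + Z 0 + P.ν * Z 1 - Z 2 - P.ν * Z 3 - P.κ ^ 2 * Z' 3
        = F + P.ε * aCoef P Z * Z 1 ^ 2 := by
  rw [tauSq, aCoef, Params.weight]
  have e1 : 1 / (2 * hInt P (Z 0)) * (Z' 1 / 2 - 3 * P.ε * Z 1 ^ 2 / (4 * hInt P (Z 0))) * P.R ^ 2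
      = 2 * (P.R ^ 2 / (8 * hInt P (Z 0))) * Z' 1
        - 6 * P.ε * Z 1 ^ 2 * (P.R ^ 2 / (16 * hInt P (Z 0) ^ 2)) := by
    field_simp
    ring
  have e2 : (-(P.R / 2) * Z 1) ^ 2 / hInt P (Z 0) ^ 2
      = 4 * Z 1 ^ 2 * (P.R ^ 2 / (16 * hInt P (Z 0) ^ 2)) := by
    field_simp
    ring
  have e3 : (-(P.R / 2) * Z 1) ^ 2 / (1 + P.ε * Z 2) ^ 2
      = 2 * Z 1 ^ 2 * (P.R ^ 2 / (8 * (1 + P.ε * Z 2) ^ 2)) := by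
    field_simp
    ring
  rw [e1, e2, e3] at hb
  rw [e1]
  constructor <;> intro h
  · linear_combination h + hb
  · linear_combination h - hb

end Coupling

/-! ### From the wave-structure problem to the augmented system -/

theorem exists_const_of_hasDerivAt_zero {R : ℝ} {f : ℝ → ℝ}
    (hf : ∀ r, 0 < r → r < R → HasDerivAt f 0 r) : ∃ b, ∀ r, 0 < r → r < R → f r = b := by
  refine ⟨f (R / 2), fun r h0 h1 => isOpen_Ioo.is_const_of_deriv_eq_zero (s := Ioo 0 R)
    isPreconnected_Ioo (fun x hx => (hf x hx.1 hx.2).differentiableAt.differentiableWithinAt)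
    (fun x hx => (hf x hx.1 hx.2).deriv) ⟨h0, h1⟩ ⟨by linarith, by linarith⟩⟩

namespace SolvesWaveStructure

variable {P : Params} {T : ℝ} {F : ℝ → ℝ} {ζ₀ q₀ : ℝ → ℝ} {δ₀ δ₁ : ℝ} {ζ q p : ℝ → ℝ → ℝ}
  {δ : ℝ → ℝ} (hs : SolvesWaveStructure P T F ζ₀ q₀ δ₀ δ₁ ζ q p δ)
include hs

theorem dt_ζ_interior {t r : ℝ} (ht : t ∈ Ico 0 T) (h0 : 0 < r) (hr : r < P.R) :
    dt T (fun s => ζ s r) t = dt T δ t := by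
  rw [dt_congr ht fun s hs' => hs.interior_constraint s hs' r h0 hr]
  exact HasDerivWithinAt.dt_eq ht ((hasDerivWithinAt_dt (hs.diff_δ t ht)).add_const _)

theorem q_interior (hP : P.Admissible) {t r : ℝ} (ht : t ∈ Ico 0 T) (h0 : 0 < r) (hr : r < P.R) :
    q t r = -(r / 2) * dt T δ t := by
  have hR := hP.R_pos
  -- `r q + r² δ' / 2` is constant in the interior, and vanishes at the centre
  obtain ⟨b, hb⟩ := exists_const_of_hasDerivAt_zero (R := P.R)
    (f := fun r => r * q t r + dt T δ t * r ^ 2 / 2) fun r h0 hr => by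
      have hbar := hs.bar t ht r h0 hr.ne
      have hm := hbar.mass
      rw [hs.dt_ζ_interior ht h0 hr] at hm
      refine (((hasDerivAt_id r).mul (hasDerivAt_of_dr hbar.diff_q)).add
        (((hasDerivAt_pow 2 r).const_mul (dt T δ t)).div_const 2)).congr_deriv ?_
      have : dr (q t) r = -dt T δ t := by linarith
      rw [this]
      simp only [id]
      field_simp
      push_cast
      ring
  have hid : Tendsto (fun r : ℝ => r) (𝓝[>] 0) (𝓝 0) := tendsto_id.mono_left nhdsWithin_le_nhds
  have hlim : Tendsto (fun r => r * q t r + dt T δ t * r ^ 2 / 2) (𝓝[>] 0) (𝓝 0) := by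
    simpa using (hid.mul (hs.centre t ht)).add (((hid.pow 2).const_mul (dt T δ t)).div_const 2)
  have hb0 : b = 0 := by
    refine tendsto_nhds_unique (tendsto_const_nhds.congr' ?_) hlim
    filter_upwards [Ioo_mem_nhdsGT hR] with ρ hρ using (hb ρ hρ.1 hρ.2).symm
  have h1 := hb r h0 hr
  rw [hb0] at h1
  have h2 : r * (q t r - -(r / 2) * dt T δ t) = 0 := by linear_combination h1
  have h3 := (mul_eq_zero.1 h2).resolve_left h0.ne'
  linarith

theorem q_boundary (hP : P.Admissible) (h : RegularExterior P.R T ζ q) {t : ℝ} (ht : t ∈ Ico 0 T) :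
    q t P.R = -(P.R / 2) * dt T δ t := by
  obtain ⟨a, h1, h2⟩ := hs.volume_cons t ht
  have h3 : Tendsto (fun r : ℝ => -(r / 2) * dt T δ t) (𝓝[<] P.R) (𝓝 (-(P.R / 2) * dt T δ t)) :=
    ((by fun_prop : Continuous fun r : ℝ => -(r / 2) * dt T δ t).tendsto P.R).mono_left
      nhdsWithin_le_nhds
  rw [tendsto_nhds_unique (h.tendsto_q_trace ht) h1]
  refine tendsto_nhds_unique h2 (h3.congr' ?_)
  filter_upwards [Ioo_mem_nhdsLT hP.R_pos] with r hr using (hs.q_interior hP ht hr.1 hr.2).symm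

theorem dt_q_interior (hP : P.Admissible) {t r : ℝ} (ht : t ∈ Ico 0 T) (h0 : 0 < r)
    (hr : r < P.R) : dt T (fun s => q s r) t = -(r / 2) * dt T (dt T δ) t := by
  rw [dt_congr ht fun s hs' => hs.q_interior hP hs' h0 hr]
  exact HasDerivWithinAt.dt_eq ht ((hasDerivWithinAt_dt (hs.diff_dδ t ht)).const_mul _)

theorem dt_q_boundary (hP : P.Admissible) (h : RegularExterior P.R T ζ q) {t : ℝ}
    (ht : t ∈ Ico 0 T) : dt T (fun s => q s P.R) t = -(P.R / 2) * dt T (dt T δ) t := by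
  rw [dt_congr ht fun s hs' => hs.q_boundary hP h hs']
  exact HasDerivWithinAt.dt_eq ht ((hasDerivWithinAt_dt (hs.diff_dδ t ht)).const_mul _)

theorem hInt_eq {t r : ℝ} (ht : t ∈ Ico 0 T) (h0 : 0 < r) (hr : r < P.R) :
    1 + P.ε * ζ t r = hInt P (δ t) := by
  rw [hs.interior_constraint t ht r h0 hr, hInt, Params.hEq]
  ring

theorem hInt_pos (hP : P.Admissible) {t : ℝ} (ht : t ∈ Ico 0 T) : 0 < hInt P (δ t) := by
  have hR := hP.R_pos
  rw [← hs.hInt_eq ht (half_pos hR) (half_lt_self hR)]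
  exact hs.height_pos t ht _ (half_pos hR)

theorem pressure_interior (hP : P.Admissible) {t : ℝ} (ht : t ∈ Ico 0 T) :
    ∃ b, ∀ r, 0 < r → r < P.R → p t r = 1 / (2 * hInt P (δ t)) *
      (dt T (dt T δ) t / 2 - 3 * P.ε * dt T δ t ^ 2 / (4 * hInt P (δ t))) * r ^ 2 + b := by
  obtain ⟨a, ha⟩ : ∃ a, a = 1 / (2 * hInt P (δ t)) *
    (dt T (dt T δ) t / 2 - 3 * P.ε * dt T δ t ^ 2 / (4 * hInt P (δ t))) := ⟨_, rfl⟩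
  rw [← ha]
  obtain ⟨b, hb⟩ := exists_const_of_hasDerivAt_zero (R := P.R)
    (f := fun r => p t r - a * r ^ 2) fun r h0 hr => by
      have hbar := hs.bar t ht r h0 hr.ne
      have hev : ∀ᶠ ρ in 𝓝 r, 0 < ρ ∧ ρ < P.R := Ioo_mem_nhds h0 hr
      have hpos := hs.hInt_pos hP ht
      have hI : 1 + P.ε * (δ t + P.ζeq) = hInt P (δ t) := by rw [hInt, Params.hEq]; ring
      have hp' := (interior_momentum_iff (b := δ t + P.ζeq) (c := dt T δ t)
        (c' := dt T (dt T δ) t) h0 (by rw [hI]; exact hpos)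
        (hev.mono fun ρ hρ => hs.interior_constraint t ht ρ hρ.1 hρ.2)
        (hev.mono fun ρ hρ => hs.q_interior hP ht hρ.1 hρ.2)
        (hev.mono fun ρ hρ => hs.dt_q_interior hP ht hρ.1 hρ.2)).1 hbar.momentum
      refine (hbar.diff_p.hasDerivAt.sub ((hasDerivAt_pow 2 r).const_mul a)).congr_deriv ?_
      rw [hp', hI, ha]
      field_simp
      push_cast
      ring
  exact ⟨b, fun r h0 hr => by linarith [hb r h0 hr]⟩

theorem dt_ζ_boundary (hP : P.Admissible) (h : RegularExterior P.R T ζ q) {t : ℝ}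
    (ht : t ∈ Ico 0 T) :
    dt T (fun s => ζ s P.R) t = -RegularExterior.drq P.R q t P.R :=
  h.dt_ζ_boundary hP.R_pos ht fun r hr => (hs.bar t ht r (hP.R_pos.trans hr) hr.ne').mass

theorem bdryUnknown_eq (hP : P.Admissible) (h : RegularExterior P.R T ζ q) {t : ℝ}
    (ht : t ∈ Ico 0 T) :
    bdryUnknown P T ζ δ t = ![δ t, dt T δ t, ζ t P.R, -RegularExterior.drq P.R q t P.R] := by
  rw [bdryUnknown, trace, trace, (h.tendsto_ζ_trace ht).limUnder_eq,
    (h.tendsto_ζt_trace ht).limUnder_eq, hs.dt_ζ_boundary hP h ht]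

theorem hasDerivWithinAt_bdryUnknown (hP : P.Admissible) (h : RegularExterior P.R T ζ q) {t : ℝ}
    (ht : t ∈ Ico 0 T) :
    HasDerivWithinAt (bdryUnknown P T ζ δ)
      ![dt T δ t, dt T (dt T δ) t, -RegularExterior.drq P.R q t P.R,
        -RegularExterior.drqt P.R T q t P.R] (Ico 0 T) t := by
  have h1 : HasDerivWithinAt
      (fun s => ![δ s, dt T δ s, ζ s P.R, -RegularExterior.drq P.R q s P.R])
      ![dt T δ t, dt T (dt T δ) t, -RegularExterior.drq P.R q t P.R,
        -RegularExterior.drqt P.R T q t P.R] (Ico 0 T) t := by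
    refine hasDerivWithinAt_pi.2 fun i => ?_
    fin_cases i
    · exact hasDerivWithinAt_dt (hs.diff_δ t ht)
    · exact hasDerivWithinAt_dt (hs.diff_dδ t ht)
    · rw [← hs.dt_ζ_boundary hP h ht]
      exact RegularExterior.hasDerivWithinAt_time h.smooth_ζ ht le_rfl
    · exact (h.hasDerivWithinAt_drq ht le_rfl).neg
  exact h1.congr (fun s hs' => hs.bdryUnknown_eq hP h hs') (hs.bdryUnknown_eq hP h ht)

/-- The conservation of energy at the contact line fixes the constant in the interior pressure. -/
theorem energy_balance (hP : P.Admissible) (h : RegularExterior P.R T ζ q) {t a b : ℝ}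
    (ht : t ∈ Ico 0 T) (hb : ∀ r, 0 < r → r < P.R → p t r = a * r ^ 2 + b) :
    a * P.R ^ 2 + b + (δ t + P.ζeq) + P.ν * dt T δ t + P.κ ^ 2 * dt T (dt T δ) t
        + P.ε / 2 * ((-(P.R / 2) * dt T δ t) ^ 2 / hInt P (δ t) ^ 2)
      = ζ t P.R + P.ν * -RegularExterior.drq P.R q t P.R
        + P.κ ^ 2 * -RegularExterior.drqt P.R T q t P.R
        + P.ε / 2 * ((-(P.R / 2) * dt T δ t) ^ 2 / (1 + P.ε * ζ t P.R) ^ 2) := by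
  have hR := hP.R_pos
  obtain ⟨E, hE1, hE2⟩ := hs.energy_cons t ht
  have hleft : Tendsto (fun r : ℝ => a * r ^ 2 + b + (δ t + P.ζeq) + P.ν * dt T δ t
      + P.κ ^ 2 * dt T (dt T δ) t + P.ε / 2 * ((-(r / 2) * dt T δ t) ^ 2 / hInt P (δ t) ^ 2))
      (𝓝[<] P.R) (𝓝 (a * P.R ^ 2 + b + (δ t + P.ζeq) + P.ν * dt T δ t
      + P.κ ^ 2 * dt T (dt T δ) t
      + P.ε / 2 * ((-(P.R / 2) * dt T δ t) ^ 2 / hInt P (δ t) ^ 2))) :=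
    (Continuous.tendsto (by fun_prop) P.R).mono_left nhdsWithin_le_nhds
  have hl := tendsto_nhds_unique hE2 (hleft.congr' ?_)
  · have hζ := h.tendsto_ζ_trace ht
    have hdrq := tendsto_trace (h.continuousOn_drq hR ht)
    have hdrqt := tendsto_trace (h.continuousOn_drqt hR ht)
    have hpos : (1 + P.ε * ζ t P.R) ^ 2 ≠ 0 := (pow_pos (hs.height_pos t ht P.R hR) 2).ne'
    have hright := ((hζ.add (hdrq.neg.const_mul P.ν)).add (hdrqt.neg.const_mul (P.κ ^ 2))).add
      ((((h.tendsto_q_trace ht).pow 2).div (((hζ.const_mul P.ε).const_add 1).pow 2)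
        hpos).const_mul (P.ε / 2))
    rw [hs.q_boundary hP h ht] at hright
    rw [← hl]
    refine tendsto_nhds_unique hE1 (hright.congr' ?_)
    filter_upwards [self_mem_nhdsWithin] with r hr
    have hmass : ∀ s ∈ Ico 0 T, dt T (fun s => ζ s r) s = -RegularExterior.drq P.R q s r :=
      fun s hs' => by
        have := (hs.bar s hs' r (hR.trans hr) (ne_of_gt hr)).mass
        rw [h.dr_eq_drq hs' hr] at this
        linarith
    have h2 : dt T (dt T fun s => ζ s r) t = -RegularExterior.drqt P.R T q t r := by
      rw [dt_congr ht hmass]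
      exact HasDerivWithinAt.dt_eq ht (h.hasDerivWithinAt_drq ht (le_of_lt hr)).neg
    rw [hs.exterior_pressure t ht r hr, hmass t ht, h2, zero_add]
    rfl
  · filter_upwards [Ioo_mem_nhdsLT hR] with r hr
    have h2 : dt T (dt T fun s => ζ s r) t = dt T (dt T δ) t :=
      dt_congr ht fun s hs' => hs.dt_ζ_interior hs' hr.1 hr.2
    rw [hb r hr.1 hr.2, hs.dt_ζ_interior ht hr.1 hr.2, h2, hs.q_interior hP ht hr.1 hr.2,
      hs.hInt_eq ht hr.1 hr.2, hs.interior_constraint t ht r hr.1 hr.2]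

theorem exterior_height (hP : P.Admissible) {t : ℝ} (ht : t ∈ Ico 0 T) :
    ∀ r, P.R ≤ r → 0 < 1 + P.ε * ζ t r :=
  fun r hr => hs.height_pos t ht r (hP.R_pos.trans_le hr)

/-- Solution formula for `∂_t q` in the exterior. -/
theorem dt_q_exterior (hP : P.Admissible) (h : RegularExterior P.R T ζ q) {t : ℝ}
    (ht : t ∈ Ico 0 T) {W : ℝ → ℝ}
    (hW : IsR0 P.κ P.R (fun r => P.ε * dr (fun ρ => q t ρ ^ 2 / (1 + P.ε * ζ t ρ)) r
      + (1 + P.ε * ζ t r) * deriv (ζ t) r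
      - P.ν * (1 + P.ε * ζ t r) * deriv (fun ρ => dr (q t) ρ / (1 + P.ε * ζ t ρ)) r) W) {r : ℝ}
    (hr : P.R < r) :
    dt T (fun s => q s r) t
      = -(P.R / 2) * dt T (dt T δ) t / decayK P.κ P.R * decayK P.κ r - W r := by
  have hR := hP.R_pos
  refine eq_decayK_sub_of_eqn (v := fun ρ => dt T (fun s => q s ρ) t) hP.κ_pos hR
    (fun r hr => (h.hasDerivAt_qt ht hr).differentiableAt)
    (fun r hr => (hs.bar t ht r (hR.trans hr) hr.ne').diff_dqt) (fun r hr => ?_)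
    (hs.dt_q_boundary hP h ht ▸ h.tendsto_qt_trace ht) (h.tendsto_qt_atTop hR ht) hW hr
  have hm := (hs.bar t ht r (hR.trans hr) hr.ne').momentum
  have hp : deriv (p t) r = 0 := by
    have : p t =ᶠ[𝓝 r] fun _ => 0 :=
      (eventually_gt_of_lt hr).mono fun ρ hρ => hs.exterior_pressure t ht ρ hρ
    rw [this.deriv_eq]
    simp
  rw [hp] at hm
  linarith

/-- The boundary equation, and the identification of the acceleration. -/
theorem boundary_equation (hP : P.Admissible) (h : RegularExterior P.R T ζ q) {t : ℝ}
    (ht : t ∈ Ico 0 T) :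
    dt T (bdryUnknown P T ζ δ) t
        + Dtilde P (bdryUnknown P T ζ δ t) (Ihyd P fun r => (ζ t r, q t r)) (F t) = 0 ∧
      accel P (bdryUnknown P T ζ δ t) (Ihyd P fun r => (ζ t r, q t r)) (F t)
        = dt T (dt T δ) t := by
  have hR := hP.R_pos
  have hh := hs.exterior_height hP ht
  obtain ⟨hN, W, hW, -, hf⟩ := (h.regularSlice hR ht hh).exists_nonlocal hP
  have htr := trace_dr_qt hP h ht hh hW (fun r hr => hs.dt_q_exterior hP h ht hW hr) hN hf
  rw [HasDerivWithinAt.dt_eq ht (hs.hasDerivWithinAt_bdryUnknown hP h ht)]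
  obtain ⟨Z, hZ⟩ : ∃ Z, Z = bdryUnknown P T ζ δ t := ⟨_, rfl⟩
  obtain ⟨Z', hZ'⟩ : ∃ Z' : Fin 4 → ℝ, Z' = ![dt T δ t, dt T (dt T δ) t,
    -RegularExterior.drq P.R q t P.R, -RegularExterior.drqt P.R T q t P.R] := ⟨_, rfl⟩
  rw [← hZ, ← hZ']
  rw [hs.bdryUnknown_eq hP h ht] at hZ
  have z0 : Z 0 = δ t := by rw [hZ]; rfl
  have z1 : Z 1 = dt T δ t := by rw [hZ]; rfl
  have z2 : Z 2 = ζ t P.R := by rw [hZ]; rfl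
  have z3 : Z 3 = -RegularExterior.drq P.R q t P.R := by rw [hZ]; rfl
  have z0' : Z' 0 = dt T δ t := by rw [hZ']; rfl
  have z1' : Z' 1 = dt T (dt T δ) t := by rw [hZ']; rfl
  have z2' : Z' 2 = -RegularExterior.drq P.R q t P.R := by rw [hZ']; rfl
  have z3' : Z' 3 = -RegularExterior.drqt P.R T q t P.R := by rw [hZ']; rfl
  have row3 : P.κ * G P * Z' 1 + P.ν * Z' 2 + P.κ ^ 2 * Z' 3
      + (Z 2 - Ihyd P (fun r => (ζ t r, q t r)) + P.ε * fBdry P Z) = 0 := by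
    rw [fBdry, z1, z2, z1', z2', z3']
    rw [hs.q_boundary hP h ht] at htr
    have e : 2 * P.κ * G P / P.R * (-(P.R / 2) * dt T (dt T δ) t)
        = -(P.κ * G P * dt T (dt T δ) t) := by
      field_simp
    rw [e] at htr
    linear_combination -htr
  have hδ : 0 < hInt P (Z 0) := by rw [z0]; exact hs.hInt_pos hP ht
  obtain ⟨b, hb⟩ := hs.pressure_interior hP ht
  have hen := hs.energy_balance hP h ht hb
  have hnewt := hs.newton t ht
  rw [average_ball_quadratic hR hb] at hnewt
  rw [← z0, ← z1, ← z1', ← z2, ← z3, ← z3'] at hen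
  rw [← z0, ← z1, ← z1'] at hnewt
  have hexact := (newton_iff_exact hδ (by rw [z2]; exact hh _ le_rfl) hen).1 hnewt
  obtain ⟨hrow, hacc⟩ := newton_iff_row hP (F := F t) hδ (z0'.trans z1.symm)
    (z2'.trans z3.symm) row3
  exact ⟨(ode_iff hP Z Z' _ _).2 ⟨z0'.trans z1.symm, hrow.2 hexact, z2'.trans z3.symm, row3⟩,
    (hacc hexact).trans z1'⟩

theorem nonlocalDefined (hP : P.Admissible) (h : RegularExterior P.R T ζ q) {t : ℝ}
    (ht : t ∈ Ico 0 T) : NonlocalDefined P fun r => (ζ t r, q t r) :=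
  ((h.regularSlice hP.R_pos ht (hs.exterior_height hP ht)).exists_nonlocal hP).1

theorem solvesAugmented (hP : P.Admissible) (hT : 0 < T) (h : RegularExterior P.R T ζ q) :
    SolvesAugmented P T F ζ₀ q₀ δ₀ δ₁ (fun t r => (ζ t r, q t r)) (bdryUnknown P T ζ δ) := by
  have hR := hP.R_pos
  have h0T : (0 : ℝ) ∈ Ico 0 T := ⟨le_rfl, hT⟩
  have hflux : ∀ t ∈ Ico 0 T, ∀ r, P.R < r → HasDerivAt
      (flux P (fun r => (ζ t r, q t r)) (bdryUnknown P T ζ δ t) (F t))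
      (-dt T (fun s => ζ s r) t - q t r / r, -dt T (fun s => q s r) t
        - P.ε * R0 P.κ P.R (radialArg P fun r => (ζ t r, q t r)) r
        - P.ε * P.ν * R0 P.κ P.R (viscousArg P fun r => (ζ t r, q t r)) r) r := by
    intro t ht r hr
    obtain ⟨-, W, hW, hR1, -⟩ :=
      (h.regularSlice hR ht (hs.exterior_height hP ht)).exists_nonlocal hP
    have hbar := hs.bar t ht r (hR.trans hr) hr.ne'
    refine (hasDerivAt_flux hP (bdryUnknown P T ζ δ t) (F t) hr (hasDerivAt_of_dr hbar.diff_q)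
      (hR1 r hr)).congr_deriv ?_
    rw [(hs.boundary_equation hP h ht).2, hs.dt_q_exterior hP h ht hW hr]
    have := hbar.mass
    ext
    · simp only
      linarith
    · simp only
      ring
  refine
    { height_ext := fun t ht => hs.exterior_height hP ht
      height_int := fun t ht => ?_
      diff_t := fun t ht r hr => ?_
      diff_flux := fun t ht r hr => (hflux t ht r hr).differentiableAt
      pde := fun t ht r hr => ?_
      diff_Z := fun t ht => (hs.hasDerivWithinAt_bdryUnknown hP h ht).differentiableWithinAt
      ode := fun t ht => (hs.boundary_equation hP h ht).1
      bdry_ζ := fun t ht => ?_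
      bdry_q := fun t ht => ?_
      init_u := fun r hr => by rw [hs.init_ζ r hr, hs.init_q r hr]
      init_Z := ?_ }
  · rw [hs.bdryUnknown_eq hP h ht]
    exact hs.hInt_pos hP ht
  · have hbar := hs.bar t ht r (hR.trans hr) hr.ne'
    exact hbar.diff_ζt.prodMk hbar.diff_qt
  · have hbar := hs.bar t ht r (hR.trans hr) hr.ne'
    rw [(hflux t ht r hr).deriv, HasDerivWithinAt.dt_eq ht
      ((hasDerivWithinAt_dt hbar.diff_ζt).prodMk (hasDerivWithinAt_dt hbar.diff_qt)), Sr, Snu]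
    ext
    · simp
      ring
    · simp
      ring
  · rw [hs.bdryUnknown_eq hP h ht]
    exact h.tendsto_ζ_trace ht
  · rw [hs.bdryUnknown_eq hP h ht]
    have := h.tendsto_q_trace ht
    rwa [hs.q_boundary hP h ht] at this
  · have h1 : trace P.R ζ₀ = ζ 0 P.R := by
      refine ((h.tendsto_ζ_trace h0T).congr' ?_).limUnder_eq
      filter_upwards [self_mem_nhdsWithin] with r hr using hs.init_ζ r hr
    have h2 : trace P.R (dr q₀) = RegularExterior.drq P.R q 0 P.R := by
      refine ((h.tendsto_drq_trace hR h0T).congr' ?_).limUnder_eq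
      filter_upwards [self_mem_nhdsWithin] with r hr using dr_congr hs.init_q hr
    rw [hs.bdryUnknown_eq hP h h0T, h1, h2, hs.init_δ, hs.init_dδ]

end SolvesWaveStructure

/-! ### From the augmented system to the wave-structure problem -/

theorem SolvesBArAt.congr {P : Params} {T : ℝ} {ζ q p ζ' q' p' : ℝ → ℝ → ℝ} {t r : ℝ}
    (h : SolvesBArAt P T ζ q p t r)
    (he : ∀ᶠ ρ in 𝓝 r, ∀ s, ζ' s ρ = ζ s ρ ∧ q' s ρ = q s ρ ∧ p' s ρ = p s ρ) :
    SolvesBArAt P T ζ' q' p' t r := by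
  have hζ : ζ' t =ᶠ[𝓝 r] ζ t := he.mono fun ρ h => (h t).1
  have hq : q' t =ᶠ[𝓝 r] q t := he.mono fun ρ h => (h t).2.1
  have hp : p' t =ᶠ[𝓝 r] p t := he.mono fun ρ h => (h t).2.2
  have hζt : (fun s => ζ' s r) = fun s => ζ s r := funext fun s => (he.self_of_nhds s).1
  have hqt : (fun s => q' s r) = fun s => q s r := funext fun s => (he.self_of_nhds s).2.1
  have hqtr : (fun ρ => dt T (fun s => q' s ρ) t) =ᶠ[𝓝 r] fun ρ => dt T (fun s => q s ρ) t := by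
    filter_upwards [he] with ρ hρ
    rw [funext fun s => (hρ s).2.1]
  have hdq := dr_congr_nhds hq
  have hdqt := dr_congr_nhds hqtr
  have h1 : (fun ρ => q' t ρ ^ 2 / (1 + P.ε * ζ' t ρ)) =ᶠ[𝓝 r]
      fun ρ => q t ρ ^ 2 / (1 + P.ε * ζ t ρ) := by
    filter_upwards [hζ, hq] with ρ h1 h2
    rw [h1, h2]
  have h2 : (fun ρ => dr (q' t) ρ / (1 + P.ε * ζ' t ρ)) =ᶠ[𝓝 r]
      fun ρ => dr (q t) ρ / (1 + P.ε * ζ t ρ) := by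
    filter_upwards [hζ, hdq] with ρ h1 h2
    rw [h1, h2]
  refine
    { diff_ζt := hζt ▸ h.diff_ζt
      diff_ζ := hζ.differentiableAt_iff.2 h.diff_ζ
      diff_qt := hqt ▸ h.diff_qt
      diff_q := hq.differentiableAt_iff.2 h.diff_q
      diff_dq := hdq.differentiableAt_iff.2 h.diff_dq
      diff_qtr := hqtr.differentiableAt_iff.2 h.diff_qtr
      diff_dqt := hdqt.differentiableAt_iff.2 h.diff_dqt
      diff_p := hp.differentiableAt_iff.2 h.diff_p
      mass := ?_
      momentum := ?_ }
  · rw [hζt, hdq.eq_of_nhds]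
    exact h.mass
  · rw [hqt, hdqt.deriv_eq, (dr_congr_nhds h1).eq_of_nhds, h2.deriv_eq, hζ.deriv_eq, hp.deriv_eq,
      hζ.eq_of_nhds]
    exact h.momentum

section Glue

variable {R : ℝ} {fi fe : ℝ → ℝ → ℝ} {t r : ℝ}

theorem glue_of_lt (hr : r < R) : glue R fi fe t r = fi t r := if_pos hr

theorem glue_of_le (hr : R ≤ r) : glue R fi fe t r = fe t r := if_neg hr.not_gt

end Glue

theorem one_add_mul_zetaInt (P : Params) (Z : ℝ → Fin 4 → ℝ) (t : ℝ) :
    1 + P.ε * zetaInt P Z t = hInt P (Z t 0) := by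
  rw [hInt, zetaInt, Params.hEq]
  ring

namespace SolvesAugmented

variable {P : Params} {T : ℝ} {F : ℝ → ℝ} {ζ₀ q₀ : ℝ → ℝ} {δ₀ δ₁ : ℝ} {u : ℝ → ℝ → ℝ × ℝ}
  {Z : ℝ → Fin 4 → ℝ} (hs : SolvesAugmented P T F ζ₀ q₀ δ₀ δ₁ u Z)
include hs

theorem hasDerivWithinAt_Z {t : ℝ} (ht : t ∈ Ico 0 T) (i : Fin 4) :
    HasDerivWithinAt (fun s => Z s i) (dt T Z t i) (Ico 0 T) t :=
  hasDerivWithinAt_pi.1 (hs.diff_Z t ht).hasDerivWithinAt i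

theorem dt_Z {t : ℝ} (ht : t ∈ Ico 0 T) (i : Fin 4) : dt T (fun s => Z s i) t = dt T Z t i :=
  HasDerivWithinAt.dt_eq ht (hs.hasDerivWithinAt_Z ht i)

/-- The boundary equation in rows, the second row being replaced by Newton's equation with the
pressure eliminated; the acceleration is `accel`. -/
theorem rows (hP : P.Admissible) {t : ℝ} (ht : t ∈ Ico 0 T) :
    dt T Z t 0 = Z t 1 ∧ dt T Z t 2 = Z t 3 ∧
      tauSq P (Z t 0) * dt T Z t 1 + Z t 0 + P.ν * Z t 1 - Z t 2 - P.ν * Z t 3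
        - P.κ ^ 2 * dt T Z t 3 = F t + P.ε * aCoef P (Z t) * Z t 1 ^ 2 ∧
      accel P (Z t) (Ihyd P (u t)) (F t) = dt T Z t 1 := by
  obtain ⟨h0, h1, h2, h3⟩ := (ode_iff hP _ _ _ _).1 (hs.ode t ht)
  obtain ⟨hrow, hacc⟩ := newton_iff_row hP (hs.height_int t ht) h0 h2 h3
  exact ⟨h0, h2, hrow.1 h1, hacc (hrow.1 h1)⟩

theorem hasDerivWithinAt_zetaInt (hP : P.Admissible) {t : ℝ} (ht : t ∈ Ico 0 T) :
    HasDerivWithinAt (zetaInt P Z) (Z t 1) (Ico 0 T) t := by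
  rw [← (hs.rows hP ht).1]
  exact (hs.hasDerivWithinAt_Z ht 0).add_const _

theorem dt_dt_zetaInt (hP : P.Admissible) {t : ℝ} (ht : t ∈ Ico 0 T) :
    dt T (dt T (zetaInt P Z)) t = dt T Z t 1 := by
  rw [dt_congr ht fun s hs' => HasDerivWithinAt.dt_eq hs' (hs.hasDerivWithinAt_zetaInt hP hs'),
    hs.dt_Z ht]

/-- The interior pressure is quadratic in the radius, and its boundary value is fixed by the
conservation of energy. -/
theorem pInt_eq (hP : P.Admissible) {t : ℝ} (ht : t ∈ Ico 0 T) (r : ℝ) :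
    pInt P T u Z t r = 1 / (2 * hInt P (Z t 0)) *
        (dt T Z t 1 / 2 - 3 * P.ε * Z t 1 ^ 2 / (4 * hInt P (Z t 0))) * r ^ 2
      + (Z t 2 + P.ν * Z t 3 + P.κ ^ 2 * dt T Z t 3
        + P.ε / 2 * ((-(P.R / 2) * Z t 1) ^ 2 / (1 + P.ε * Z t 2) ^ 2)
        - (1 / (2 * hInt P (Z t 0)) *
            (dt T Z t 1 / 2 - 3 * P.ε * Z t 1 ^ 2 / (4 * hInt P (Z t 0))) * P.R ^ 2
          + (Z t 0 + P.ζeq) + P.ν * Z t 1 + P.κ ^ 2 * dt T Z t 1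
          + P.ε / 2 * ((-(P.R / 2) * Z t 1) ^ 2 / hInt P (Z t 0) ^ 2))) := by
  have h1 : trace P.R (fun ρ => (u t ρ).2) = -(P.R / 2) * Z t 1 := (hs.bdry_q t ht).limUnder_eq
  have h2 : trace P.R (fun ρ => (u t ρ).1) = Z t 2 := (hs.bdry_ζ t ht).limUnder_eq
  rw [pInt, h1, h2, one_add_mul_zetaInt, hs.dt_Z ht, hs.dt_Z ht, hs.dt_dt_zetaInt hP ht,
    HasDerivWithinAt.dt_eq ht (hs.hasDerivWithinAt_zetaInt hP ht), qInt, zetaInt]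
  ring

theorem dt_qInt {t : ℝ} (ht : t ∈ Ico 0 T) (r : ℝ) :
    dt T (fun s => qInt Z s r) t = -(r / 2) * dt T Z t 1 :=
  HasDerivWithinAt.dt_eq ht ((hs.hasDerivWithinAt_Z ht 1).const_mul _)

/-- The radial Boussinesq-Abbott system in the interior. -/
theorem solvesBArAt_interior (hP : P.Admissible) {t r : ℝ} (ht : t ∈ Ico 0 T) (hr : 0 < r) :
    SolvesBArAt P T (fun t _ => zetaInt P Z t) (qInt Z) (pInt P T u Z) t r := by
  have hq : qInt Z t =ᶠ[𝓝 r] fun ρ => -(ρ / 2) * Z t 1 := Eventually.of_forall fun _ => rfl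
  have hqt : (fun ρ => dt T (fun s => qInt Z s ρ) t) =ᶠ[𝓝 r] fun ρ => -(ρ / 2) * dt T Z t 1 :=
    Eventually.of_forall fun ρ => hs.dt_qInt ht ρ
  have hp : HasDerivAt (pInt P T u Z t) (r / hInt P (Z t 0) *
      (dt T Z t 1 / 2 - 3 * P.ε * Z t 1 ^ 2 / (4 * hInt P (Z t 0)))) r := by
    rw [funext fun r => hs.pInt_eq hP ht r]
    refine (((hasDerivAt_pow 2 r).const_mul _).add_const _).congr_deriv ?_
    push_cast
    have := (hs.height_int t ht).ne'
    field_simp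
  refine
    { diff_ζt := (hs.hasDerivWithinAt_zetaInt hP ht).differentiableWithinAt
      diff_ζ := differentiableAt_const _
      diff_qt := ((hs.hasDerivWithinAt_Z ht 1).const_mul (-(r / 2))).differentiableWithinAt
      diff_q := hq.differentiableAt_iff.2 (hasDerivAt_linear _ r).differentiableAt
      diff_dq := (dr_linear_eventually hr hq).differentiableAt_iff.2 (differentiableAt_const _)
      diff_qtr := hqt.differentiableAt_iff.2 (hasDerivAt_linear _ r).differentiableAt
      diff_dqt := (dr_linear_eventually hr hqt).differentiableAt_iff.2 (differentiableAt_const _)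
      diff_p := hp.differentiableAt
      mass := ?_
      momentum := ?_ }
  · rw [(dr_linear_eventually hr hq).eq_of_nhds]
    have := HasDerivWithinAt.dt_eq ht (hs.hasDerivWithinAt_zetaInt hP ht)
    change dt T (zetaInt P Z) t + -Z t 1 = 0
    linarith
  · refine (interior_momentum_iff (z := fun _ => zetaInt P Z t) hr ?_
      (Eventually.of_forall fun _ => rfl) hq hqt).2 ?_
    · rw [one_add_mul_zetaInt]
      exact hs.height_int t ht
    · rw [hp.deriv, one_add_mul_zetaInt]

section

variable (h : RegularExterior P.R T (fun t r => (u t r).1) (fun t r => (u t r).2))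
include h

theorem boundary_ζ {t : ℝ} (ht : t ∈ Ico 0 T) : (u t P.R).1 = Z t 2 :=
  tendsto_nhds_unique (h.tendsto_ζ_trace ht) (hs.bdry_ζ t ht)

/-- The radial Boussinesq-Abbott system in the exterior. -/
theorem solvesBArAt_exterior (hP : P.Admissible) {t r : ℝ} (ht : t ∈ Ico 0 T) (hr : P.R < r) :
    SolvesBArAt P T (fun t r => (u t r).1) (fun t r => (u t r).2) (fun _ _ => 0) t r := by
  have hR := hP.R_pos
  have hκ := hP.κ_pos
  have hS := h.regularSlice hR ht (hs.height_ext t ht)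
  obtain ⟨-, W, hW, hR1, -⟩ := hS.exists_nonlocal hP
  -- the conservation law, componentwise
  have hpde : ∀ r, P.R < r → dt T (fun s => (u s r).1) t + dr (fun r => (u t r).2) r = 0 ∧
      dt T (fun s => (u s r).2) t
        = -(P.R / 2) * accel P (Z t) (Ihyd P (u t)) (F t) / decayK P.κ P.R * decayK P.κ r
          - W r := fun r hr => by
    have hq := (hasDerivAt_of_slice (f := fun t r => (u t r).2) h.smooth_q ht hr).differentiableAt
    have hfl : HasDerivAt (flux P (u t) (Z t) (F t)) _ r :=
      hasDerivAt_flux hP (z := fun r => (u t r).1) (y := fun r => (u t r).2) (Z t) (F t) hr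
        (hasDerivAt_of_dr hq) (hR1 r hr)
    have hd := hs.diff_t t ht r hr
    have hdt : dt T (fun s => u s r) t
        = (dt T (fun s => (u s r).1) t, dt T (fun s => (u s r).2) t) :=
      HasDerivWithinAt.dt_eq ht (hd.fst.hasDerivWithinAt.prodMk hd.snd.hasDerivWithinAt)
    have hp := hs.pde t ht r hr
    rw [hfl.deriv, hdt, Sr, Snu] at hp
    have e1 := congrArg Prod.fst hp
    have e2 := congrArg Prod.snd hp
    simp only [Prod.fst_add, Prod.snd_add, Prod.smul_mk, smul_eq_mul, mul_zero, add_zero]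
      at e1 e2
    constructor
    · linarith
    · linear_combination e2
  obtain ⟨hv, hv', heq, -⟩ := eqn_of_eq_decayK_sub (v := fun ρ => dt T (fun s => (u s ρ).2) t)
    hκ hR hW fun r hr => (hpde r hr).2
  refine
    { diff_ζt := (hs.diff_t t ht r hr).fst
      diff_ζ := (hS.deriv_z r hr).differentiableAt
      diff_qt := (hs.diff_t t ht r hr).snd
      diff_q := (hS.deriv_y r hr).differentiableAt
      diff_dq := (hasDerivAt_congr_Ioi (fun ρ hρ => hS.dr_y hρ) hr
        (hS.deriv_e r hr)).differentiableAt
      diff_qtr := hv r hr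
      diff_dqt := hv' r hr
      diff_p := differentiableAt_const 0
      mass := (hpde r hr).1
      momentum := ?_ }
  have := heq r hr
  simp only [deriv_const, mul_zero, zero_add]
  linarith

/-- Both one-sided limits in the conservation of energy at the contact line. -/
theorem energy_cons (hP : P.Admissible) {t : ℝ} (ht : t ∈ Ico 0 T) :
    JumpZero P.R fun r =>
      glue P.R (pInt P T u Z) (fun _ _ => 0) t r
        + glue P.R (fun t _ => zetaInt P Z t) (fun t r => (u t r).1) t r
        + P.ν * dt T (fun s => glue P.R (fun t _ => zetaInt P Z t) (fun t r => (u t r).1) s r) t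
        + P.κ ^ 2 * dt T (dt T fun s =>
            glue P.R (fun t _ => zetaInt P Z t) (fun t r => (u t r).1) s r) t
        + P.ε / 2 * (glue P.R (qInt Z) (fun t r => (u t r).2) t r ^ 2
          / (1 + P.ε * glue P.R (fun t _ => zetaInt P Z t) (fun t r => (u t r).1) t r) ^ 2) := by
  have hR := hP.R_pos
  have hmass : ∀ s ∈ Ico 0 T, ∀ r, P.R < r → dt T (fun s => (u s r).1) s
      = -RegularExterior.drq P.R (fun t r => (u t r).2) s r := fun s hs' r hr => by
    have h1 := (hs.solvesBArAt_exterior h hP hs' hr).mass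
    rw [h.dr_eq_drq hs' hr] at h1
    linarith
  have hZ3 : ∀ s ∈ Ico 0 T,
      RegularExterior.drq P.R (fun t r => (u t r).2) s P.R = -Z s 3 := fun s hs' => by
    have h1 : dt T (fun s => (u s P.R).1) s = Z s 3 := by
      rw [dt_congr hs' fun s hs'' => hs.boundary_ζ h hs'', hs.dt_Z hs', (hs.rows hP hs').2.1]
    have h2 := h.dt_ζ_boundary hR hs' fun r hr => (hs.solvesBArAt_exterior h hP hs' hr).mass
    rw [h1] at h2
    linarith
  have hZ3' : RegularExterior.drqt P.R T (fun t r => (u t r).2) t P.R = -dt T Z t 3 := by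
    rw [← HasDerivWithinAt.dt_eq ht (h.hasDerivWithinAt_drq ht le_rfl), dt_congr ht hZ3]
    exact HasDerivWithinAt.dt_eq ht (hs.hasDerivWithinAt_Z ht 3).neg
  refine ⟨Z t 2 + P.ν * Z t 3 + P.κ ^ 2 * dt T Z t 3
    + P.ε / 2 * ((-(P.R / 2) * Z t 1) ^ 2 / (1 + P.ε * Z t 2) ^ 2), ?_, ?_⟩
  · have hζ := hs.bdry_ζ t ht
    have hdrq := tendsto_trace (h.continuousOn_drq hR ht)
    have hdrqt := tendsto_trace (h.continuousOn_drqt hR ht)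
    have hpos : (1 + P.ε * Z t 2) ^ 2 ≠ 0 := by
      rw [← hs.boundary_ζ h ht]
      exact (pow_pos (hs.height_ext t ht P.R le_rfl) 2).ne'
    have hright := ((hζ.add (hdrq.neg.const_mul P.ν)).add (hdrqt.neg.const_mul (P.κ ^ 2))).add
      ((((hs.bdry_q t ht).pow 2).div (((hζ.const_mul P.ε).const_add 1).pow 2)
        hpos).const_mul (P.ε / 2))
    rw [hZ3 t ht, hZ3', neg_neg, neg_neg] at hright
    refine hright.congr' ?_
    filter_upwards [self_mem_nhdsWithin] with r hr
    have hr' : P.R < r := hr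
    have e1 : (fun s => glue P.R (fun t _ => zetaInt P Z t) (fun t r => (u t r).1) s r)
        = fun s => (u s r).1 := funext fun s => glue_of_le hr'.le
    have h2 : dt T (dt T fun s => (u s r).1) t
        = -RegularExterior.drqt P.R T (fun t r => (u t r).2) t r := by
      rw [dt_congr ht fun s hs' => hmass s hs' r hr']
      exact HasDerivWithinAt.dt_eq ht (h.hasDerivWithinAt_drq ht hr'.le).neg
    rw [e1, h2, hmass t ht r hr', glue_of_le hr'.le, glue_of_le hr'.le, glue_of_le hr'.le, zero_add]
    rfl
  · have hleft : Tendsto (fun r : ℝ => pInt P T u Z t r + zetaInt P Z t + P.ν * Z t 1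
        + P.κ ^ 2 * dt T Z t 1 + P.ε / 2 * (qInt Z t r ^ 2 / (1 + P.ε * zetaInt P Z t) ^ 2))
        (𝓝[<] P.R) (𝓝 (pInt P T u Z t P.R + zetaInt P Z t + P.ν * Z t 1
        + P.κ ^ 2 * dt T Z t 1
        + P.ε / 2 * (qInt Z t P.R ^ 2 / (1 + P.ε * zetaInt P Z t) ^ 2))) := by
      refine Tendsto.mono_left ?_ nhdsWithin_le_nhds
      rw [funext fun r => hs.pInt_eq hP ht r]
      unfold qInt
      exact Continuous.tendsto (by fun_prop) P.R
    have e : pInt P T u Z t P.R + zetaInt P Z t + P.ν * Z t 1 + P.κ ^ 2 * dt T Z t 1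
        + P.ε / 2 * (qInt Z t P.R ^ 2 / (1 + P.ε * zetaInt P Z t) ^ 2)
        = Z t 2 + P.ν * Z t 3 + P.κ ^ 2 * dt T Z t 3
          + P.ε / 2 * ((-(P.R / 2) * Z t 1) ^ 2 / (1 + P.ε * Z t 2) ^ 2) := by
      rw [hs.pInt_eq hP ht, one_add_mul_zetaInt, zetaInt, qInt]
      ring
    rw [e] at hleft
    refine hleft.congr' ?_
    filter_upwards [self_mem_nhdsWithin] with r hr
    have hr' : r < P.R := hr
    have e1 : (fun s => glue P.R (fun t _ => zetaInt P Z t) (fun t r => (u t r).1) s r)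
        = zetaInt P Z := funext fun s => glue_of_lt hr'
    rw [e1, hs.dt_dt_zetaInt hP ht,
      HasDerivWithinAt.dt_eq ht (hs.hasDerivWithinAt_zetaInt hP ht), glue_of_lt hr',
      glue_of_lt hr', glue_of_lt hr']

theorem solvesWaveStructure (hP : P.Admissible) (hT : 0 < T) :
    SolvesWaveStructure P T F ζ₀ q₀ δ₀ δ₁
      (glue P.R (fun t _ => zetaInt P Z t) (fun t r => (u t r).1))
      (glue P.R (qInt Z) (fun t r => (u t r).2))
      (glue P.R (pInt P T u Z) (fun _ _ => 0)) (fun t => Z t 0) := by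
  have hR := hP.R_pos
  have h0T : (0 : ℝ) ∈ Ico 0 T := ⟨le_rfl, hT⟩
  have hdδ : ∀ t ∈ Ico 0 T, dt T (fun t => Z t 0) t = Z t 1 := fun t ht => by
    rw [hs.dt_Z ht, (hs.rows hP ht).1]
  have hddδ : ∀ t ∈ Ico 0 T, dt T (dt T fun t => Z t 0) t = dt T Z t 1 := fun t ht => by
    rw [dt_congr ht hdδ, hs.dt_Z ht]
  have hqc : ∀ t a, Tendsto (qInt Z t) (𝓝 a) (𝓝 (-(a / 2) * Z t 1)) := fun t a =>
    (by fun_prop : Continuous fun r : ℝ => -(r / 2) * Z t 1).tendsto a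
  refine
    { height_pos := fun t ht r _ => ?_
      bar := fun t ht r h0 hne => ?_
      interior_constraint := fun t _ r _ hr => glue_of_lt hr
      centre := fun t _ => ?_
      exterior_pressure := fun t _ r hr => glue_of_le hr.le
      diff_δ := fun t ht => (hs.hasDerivWithinAt_Z ht 0).differentiableWithinAt
      diff_dδ := fun t ht => ((hs.hasDerivWithinAt_Z ht 1).congr (fun s hs' => hdδ s hs')
        (hdδ t ht)).differentiableWithinAt
      newton := fun t ht => ?_
      volume_cons := fun t ht => ⟨-(P.R / 2) * Z t 1, ?_, ?_⟩
      energy_cons := fun t ht => hs.energy_cons h hP ht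
      no_vortex := fun t _ θ => ⟨0, ?_, ?_⟩
      init_ζ := fun r hr => ?_
      init_q := fun r hr => ?_
      init_δ := ?_
      init_dδ := ?_ }
  · rcases lt_or_ge r P.R with hr | hr
    · rw [glue_of_lt hr, one_add_mul_zetaInt]
      exact hs.height_int t ht
    · rw [glue_of_le hr]
      exact hs.height_ext t ht r hr
  · rcases lt_or_gt_of_ne hne with hr | hr
    · refine (hs.solvesBArAt_interior hP ht h0).congr ?_
      filter_upwards [Iio_mem_nhds hr] with ρ hρ s
      exact ⟨glue_of_lt hρ, glue_of_lt hρ, glue_of_lt hρ⟩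
    · refine (hs.solvesBArAt_exterior h hP ht hr).congr ?_
      filter_upwards [Ioi_mem_nhds hr] with ρ hρ s
      exact ⟨glue_of_le (le_of_lt hρ), glue_of_le (le_of_lt hρ), glue_of_le (le_of_lt hρ)⟩
  · have h1 := (hqc t 0).mono_left (nhdsWithin_le_nhds (s := Ioi 0))
    rw [zero_div, neg_zero, zero_mul] at h1
    refine h1.congr' ?_
    filter_upwards [Ioo_mem_nhdsGT hR] with r hr using (glue_of_lt hr.2).symm
  · rw [hddδ t ht, average_ball_quadratic hR fun r _ hr => by
      rw [glue_of_lt hr, hs.pInt_eq hP ht]]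
    refine (newton_iff_exact (hs.height_int t ht) ?_ ?_).2 (hs.rows hP ht).2.2.1
    · rw [← hs.boundary_ζ h ht]
      exact hs.height_ext t ht P.R le_rfl
    · ring
  · refine (hs.bdry_q t ht).congr' ?_
    filter_upwards [self_mem_nhdsWithin] with r hr
    exact (glue_of_le (fe := fun t r => (u t r).2) (le_of_lt hr)).symm
  · refine ((hqc t P.R).mono_left nhdsWithin_le_nhds).congr' ?_
    filter_upwards [self_mem_nhdsWithin] with r hr using (glue_of_lt hr).symm
  all_goals try
    refine tendsto_const_nhds.congr fun r => ?_
    simp only [cross, Prod.smul_fst, Prod.smul_snd, smul_eq_mul]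
    ring
  · rw [glue_of_le hr.le, hs.init_u r hr]
  · rw [glue_of_le hr.le, hs.init_u r hr]
  · rw [hs.init_Z]
    rfl
  · rw [hdδ 0 h0T, hs.init_Z]
    rfl

end

end SolvesAugmented

end FloatingCylinder

theorem theorem1p2 (P : FloatingCylinder.Params) (hP : P.Admissible) (T : ℝ) (hT : 0 < T)
    (F : ℝ → ℝ) (hF : ContinuousOn F (Set.Ico 0 T)) (hFb : ∃ C, ∀ t ∈ Set.Ico 0 T, |F t| ≤ C)
    (ζ₀ q₀ : ℝ → ℝ) (δ₀ δ₁ : ℝ) :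
    (∀ (ζ q p : ℝ → ℝ → ℝ) (δ : ℝ → ℝ),
      FloatingCylinder.RegularExterior P.R T ζ q →
      FloatingCylinder.SolvesWaveStructure P T F ζ₀ q₀ δ₀ δ₁ ζ q p δ →
      (∀ t ∈ Set.Ico 0 T, FloatingCylinder.NonlocalDefined P (fun r => (ζ t r, q t r))) ∧
      FloatingCylinder.SolvesAugmented P T F ζ₀ q₀ δ₀ δ₁
        (fun t r => (ζ t r, q t r)) (FloatingCylinder.bdryUnknown P T ζ δ)) ∧
    (∀ (u : ℝ → ℝ → ℝ × ℝ) (Z : ℝ → Fin 4 → ℝ),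
      FloatingCylinder.RegularExterior P.R T (fun t r => (u t r).1) (fun t r => (u t r).2) →
      FloatingCylinder.SolvesAugmented P T F ζ₀ q₀ δ₀ δ₁ u Z →
      FloatingCylinder.SolvesWaveStructure P T F ζ₀ q₀ δ₀ δ₁
        (FloatingCylinder.glue P.R (fun t _ => FloatingCylinder.zetaInt P Z t)
          (fun t r => (u t r).1))
        (FloatingCylinder.glue P.R (FloatingCylinder.qInt Z) (fun t r => (u t r).2))
        (FloatingCylinder.glue P.R (FloatingCylinder.pInt P T u Z) (fun _ _ => 0))
        (fun t => Z t 0)) :=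
  ⟨fun _ _ _ _ h hs => ⟨fun _ ht => hs.nonlocalDefined hP h ht, hs.solvesAugmented hP hT h⟩,
    fun _ _ h hs => hs.solvesWaveStructure h hP hT⟩
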